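/- **Setting.** A principal allocates an asset among $N$ agents. Agent $i$'s type $\theta_i$ is drawn independently from a distribution $F_i$ on $\Theta_i=[\underline\theta_i,\bar\theta_i]$, $\underline\theta_i<\bar\theta_i$, with continuous density $f_i$, positive on the interior; $\Theta=\prod_i\Theta_i$. If type $\theta_i$ wins, his income $\pi_i$ is drawn from a distribution $G_i(\cdot|\theta_i)$ on $\Pi_i(\theta_i)=[\underline\pi_i(\theta_i),\bar\pi_i(\theta_i)]$, $0\le\underline\pi_i(\theta_i)<\bar\pi_i(\theta_i)\le\infty$ (right-open if $\bar\pi_i(\theta_i)=\infty$), with continuous density $g_i(\cdot|\theta_i)$, positive on the interior, and with mean $\mathbf E[\pi_i|\theta_i]=\theta_i$. Let $\Pi_i=\bigcup_{\theta_i}\Pi_i(\theta_i)$. For $\pi_i\in\Pi_i$, $G_i(\pi_i|\theta_i)$ is continuously differentiable in $\theta_i$, except possibly where $\pi_i$ is an end point of $\Pi_i(\theta_i)$, with derivative $G_{i,2}<0$ for interior $\theta_i$ and interior $\pi_i$; and $|G_i(\pi_i|\theta_i)-G_i(\pi_i|\theta_i')|\le b_i(\pi_i)|\theta_i-\theta_i'|$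 for some Lebesgue integrable $b_i$ on $\Pi_i$. Auditing agent $i$ costs $c_i$; $\phi_i\in[0,1]$. **Mechanisms.** Let $\mathcal H_i=\{(\theta',\pi_i'):\theta'\in\Theta,\ \pi_i'\in\Pi_i(\theta_i')\}$. A mechanism consists of measurable rules $q:\Theta\to\{x\in\mathbf R_+^N:\sum_i x_i\le1\}$ (allocation), $t:\Theta\to\mathbf R^N$ (transfers), $r_i:\mathcal H_i\to\mathbf R$ (royalties), $a_i:\mathcal H_i\to[0,1]$ (audit probability), and $p_i:\mathcal H_i\times\Pi_i\to\mathbf R$ (penalties), for which the expected payments are finite. *Generalized double monotonicity* requires $0\le p_i(\theta',\pi_i',\hat\pi_i)-p_i(\theta',\pi_i',\pi_i)\le\phi_i(\hat\pi_i-\pi_i)$ whenever $\hat\pi_i>\pi_i$. Let $$u_i(\theta_i',\pi_i'|\pi_i)=\mathbf E_{\theta_{-i}}\big[q_i(\theta_i',\theta_{-i})\big(\pi_i-r_i(\theta_i',\theta_{-i},\pi_i')-a_i(\theta_i',\theta_{-i},\pi_i')\,p_i(\theta_i',\theta_{-i},\pi_i',\pi_i)\big)\big],$$ $U_i(\theta_i'|\theta_i)=\mathbf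 E_{\pi_i|\theta_i}[u_i(\theta_i',\mathrm{proj}_{\Pi_i(\theta_i')}\pi_i|\pi_i)]$ and $T_i(\theta_i')=\mathbf E_{\theta_{-i}}[t_i(\theta_i',\theta_{-i})]$. The principal maximizes $$\sum_i\mathbf E_\theta\big[t_i(\theta)+q_i(\theta)\,\mathbf E_{\pi_i|\theta_i}[r_i(\theta,\pi_i)+a_i(\theta,\pi_i)(p_i(\theta,\pi_i,\pi_i)-c_i)]\big]$$ over mechanisms that satisfy generalized double monotonicity and, for each $i$: $u_i(\theta_i,\pi_i|\pi_i)\ge u_i(\theta_i,\pi_i'|\pi_i)$ for $\pi_i,\pi_i'\in\Pi_i(\theta_i)$; $U_i(\theta_i|\theta_i)-T_i(\theta_i)\ge U_i(\theta_i'|\theta_i)-T_i(\theta_i')$; and $U_i(\theta_i|\theta_i)-T_i(\theta_i)\ge0$, for all $\theta_i,\theta_i'\in\Theta_i$. **Noisy auditing.** An audit of a winner with income $\pi_i$ reveals only a signal $\zeta_i$ whose law given $\pi_i$ satisfies $\mathbf E[\zeta_i|\pi_i]=\pi_i$ and is increasing in $\pi_i\in\Pi_i$ in the first-order stochastic dominance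 order. Let $Z_i$ be the support of the signal. Penalty rules are now $\tilde p_i:\mathcal H_i\times Z_i\to\mathbf R$ and must satisfy generalized double monotonicity in the signal. Utilities and the payoff are defined as before, with the penalty evaluated at $\zeta_i$ and an additional expectation over $\zeta_i$ given $\pi_i$; the constraints are the same. The *effective penalty rule* of $\tilde p_i$ is $p_i(\theta,\pi_i',\pi_i)=\mathbf E_{\zeta_i|\pi_i}[\tilde p_i(\theta,\pi_i',\zeta_i)]$. **The mechanism.** For $\pi_i$ in the interior of $\Pi_i(\theta_i)$ put $$\mu_i(\theta_i,\pi_i)=-\frac{G_{i,2}(\pi_i|\theta_i)}{g_i(\pi_i|\theta_i)}\cdot\frac{1-F_i(\theta_i)}{f_i(\theta_i)},\qquad \psi_i(\theta_i)=\theta_i-\frac{1-F_i(\theta_i)}{f_i(\theta_i)}+\mathbf E_{\pi_i|\theta_i}\big[(\mu_i(\theta_i,\pi_i)\phi_i-c_i)_+\big]$$ (with $(1-F_i)/f_i=0$ at $\bar\theta_i$, and $\psi_i(\underline\theta_i)=-\infty$ if $f_i(\underline\theta_i)=0$), $$\pi_i^*(\theta_i)=0\vee\sup\{\pi_i\in\operatorname{int}\Pi_i(\theta_i):\mu_i(\theta_i,\pi_i)\phi_i\ge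 c_i\},\qquad \Phi_i(\theta_i)=-\phi_i\int_0^{\pi_i^*(\theta_i)}G_{i,2}(\pi_i|\theta_i)\,d\pi_i .$$ Assume regularity: for each $i$, $\mu_i\phi_i-c_i$ is single-crossing from above in $\theta_i$ and in $\pi_i$ at interior points ($h$ is single-crossing from above if for $z<z'$, $h(z)\le0$ implies $h(z')\le0$ and $h(z)<0$ implies $h(z')<0$), and $\psi_i$ is strictly increasing on $\Theta_i$. Let - $q_i^*(\theta)=1$ if $\psi_i(\theta_i)>0$ and $\psi_i(\theta_i)>\psi_j(\theta_j)$ for all $j\ne i$, and $q_i^*(\theta)=0$ otherwise; - $a_i^*(\theta,\pi_i')=1$ if $\pi_i'<\pi_i^*(\theta_i)$ or $\pi_i'=\pi_i^*(\theta_i)=\bar\pi_i(\theta_i)$, and $a_i^*(\theta,\pi_i')=0$ otherwise; - $r_i^*(\theta,\pi_i')=\min\{\pi_i',\pi_i^*(\theta_i)\}\phi_i$ and $p_i^*(\theta,\pi_i',\pi_i)=(\pi_i-\pi_i')\phi_i$; - $t_i^*(\theta)=q_i^*(\theta)\,\mathbf E_{\pi_i|\theta_i}[\pi_i-r_i^*(\theta,\pi_i)]-\int_{\underline\theta_i}^{\theta_i}q_i^*(z_i,\theta_{-i})[1-\Phi_i(z_i)]\,dz_i$.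 **Theorem.** Under these assumptions: 1. If $\tilde p$ satisfies generalized double monotonicity (in the signal), then so does its effective penalty rule (in income). 2. If a mechanism is feasible under noisy auditing, then replacing its penalty rule by the effective one gives a mechanism that is feasible under perfect auditing, with the same utilities $u_i$ and the same payoff of the principal. 3. The effective penalty rule of $\tilde p_i^*(\theta,\pi_i',\zeta_i)=(\zeta_i-\pi_i')\phi_i$ is $p_i^*$. 4. $(q^*,t^*,r^*,a^*,p^*)$ is optimal for the principal under perfect auditing, $(q^*,t^*,r^*,a^*,\tilde p^*)$ is optimal under noisy auditing, and the two have the same payoff. -/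

import Mathlib

open MeasureTheory ProbabilityTheory Set

noncomputable section

namespace CostlyAudit

/-! ### One agent: primitives -/

/-- The primitives of one agent. Types lie in `[tLo, tHi]` with density `f`. Given type `θ`, income
lies in the interval from `iLo θ` to `iHi θ` (closed at every finite end) with density `g θ`.
`c` is the auditing cost and `φ` the maximal penalty sensitivity. -/
structure Agent where
  tLo : ℝ
  tHi : ℝ
  f : ℝ → ℝ
  iLo : ℝ → ℝ
  iHi : ℝ → EReal
  g : ℝ → ℝ → ℝ
  c : ℝ
  φ : ℝ

namespace Agent

variable (A : Agent)

/-- The type space `Θᵢ`. -/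
def types : Set ℝ := Icc A.tLo A.tHi

/-- The support `Πᵢ(θ)` of income given type `θ`. -/
def incomes (θ : ℝ) : Set ℝ := {x | A.iLo θ ≤ x ∧ (x : EReal) ≤ A.iHi θ}

/-- The interior of `Πᵢ(θ)`. -/
def incomesInt (θ : ℝ) : Set ℝ := {x | A.iLo θ < x ∧ (x : EReal) < A.iHi θ}

/-- `Πᵢ`, the union of all the income supports. -/
def allIncomes : Set ℝ := ⋃ θ ∈ A.types, A.incomes θ

/-- The type distribution. -/
def typeLaw : Measure ℝ :=
  (volume.restrict A.types).withDensity fun x => ENNReal.ofReal (A.f x)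

/-- The conditional income distribution `Gᵢ(· | θ)`. -/
def incomeLaw (θ : ℝ) : Measure ℝ :=
  (volume.restrict (A.incomes θ)).withDensity fun x => ENNReal.ofReal (A.g θ x)

/-- The distribution function `Fᵢ`. -/
def F (θ : ℝ) : ℝ := A.typeLaw.real (Iic θ)

/-- The conditional distribution function: `A.G θ x` is `Gᵢ(x | θ)`. -/
def G (θ x : ℝ) : ℝ := (A.incomeLaw θ).real (Iic x)

/-- The partial derivative of `Gᵢ(x | θ)` with respect to the type (one-sided at the end points
of the type space). -/
def G₂ (θ x : ℝ) : ℝ := derivWithin (fun t => A.G t x) A.types θ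

/-- The standing assumptions on one agent. -/
structure Valid : Prop where
  types_lt : A.tLo < A.tHi
  f_cont : ContinuousOn A.f A.types
  f_pos : ∀ θ ∈ Ioo A.tLo A.tHi, 0 < A.f θ
  typeLaw_prob : IsProbabilityMeasure A.typeLaw
  iLo_nonneg : ∀ θ ∈ A.types, 0 ≤ A.iLo θ
  iLo_lt_iHi : ∀ θ ∈ A.types, (A.iLo θ : EReal) < A.iHi θ
  g_cont : ∀ θ ∈ A.types, ContinuousOn (A.g θ) (A.incomes θ)
  g_pos : ∀ θ ∈ A.types, ∀ x ∈ A.incomesInt θ, 0 < A.g θ x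
  incomeLaw_prob : ∀ θ ∈ A.types, IsProbabilityMeasure (A.incomeLaw θ)
  income_integrable : ∀ θ ∈ A.types, Integrable (fun x => x) (A.incomeLaw θ)
  /-- Normalization: the type is the expected income. -/
  income_mean : ∀ θ ∈ A.types, ∫ x, x ∂(A.incomeLaw θ) = θ
  /-- `Gᵢ(x | ·)` is continuously differentiable; nothing is required at a type for which `x` is an
  end point of the income support. -/
  G_diff : ∀ x ∈ A.allIncomes, ∀ θ ∈ A.types, x ≠ A.iLo θ → (x : EReal) ≠ A.iHi θ →
    DifferentiableWithinAt ℝ (fun t => A.G t x) A.types θ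
  G₂_cont : ∀ x ∈ A.allIncomes,
    ContinuousOn (fun θ => A.G₂ θ x) {θ | θ ∈ A.types ∧ x ≠ A.iLo θ ∧ (x : EReal) ≠ A.iHi θ}
  G₂_neg : ∀ θ ∈ Ioo A.tLo A.tHi, ∀ x ∈ A.incomesInt θ, A.G₂ θ x < 0
  /-- Integrable Lipschitz bound (it holds if `|G₂| ≤ b` everywhere). -/
  G_bound : ∃ b : ℝ → ℝ, IntegrableOn b A.allIncomes ∧ ∀ x ∈ A.allIncomes,
    ∀ θ ∈ A.types, ∀ θ' ∈ A.types, |A.G θ x - A.G θ' x| ≤ b x * |θ - θ'|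
  φ_mem : A.φ ∈ Icc (0 : ℝ) 1

/-- The point of `Πᵢ(θ')` closest to `x`. -/
def proj (θ' x : ℝ) : ℝ := max (A.iLo θ') (min (x : EReal) (A.iHi θ')).toReal

/-- The inverse hazard rate of the type distribution. -/
def invHazard (θ : ℝ) : ℝ := (1 - A.F θ) / A.f θ

def mu (θ x : ℝ) : ℝ := -(A.G₂ θ x / A.g θ x) * A.invHazard θ

/-- The virtual value. The value is `-∞` at the lowest type if the density vanishes there,
since the inverse hazard rate is infinite in that case. -/
def virtualValue (θ : ℝ) : EReal :=
  open Classical in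
  if θ = A.tLo ∧ A.f θ = 0 then ⊥
  else ((θ - A.invHazard θ + ∫ x, max (A.mu θ x * A.φ - A.c) 0 ∂(A.incomeLaw θ) : ℝ) : EReal)

/-- `h` is single-crossing from above on `S`. -/
def SingleCrossing (h : ℝ → ℝ) (S : Set ℝ) : Prop :=
  ∀ z ∈ S, ∀ z' ∈ S, z < z' → (h z ≤ 0 → h z' ≤ 0) ∧ (h z < 0 → h z' < 0)

/-- The regularity assumption. -/
structure Regular : Prop where
  crossing_type : ∀ x, SingleCrossing (fun θ => A.mu θ x * A.φ - A.c)
    {θ | θ ∈ Ioo A.tLo A.tHi ∧ x ∈ A.incomesInt θ}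
  crossing_income : ∀ θ ∈ Ioo A.tLo A.tHi,
    SingleCrossing (fun x => A.mu θ x * A.φ - A.c) (A.incomesInt θ)
  virtualValue_mono : StrictMonoOn A.virtualValue A.types

/-- The auditing threshold, with values in `[0, ∞]`. -/
def threshold (θ : ℝ) : EReal :=
  max 0 (sSup ((fun x : ℝ => (x : EReal)) '' {x | x ∈ A.incomesInt θ ∧ A.c ≤ A.mu θ x * A.φ}))

def capPhi (θ : ℝ) : ℝ :=
  -A.φ * ∫ x in {x : ℝ | 0 < x ∧ (x : EReal) ≤ A.threshold θ}, A.G₂ θ x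

end Agent

/-! ### Mechanisms -/

/-- A direct mechanism. `q i θ` and `t i θ` are the allocation probability and the upfront transfer
of agent `i`; `r i θ x` and `a i θ x` are the royalty and the auditing probability after the income
report `x`; `p i θ x y` is the penalty if the audit shows `y` (the true income under perfect
auditing, the signal under noisy auditing). Values off the sets of report histories are ignored. -/
structure Mechanism (N : ℕ) where
  q : Fin N → (Fin N → ℝ) → ℝ
  t : Fin N → (Fin N → ℝ) → ℝ
  r : Fin N → (Fin N → ℝ) → ℝ → ℝ
  a : Fin N → (Fin N → ℝ) → ℝ → ℝ
  p : Fin N → (Fin N → ℝ) → ℝ → ℝ → ℝ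

variable {N : ℕ} (A : Fin N → Agent)

/-- The set `Θ` of type profiles. -/
def profiles : Set (Fin N → ℝ) := {θ | ∀ i, θ i ∈ (A i).types}

/-- The law of the type profile: types are independent. -/
def profileLaw : Measure (Fin N → ℝ) := Measure.pi fun i => (A i).typeLaw

/-- The set of report histories of agent `i`. -/
def histories (i : Fin N) : Set ((Fin N → ℝ) × ℝ) :=
  {h | h.1 ∈ profiles A ∧ h.2 ∈ (A i).incomes (h.1 i)}

/-- The profile `(s, θ₋ᵢ)`. Since types are independent, the expectation over the other agents' types
is the integral over `θ` of an expression in `repl θ i s`, which does not depend on `θ i`. -/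
def repl (θ : Fin N → ℝ) (i : Fin N) (s : ℝ) : Fin N → ℝ := Function.update θ i s

/-- Generalized double monotonicity, for penalties that depend on an audit outcome in `Y i`. -/
def DoubleMonotone (Y : Fin N → Set ℝ) (m : Mechanism N) : Prop :=
  ∀ i, ∀ h ∈ histories A i, ∀ y ∈ Y i, ∀ y' ∈ Y i, y < y' →
    0 ≤ m.p i h.1 h.2 y' - m.p i h.1 h.2 y ∧
      m.p i h.1 h.2 y' - m.p i h.1 h.2 y ≤ (y' - y) * (A i).φ

/-- The rules are measurable, have their values in the prescribed sets, and the transfers are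
integrable, ex ante and interim. Audit outcomes of agent `i` lie in `Y i`. -/
structure WellDefined (Y : Fin N → Set ℝ) (m : Mechanism N) : Prop where
  q_nonneg : ∀ θ ∈ profiles A, ∀ i, 0 ≤ m.q i θ
  q_sum : ∀ θ ∈ profiles A, ∑ i, m.q i θ ≤ 1
  a_mem : ∀ i, ∀ h ∈ histories A i, m.a i h.1 h.2 ∈ Icc (0 : ℝ) 1
  q_meas : ∀ i, Measurable fun θ : profiles A => m.q i θ
  t_meas : ∀ i, Measurable fun θ : profiles A => m.t i θ
  r_meas : ∀ i, Measurable fun h : histories A i => m.r i h.1.1 h.1.2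
  a_meas : ∀ i, Measurable fun h : histories A i => m.a i h.1.1 h.1.2
  p_meas : ∀ i, Measurable fun h : ↥(histories A i ×ˢ Y i) => m.p i h.1.1.1 h.1.1.2 h.1.2
  t_integrable : ∀ i, Integrable (m.t i) (profileLaw A)
  t_interim : ∀ i, ∀ s ∈ (A i).types, Integrable (fun θ => m.t i (repl θ i s)) (profileLaw A)

/-- The interim transfer `Tᵢ`. -/
def interimTransfer (m : Mechanism N) (i : Fin N) (s : ℝ) : ℝ :=
  ∫ θ, m.t i (repl θ i s) ∂(profileLaw A)

/-- `U i s' s`: expected gross utility of type `s` who reports `s'` and then reports income as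
truthfully as possible, if `u i s' x' x` is the utility `uᵢ(s', x' | x)`. -/
def expUtility (u : Fin N → ℝ → ℝ → ℝ → ℝ) (i : Fin N) (s' s : ℝ) : ℝ :=
  ∫ x, u i s' ((A i).proj s' x) x ∂((A i).incomeLaw s)

/-- The constraints of the principal's program, for given utilities `uᵢ(s', x' | x)`. -/
structure Incentives (u : Fin N → ℝ → ℝ → ℝ → ℝ) (m : Mechanism N) : Prop where
  ic_income : ∀ i, ∀ s ∈ (A i).types, ∀ x ∈ (A i).incomes s, ∀ x' ∈ (A i).incomes s,
    u i s x' x ≤ u i s x x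
  ic_type : ∀ i, ∀ s ∈ (A i).types, ∀ s' ∈ (A i).types,
    expUtility A u i s' s - interimTransfer A m i s' ≤
      expUtility A u i s s - interimTransfer A m i s
  ir : ∀ i, ∀ s ∈ (A i).types, 0 ≤ expUtility A u i s s - interimTransfer A m i s

/-! ### Perfect auditing -/

/-- The utility `uᵢ(s', x' | x)`. -/
def utility (m : Mechanism N) (i : Fin N) (s' x' x : ℝ) : ℝ :=
  ∫ θ, m.q i (repl θ i s') * (x - m.r i (repl θ i s') x'
    - m.a i (repl θ i s') x' * m.p i (repl θ i s') x' x) ∂(profileLaw A)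

/-- The principal's expected payoff. -/
def payoff (m : Mechanism N) : ℝ :=
  ∑ i, ∫ θ, (m.t i θ + m.q i θ * ∫ x, (m.r i θ x + m.a i θ x * (m.p i θ x x - (A i).c))
    ∂((A i).incomeLaw (θ i))) ∂(profileLaw A)

/-- The contingent payments have finite expectations: for the agents' utilities and ex ante. -/
structure FinitePayments (m : Mechanism N) : Prop where
  interim : ∀ i, ∀ s ∈ (A i).types, ∀ x' ∈ (A i).incomes s, ∀ x ∈ (A i).allIncomes,
    ∫⁻ θ, ‖m.q i (repl θ i s) * (m.r i (repl θ i s) x'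
      + m.a i (repl θ i s) x' * m.p i (repl θ i s) x' x)‖ₑ ∂(profileLaw A) < ⊤
  exAnte : ∀ i, ∫⁻ θ, ∫⁻ x, ‖m.q i θ * (m.r i θ x + m.a i θ x * m.p i θ x x)‖ₑ
    ∂((A i).incomeLaw (θ i)) ∂(profileLaw A) < ⊤

/-- Feasibility in the principal's program with perfect auditing. -/
structure Feasible (m : Mechanism N) : Prop where
  wellDefined : WellDefined A (fun i => (A i).allIncomes) m
  finite : FinitePayments A m
  doubleMonotone : DoubleMonotone A (fun i => (A i).allIncomes) m
  incentives : Incentives A (utility A m) m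

/-- Optimality in the principal's program with perfect auditing. -/
def Optimal (m : Mechanism N) : Prop :=
  Feasible A m ∧ ∀ m', Feasible A m' → payoff A m' ≤ payoff A m

/-! ### Noisy auditing -/

variable (K : Fin N → Kernel ℝ ℝ)

/-- The audit signal of agent `i` has law `K i x` if the true income is `x`. It is unbiased, and its
law is increasing in the true income in the (first-order) stochastic dominance order. -/
structure ValidSignal : Prop where
  markov : ∀ i, IsMarkovKernel (K i)
  integrable : ∀ i, ∀ x ∈ (A i).allIncomes, Integrable (fun z => z) (K i x)
  unbiased : ∀ i, ∀ x ∈ (A i).allIncomes, ∫ z, z ∂(K i x) = x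
  dominance : ∀ i, ∀ x ∈ (A i).allIncomes, ∀ y ∈ (A i).allIncomes, x < y →
    ∀ z, K i y (Iic z) ≤ K i x (Iic z)

/-- The support `Zᵢ` of the signal: the smallest closed set that carries all its conditional laws. -/
def signalSupport (i : Fin N) : Set ℝ := closure (⋃ x ∈ (A i).allIncomes, (K i x).support)

/-- The utility `uᵢ(s', x' | x)` under noisy auditing. -/
def noisyUtility (m : Mechanism N) (i : Fin N) (s' x' x : ℝ) : ℝ :=
  ∫ θ, ∫ z, m.q i (repl θ i s') * (x - m.r i (repl θ i s') x'
    - m.a i (repl θ i s') x' * m.p i (repl θ i s') x' z) ∂(K i x) ∂(profileLaw A)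

/-- The principal's expected payoff under noisy auditing. -/
def noisyPayoff (m : Mechanism N) : ℝ :=
  ∑ i, ∫ θ, (m.t i θ + m.q i θ * ∫ x, ∫ z, (m.r i θ x + m.a i θ x * (m.p i θ x z - (A i).c))
    ∂(K i x) ∂((A i).incomeLaw (θ i))) ∂(profileLaw A)

/-- The contingent payments have finite expectations under noisy auditing. -/
structure NoisyFinitePayments (m : Mechanism N) : Prop where
  interim : ∀ i, ∀ s ∈ (A i).types, ∀ x' ∈ (A i).incomes s, ∀ x ∈ (A i).allIncomes,
    ∫⁻ θ, ∫⁻ z, ‖m.q i (repl θ i s) * (m.r i (repl θ i s) x'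
      + m.a i (repl θ i s) x' * m.p i (repl θ i s) x' z)‖ₑ ∂(K i x) ∂(profileLaw A) < ⊤
  exAnte : ∀ i, ∫⁻ θ, ∫⁻ x, ∫⁻ z, ‖m.q i θ * (m.r i θ x + m.a i θ x * m.p i θ x z)‖ₑ
    ∂(K i x) ∂((A i).incomeLaw (θ i)) ∂(profileLaw A) < ⊤

/-- Feasibility in the principal's program with noisy auditing. -/
structure NoisyFeasible (m : Mechanism N) : Prop where
  wellDefined : WellDefined A (signalSupport A K) m
  finite : NoisyFinitePayments A K m
  doubleMonotone : DoubleMonotone A (signalSupport A K) m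
  incentives : Incentives A (noisyUtility A K m) m

/-- Optimality in the principal's program with noisy auditing. -/
def NoisyOptimal (m : Mechanism N) : Prop :=
  NoisyFeasible A K m ∧ ∀ m', NoisyFeasible A K m' → noisyPayoff A K m' ≤ noisyPayoff A K m

/-- The mechanism with the effective penalty rule: the expected penalty given the true income. -/
def effective (m : Mechanism N) : Mechanism N :=
  { m with p := fun i θ x' x => ∫ z, m.p i θ x' z ∂(K i x) }

/-! ### The optimal mechanism -/

open Classical in
/-- Agent `i` wins if his virtual value exceeds zero and the virtual values of all others. -/
def starQ (i : Fin N) (θ : Fin N → ℝ) : ℝ :=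
  if 0 < (A i).virtualValue (θ i) ∧
    ∀ j, j ≠ i → max ((A j).virtualValue (θ j)) 0 < (A i).virtualValue (θ i) then 1 else 0

/-- Linear royalties up to the cap. -/
def starR (i : Fin N) (θ : Fin N → ℝ) (x' : ℝ) : ℝ :=
  (min (x' : EReal) ((A i).threshold (θ i))).toReal * (A i).φ

open Classical in
/-- Audit below the threshold. If the threshold is the top of the income support, so that auditing
is worthwhile at every income, the top report is audited too. -/
def starA (i : Fin N) (θ : Fin N → ℝ) (x' : ℝ) : ℝ :=
  if (x' : EReal) < (A i).threshold (θ i) ∨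
    ((x' : EReal) = (A i).threshold (θ i) ∧ (A i).threshold (θ i) = (A i).iHi (θ i)) then 1 else 0

/-- The upfront transfers. -/
def starT (i : Fin N) (θ : Fin N → ℝ) : ℝ :=
  starQ A i θ * (∫ x, (x - starR A i θ x) ∂((A i).incomeLaw (θ i)))
    - ∫ z in (A i).tLo..(θ i), starQ A i (repl θ i z) * (1 - (A i).capPhi z)

/-- The optimal mechanism. The last argument of the penalty rule is the audit outcome: the true income
under perfect auditing, the signal under noisy auditing. -/
def star : Mechanism N where
  q := starQ A
  t := starT A
  r := starR A
  a := starA A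
  p := fun i _ x' y => (y - x') * (A i).φ

end CostlyAudit

end

noncomputable section

namespace CostlyAudit

open Filter Topology

/-! ### Stochastic dominance and primitives -/

/-! Under perfect auditing this is a Myerson argument with audits as a second instrument. Fix a
feasible mechanism and an agent. Let Q(s) be the interim probability that type s wins, B(s,x) the
probability that he wins and is audited after reporting income x, and V(s) his interim net utility.
At a fixed report, generalized double monotonicity confines the slope of utility in true income to
[Q − φB, Q]. Since a richer agent can imitate the report of a poorer one, truthful utility also has
slope at least Q − φB (`truthful_sub_mem`). The type matters only through the law of income, and −G₂
is a probability density in income because the type is the mean (`integral_neg_G₂`). The first-order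
condition for type reports then gives V'(z) ≥ Q(z) − φ ∫ B(z,x) (−G₂(x|z)) dx
(`le_deriv_netUtility`).

The payoff from the agent is the expectation of sQ(s) − V(s) − c E[B(s,x)] (`agentPayoff_eq`).
Integrating V by parts against the type law brings in the inverse hazard rate, and B ends up
multiplied by μφ − c. As 0 ≤ B ≤ Q, the payoff is at most E[Qψ] (`agentPayoff_le`). Summed over
agents, the bound is largest when the highest positive virtual value wins
(`sum_mul_le_sum_starQ_mul`); ties are null.

The proposed mechanism attains this bound, so what remains is its feasibility. After the type report
θ its contingent payments amount to φ min(x, τ) at every nonnegative income x, even outside the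
reported support, with τ the extended threshold (`contingentPay_proj`). Rents have slope Q(z)(1 −
Φ(z)). Global incentive compatibility holds because Q is nondecreasing and higher types are audited
on smaller sets of incomes (`mul_netIncome_sub_le`). The second fact rests on regularity but is not
immediate: single crossing compares two types only at incomes interior to both supports, and only
for interior types. A chain of overlapping supports covers distant types (`auditWorthy_of_lt`), and
a limit covers the lowest one (`le_threshold_tLo`).

Noisy auditing reduces to this case. On the signal support both the penalty and φz minus the penalty
are nondecreasing, so dominance and unbiasedness pass double monotonicity to the conditional mean
(`doubleMonotone_effective`). Utilities and payoff are affine in the penalty, so a noisy mechanism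
earns exactly what its effective version earns. The linear penalty averages back to itself, so the
bound is attained again. -/

theorem measure_lowerSet_le_of_dominance {ν₁ ν₂ : Measure ℝ} [IsProbabilityMeasure ν₁]
    [IsProbabilityMeasure ν₂] (h : ∀ z, ν₂ (Iic z) ≤ ν₁ (Iic z)) {L : Set ℝ} (hL : IsLowerSet L) :
    ν₂ L ≤ ν₁ L := by
  rcases L.eq_empty_or_nonempty with rfl | hne
  · simp
  by_cases hb : BddAbove L
  · by_cases ha : sSup L ∈ L
    · have : L = Iic (sSup L) :=
        Subset.antisymm (fun x hx => le_csSup hb hx) (fun x hx => hL hx ha)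
      rw [this]
      exact h _
    -- A bounded lower set without its supremum is an increasing union of closed half-lines, so
    -- continuity from below transfers the inequality.
    · have hL' : L = ⋃ n : ℕ, Iic (sSup L - 1 / ((n : ℝ) + 1)) := by
        ext x
        simp only [mem_iUnion, mem_Iic]
        constructor
        · intro hx
          have hlt : x < sSup L := lt_of_le_of_ne (le_csSup hb hx) (fun e => ha (e ▸ hx))
          obtain ⟨n, hn⟩ := exists_nat_one_div_lt (sub_pos.2 hlt)
          exact ⟨n, by linarith⟩
        · rintro ⟨n, hn⟩
          have hlt : x < sSup L := by
            have : (0 : ℝ) < 1 / ((n : ℝ) + 1) := by positivity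
            linarith
          obtain ⟨y, hy, hxy⟩ := exists_lt_of_lt_csSup hne hlt
          exact hL hxy.le hy
      have hmono : Monotone fun n : ℕ => Iic (sSup L - 1 / ((n : ℝ) + 1)) := by
        intro m n hmn
        apply Iic_subset_Iic.2
        have : 1 / ((n : ℝ) + 1) ≤ 1 / ((m : ℝ) + 1) := by
          apply one_div_le_one_div_of_le (by positivity)
          have : (m : ℝ) ≤ n := by exact_mod_cast hmn
          linarith
        linarith
      rw [hL']
      exact le_of_tendsto_of_tendsto' (tendsto_measure_iUnion_atTop hmono)
        (tendsto_measure_iUnion_atTop hmono) (fun n => h _)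
  · have : L = univ := by
      refine eq_univ_of_forall fun x => ?_
      obtain ⟨y, hy, hxy⟩ := not_bddAbove_iff.1 hb x
      exact hL hxy.le hy
    simp [this]

theorem measure_upperSet_le_of_dominance {ν₁ ν₂ : Measure ℝ} [IsProbabilityMeasure ν₁]
    [IsProbabilityMeasure ν₂] (h : ∀ z, ν₂ (Iic z) ≤ ν₁ (Iic z)) {U : Set ℝ} (hU : IsUpperSet U) :
    ν₁ U ≤ ν₂ U := by
  have hm : MeasurableSet U := hU.ordConnected.measurableSet
  have h1 := measure_lowerSet_le_of_dominance h hU.compl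
  rw [prob_compl_eq_one_sub hm, prob_compl_eq_one_sub hm] at h1
  have e1 : ν₁ U ≤ 1 := prob_le_one
  by_contra hlt
  push Not at hlt
  have e2 : ν₁ U ≤ ν₁ U + (1 - ν₁ U) - (1 - ν₁ U) := by
    rw [ENNReal.add_sub_cancel_right (ne_top_of_le_ne_top ENNReal.one_ne_top tsub_le_self)]
  rw [add_tsub_cancel_of_le e1] at e2
  refine absurd (e2.trans (tsub_le_tsub_left h1 1)) (not_le.2 ?_)
  rwa [ENNReal.sub_sub_cancel ENNReal.one_ne_top prob_le_one]

/-- Monotonicity on a set carrying both laws is enough: the upper set generated by the superlevel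
set inside `S` agrees with it on `S`. Penalties are controlled only on the signal support, so this
generality is needed. -/
theorem measure_superlevel_le_of_dominance {ν₁ ν₂ : Measure ℝ} [IsProbabilityMeasure ν₁]
    [IsProbabilityMeasure ν₂] (h : ∀ z, ν₂ (Iic z) ≤ ν₁ (Iic z)) {S : Set ℝ}
    (h₁ : ∀ᵐ x ∂ν₁, x ∈ S) (h₂ : ∀ᵐ x ∂ν₂, x ∈ S) {f : ℝ → ℝ} (hf : MonotoneOn f S) (t : ℝ) :
    ν₁ {x | t < f x} ≤ ν₂ {x | t < f x} := by
  set U : Set ℝ := {x | ∃ y ∈ S, t < f y ∧ y ≤ x} with hUdef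
  have hU : IsUpperSet U := by
    rintro x y hxy ⟨z, hz, hz1, hz2⟩
    exact ⟨z, hz, hz1, hz2.trans hxy⟩
  have key : ∀ x ∈ S, (x ∈ {x | t < f x}) = (x ∈ U) := by
    intro x hx
    refine propext ⟨fun hlt => ⟨x, hx, hlt, le_rfl⟩, ?_⟩
    rintro ⟨y, hy, hty, hyx⟩
    exact lt_of_lt_of_le hty (hf hy hx hyx)
  have e1 : ν₁ {x | t < f x} = ν₁ U := measure_congr (h₁.mono fun x hx => key x hx)
  have e2 : ν₂ {x | t < f x} = ν₂ U := measure_congr (h₂.mono fun x hx => key x hx)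
  rw [e1, e2]
  exact measure_upperSet_le_of_dominance h hU

theorem measure_superlevel_ge_of_dominance {ν₁ ν₂ : Measure ℝ} [IsProbabilityMeasure ν₁]
    [IsProbabilityMeasure ν₂] (h : ∀ z, ν₂ (Iic z) ≤ ν₁ (Iic z)) {S : Set ℝ}
    (h₁ : ∀ᵐ x ∂ν₁, x ∈ S) (h₂ : ∀ᵐ x ∂ν₂, x ∈ S) {f : ℝ → ℝ} (hf : AntitoneOn f S) (t : ℝ) :
    ν₂ {x | t < f x} ≤ ν₁ {x | t < f x} := by
  set U : Set ℝ := {x | ∃ y ∈ S, t < f y ∧ x ≤ y} with hUdef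
  have hU : IsLowerSet U := by
    rintro x y hxy ⟨z, hz, hz1, hz2⟩
    exact ⟨z, hz, hz1, hxy.trans hz2⟩
  have key : ∀ x ∈ S, (x ∈ {x | t < f x}) = (x ∈ U) := by
    intro x hx
    refine propext ⟨fun hlt => ⟨x, hx, hlt, le_rfl⟩, ?_⟩
    rintro ⟨y, hy, hty, hyx⟩
    exact lt_of_lt_of_le hty (hf hx hy hyx)
  have e1 : ν₁ {x | t < f x} = ν₁ U := measure_congr (h₁.mono fun x hx => key x hx)
  have e2 : ν₂ {x | t < f x} = ν₂ U := measure_congr (h₂.mono fun x hx => key x hx)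
  rw [e1, e2]
  exact measure_lowerSet_le_of_dominance h hU

/-- Layer-cake formula for the positive part, whose superlevel sets at positive levels are those of
`f`. -/
theorem lintegral_ofReal_eq_lintegral_superlevel {ν : Measure ℝ} {f : ℝ → ℝ}
    (hf : AEMeasurable f ν) :
    ∫⁻ x, ENNReal.ofReal (f x) ∂ν = ∫⁻ t in Ioi 0, ν {x | t < f x} := by
  have e : ∀ x, ENNReal.ofReal (f x) = ENNReal.ofReal (max (f x) 0) := fun x => by
    rcases le_total (f x) 0 with hx | hx
    · rw [max_eq_right hx, ENNReal.ofReal_of_nonpos hx, ENNReal.ofReal_zero]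
    · rw [max_eq_left hx]
  simp only [e]
  rw [lintegral_eq_lintegral_meas_lt (f := fun x => max (f x) 0) ν
    (ae_of_all _ fun x => le_max_right _ _) (hf.max aemeasurable_const)]
  refine setLIntegral_congr_fun measurableSet_Ioi fun t (ht : 0 < t) => ?_
  simp [not_lt.2 ht.le]

theorem integral_le_of_dominance {ν₁ ν₂ : Measure ℝ} [IsProbabilityMeasure ν₁]
    [IsProbabilityMeasure ν₂] (h : ∀ z, ν₂ (Iic z) ≤ ν₁ (Iic z)) {S : Set ℝ}
    (h₁ : ∀ᵐ x ∂ν₁, x ∈ S) (h₂ : ∀ᵐ x ∂ν₂, x ∈ S) {f : ℝ → ℝ} (hf : MonotoneOn f S)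
    (i₁ : Integrable f ν₁) (i₂ : Integrable f ν₂) :
    ∫ x, f x ∂ν₁ ≤ ∫ x, f x ∂ν₂ := by
  rw [integral_eq_lintegral_pos_part_sub_lintegral_neg_part i₁,
    integral_eq_lintegral_pos_part_sub_lintegral_neg_part i₂]
  refine sub_le_sub ?_ ?_
  · exact ENNReal.toReal_mono i₂.lintegral_lt_top.ne
      (by
        rw [lintegral_ofReal_eq_lintegral_superlevel i₁.aemeasurable,
          lintegral_ofReal_eq_lintegral_superlevel i₂.aemeasurable]
        exact lintegral_mono fun t => measure_superlevel_le_of_dominance h h₁ h₂ hf t)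
  · refine ENNReal.toReal_mono i₁.neg.lintegral_lt_top.ne ?_
    rw [lintegral_ofReal_eq_lintegral_superlevel (f := fun x => -f x) i₁.aemeasurable.neg,
      lintegral_ofReal_eq_lintegral_superlevel (f := fun x => -f x) i₂.aemeasurable.neg]
    exact lintegral_mono fun t => measure_superlevel_ge_of_dominance h h₁ h₂
      (f := fun x => -f x) (fun x hx y hy hxy => neg_le_neg (hf hx hy hxy)) t

/-- Integration by parts for the primitive of a bounded function. -/
theorem integral_primitive {ν : Measure ℝ} [IsProbabilityMeasure ν] {a C : ℝ}
    (hν : ∀ᵐ x ∂ν, a ≤ x) (hint : Integrable (fun x => x) ν) {k : ℝ → ℝ} (hk : Measurable k)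
    (hC : ∀ x, |k x| ≤ C) :
    Integrable (fun x => ∫ t in a..x, k t) ν ∧
      IntegrableOn (fun t => k t * ν.real (Ioi t)) (Ioi a) ∧
      ∫ x, (∫ t in a..x, k t) ∂ν = ∫ t in Ioi a, k t * ν.real (Ioi t) := by
  -- Fubini for k(t) 1{t < x}: the inner integral over t is the primitive, the one over x is k(t)
  -- times the tail probability.
  set H : ℝ → ℝ → ℝ := fun x t => (Iio x).indicator k t with hH
  have hHm : Measurable (Function.uncurry H) := by
    have : Function.uncurry H = {p : ℝ × ℝ | p.2 < p.1}.indicator (fun p => k p.2) := by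
      ext ⟨x, t⟩
      simp [H, Function.uncurry, indicator]
    rw [this]
    exact (hk.comp measurable_snd).indicator (measurableSet_lt measurable_snd measurable_fst)
  have hslice : ∀ x, a ≤ x → ∫ t in Ioi a, H x t = ∫ t in a..x, k t := by
    intro x hx
    rw [intervalIntegral.integral_of_le hx, integral_Ioc_eq_integral_Ioo,
      setIntegral_indicator measurableSet_Iio, Ioi_inter_Iio]
  have hC0 : 0 ≤ C := (abs_nonneg _).trans (hC 0)
  have hsi : ∀ x, IntegrableOn (H x) (Ioi a) := by
    intro x
    rw [hH, IntegrableOn, integrable_indicator_iff measurableSet_Iio, IntegrableOn,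
      Measure.restrict_restrict measurableSet_Iio, Iio_inter_Ioi]
    exact Measure.integrableOn_of_bounded (M := C) (by simp) hk.aestronglyMeasurable
      (ae_of_all _ fun t => hC t)
  have hprod : Integrable (Function.uncurry H) (ν.prod (volume.restrict (Ioi a))) := by
    rw [integrable_prod_iff hHm.aestronglyMeasurable]
    refine ⟨ae_of_all _ fun x => hsi x, ?_⟩
    refine Integrable.mono' (g := fun x => C * (x - a)) ((hint.sub (integrable_const a)).const_mul C)
      ?_ ?_
    · exact (hHm.norm.stronglyMeasurable.integral_prod_right).aestronglyMeasurable
    · filter_upwards [hν] with x hx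
      rw [Real.norm_of_nonneg (integral_nonneg fun _ => norm_nonneg _)]
      have : ∫ t in Ioi a, ‖Function.uncurry H (x, t)‖ ≤ ∫ t in Ioi a, (Iio x).indicator (fun _ => C) t := by
        refine integral_mono (hsi x).norm ?_ fun t => ?_
        · rw [integrable_indicator_iff measurableSet_Iio, IntegrableOn,
            Measure.restrict_restrict measurableSet_Iio, Iio_inter_Ioi]
          exact integrable_const C
        · simp only [H, Function.uncurry, indicator]
          split_ifs
          · exact hC t
          · simp
      refine this.trans (le_of_eq ?_)
      rw [setIntegral_indicator measurableSet_Iio, Ioi_inter_Iio]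
      simp [hx, mul_comm]
  have e1 : (fun x => ∫ t in a..x, k t) =ᵐ[ν] fun x => ∫ t in Ioi a, H x t :=
    hν.mono fun x hx => (hslice x hx).symm
  have e2 : ∀ t, ∫ x, H x t ∂ν = k t * ν.real (Ioi t) := by
    intro t
    have : (fun x => H x t) = (Ioi t).indicator fun _ => k t := by
      ext x
      simp [H, indicator]
    rw [this, integral_indicator measurableSet_Ioi, setIntegral_const, smul_eq_mul, mul_comm]
  refine ⟨hprod.integral_prod_left.congr e1.symm, ?_, ?_⟩
  · exact hprod.integral_prod_right.congr (ae_of_all _ fun t => e2 t)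
  · rw [integral_congr_ae e1, integral_integral_swap hprod]
    exact integral_congr_ae (ae_of_all _ fun t => e2 t)

theorem sub_eq_integral_deriv_of_lipschitz {C : NNReal} {w : ℝ → ℝ} (hw : LipschitzWith C w)
    (a x : ℝ) : w x - w a = ∫ t in a..x, deriv w t :=
  ((hw.lipschitzOnWith (s := uIcc a x)).absolutelyContinuousOnInterval.integral_deriv_eq_sub).symm

theorem measurable_indicator_of_subtype {α β : Type*} [MeasurableSpace α] [MeasurableSpace β]
    [Zero β] {s : Set α} (hs : MeasurableSet s) {f : α → β} (hf : Measurable fun x : s => f x) :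
    Measurable (s.indicator f) := by
  refine measurable_of_restrict_of_restrict_compl hs ?_ ?_
  · have : s.domRestrict (s.indicator f) = fun x : s => f x := by
      ext x
      simp
    rwa [this]
  · have : sᶜ.domRestrict (s.indicator f) = fun _ => 0 := by
      ext x
      simp [indicator_of_notMem x.2]
    rw [this]
    exact measurable_const

namespace Agent

variable {A : Agent}

/-! ### Income supports -/

theorem measurableSet_incomes (θ : ℝ) : MeasurableSet (A.incomes θ) :=
  (measurableSet_le measurable_const measurable_id).inter
    (measurableSet_le measurable_coe_real_ereal measurable_const)

theorem measurableSet_incomesInt (θ : ℝ) : MeasurableSet (A.incomesInt θ) :=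
  (measurableSet_lt measurable_const measurable_id).inter
    (measurableSet_lt measurable_coe_real_ereal measurable_const)

theorem ordConnected_incomes (θ : ℝ) : (A.incomes θ).OrdConnected :=
  ⟨fun _ hx _ hy _ hz => ⟨hx.1.trans hz.1, (EReal.coe_le_coe_iff.2 hz.2).trans hy.2⟩⟩

theorem ordConnected_incomesInt (θ : ℝ) : (A.incomesInt θ).OrdConnected :=
  ⟨fun _ hx _ hy _ hz => ⟨hx.1.trans_le hz.1, (EReal.coe_le_coe_iff.2 hz.2).trans_lt hy.2⟩⟩

theorem incomesInt_subset_incomes (θ : ℝ) : A.incomesInt θ ⊆ A.incomes θ :=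
  fun _ hx => ⟨hx.1.le, hx.2.le⟩

theorem incomes_subset_allIncomes {θ : ℝ} (hθ : θ ∈ A.types) : A.incomes θ ⊆ A.allIncomes :=
  subset_biUnion_of_mem hθ

theorem ae_ne_endpoints (θ : ℝ) {μ : Measure ℝ} (hμ : μ ≪ volume) :
    ∀ᵐ x ∂μ, x ≠ A.iLo θ ∧ (x : EReal) ≠ A.iHi θ := by
  have h1 : ∀ᵐ x ∂μ, x ≠ A.iLo θ := by
    rw [ae_iff]
    simpa using hμ (measure_singleton (A.iLo θ))
  have h2 : ∀ᵐ x ∂μ, x ≠ (A.iHi θ).toReal := by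
    rw [ae_iff]
    simpa using hμ (measure_singleton (A.iHi θ).toReal)
  filter_upwards [h1, h2] with x hx1 hx2
  refine ⟨hx1, fun h => hx2 ?_⟩
  rw [← h, EReal.toReal_coe]

theorem incomeLaw_absolutelyContinuous (θ : ℝ) : A.incomeLaw θ ≪ volume :=
  (withDensity_absolutelyContinuous _ _).trans Measure.absolutelyContinuous_restrict

theorem ae_mem_incomes (θ : ℝ) : ∀ᵐ x ∂(A.incomeLaw θ), x ∈ A.incomes θ :=
  (withDensity_absolutelyContinuous _ _).ae_le (ae_restrict_mem (measurableSet_incomes θ))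

theorem ae_mem_incomesInt (θ : ℝ) : ∀ᵐ x ∂(A.incomeLaw θ), x ∈ A.incomesInt θ := by
  filter_upwards [ae_mem_incomes θ, ae_ne_endpoints θ (incomeLaw_absolutelyContinuous θ)] with x h1 h2
  exact ⟨lt_of_le_of_ne h1.1 (Ne.symm h2.1), lt_of_le_of_ne h1.2 h2.2⟩

theorem G_nonneg (θ x : ℝ) : 0 ≤ A.G θ x := measureReal_nonneg

theorem G_eq_zero {θ x : ℝ} (hx : x ≤ A.iLo θ) : A.G θ x = 0 := by
  have : A.incomeLaw θ (Iic x) = 0 := by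
    refine measure_eq_zero_iff_ae_notMem.2 ?_
    filter_upwards [ae_mem_incomesInt θ] with y hy
    exact not_le.2 (hx.trans_lt hy.1)
  simp [G, measureReal_def, this]

theorem exists_between_incomesInt {θ x : ℝ} (hx : A.iLo θ < x) (hlt : (A.iLo θ : EReal) < A.iHi θ) :
    ∃ y ∈ A.incomesInt θ, y ≤ x := by
  obtain ⟨y, h1, h2⟩ := EReal.lt_iff_exists_real_btwn.1
    (lt_min (EReal.coe_lt_coe_iff.2 hx) hlt)
  exact ⟨y, ⟨EReal.coe_lt_coe_iff.1 h1, h2.trans_le (min_le_right _ _)⟩,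
    EReal.coe_le_coe_iff.1 (h2.le.trans (min_le_left _ _))⟩

theorem exists_incomesInt_gt {θ x : ℝ} (hx : (x : EReal) < A.iHi θ)
    (hlt : (A.iLo θ : EReal) < A.iHi θ) : ∃ y ∈ A.incomesInt θ, x < y := by
  obtain ⟨y, h1, h2⟩ := EReal.lt_iff_exists_real_btwn.1 (max_lt hx hlt)
  exact ⟨y, ⟨EReal.coe_lt_coe_iff.1 ((le_max_right _ _).trans_lt h1), h2⟩,
    EReal.coe_lt_coe_iff.1 ((le_max_left _ _).trans_lt h1)⟩

theorem types_mem_nhds {θ : ℝ} (hθ : θ ∈ Ioo A.tLo A.tHi) : A.types ∈ 𝓝 θ :=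
  Icc_mem_nhds hθ.1 hθ.2

theorem deriv_G_eq_G₂ {θ : ℝ} (hθ : θ ∈ Ioo A.tLo A.tHi) (x : ℝ) :
    deriv (fun t => A.G t x) θ = A.G₂ θ x :=
  (derivWithin_of_mem_nhds (types_mem_nhds hθ)).symm

namespace Valid

variable (hA : A.Valid)
include hA

theorem tLo_mem : A.tLo ∈ A.types := left_mem_Icc.2 hA.types_lt.le

theorem tHi_mem : A.tHi ∈ A.types := right_mem_Icc.2 hA.types_lt.le

theorem G_le_one {θ : ℝ} (hθ : θ ∈ A.types) (x : ℝ) : A.G θ x ≤ 1 :=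
  have := hA.incomeLaw_prob θ hθ
  measureReal_le_one

theorem G_eq_one {θ x : ℝ} (hθ : θ ∈ A.types) (hx : A.iHi θ ≤ x) : A.G θ x = 1 := by
  have := hA.incomeLaw_prob θ hθ
  have : A.incomeLaw θ (Iic x) = 1 := by
    rw [prob_compl_eq_zero_iff₀ measurableSet_Iic.nullMeasurableSet |>.symm]
    refine measure_eq_zero_iff_ae_notMem.2 ?_
    filter_upwards [ae_mem_incomesInt θ] with y hy
    simpa using (hy.2.le.trans hx)
  simp [G, measureReal_def, this]

theorem aemeasurable_g {θ : ℝ} (hθ : θ ∈ A.types) :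
    AEMeasurable (A.g θ) (volume.restrict (A.incomes θ)) :=
  (hA.g_cont θ hθ).aemeasurable (measurableSet_incomes θ)

theorem incomeLaw_Ioo_pos {θ a b : ℝ} (hθ : θ ∈ A.types) (hab : a < b)
    (hsub : Ioo a b ⊆ A.incomesInt θ) : 0 < A.incomeLaw θ (Ioo a b) := by
  rw [pos_iff_ne_zero]
  intro h0
  rw [incomeLaw, withDensity_apply_eq_zero' (hA.aemeasurable_g hθ).ennreal_ofReal] at h0
  have e : {x | ENNReal.ofReal (A.g θ x) ≠ 0} ∩ Ioo a b = Ioo a b := by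
    refine inter_eq_right.2 fun x hx => ?_
    simpa using hA.g_pos θ hθ x (hsub hx)
  rw [e, Measure.restrict_apply measurableSet_Ioo,
    inter_eq_left.2 (hsub.trans (incomesInt_subset_incomes θ)), Real.volume_Ioo,
    ENNReal.ofReal_eq_zero] at h0
  linarith

theorem G_lt_G {θ x y : ℝ} (hθ : θ ∈ A.types) (hx : A.iLo θ ≤ x) (hxy : x < y)
    (hy : (y : EReal) ≤ A.iHi θ) : A.G θ x < A.G θ y := by
  have := hA.incomeLaw_prob θ hθ
  have hp : 0 < (A.incomeLaw θ).real (Ioo x y) := by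
    refine ENNReal.toReal_pos (hA.incomeLaw_Ioo_pos hθ hxy fun z hz => ?_).ne' (measure_ne_top _ _)
    exact ⟨hx.trans_lt hz.1, (EReal.coe_lt_coe_iff.2 hz.2).trans_le hy⟩
  have : A.G θ x + (A.incomeLaw θ).real (Ioo x y) ≤ A.G θ y := by
    unfold G
    rw [← measureReal_union _ measurableSet_Ioo]
    · refine measureReal_mono ?_
      rintro z (hz | hz)
      · exact hz.trans hxy.le
      · exact hz.2.le
    · exact disjoint_left.2 fun z hz hz' => absurd hz'.1 (not_lt.2 hz)
  linarith

theorem G_pos {θ x : ℝ} (hθ : θ ∈ A.types) (hx : A.iLo θ < x) : 0 < A.G θ x := by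
  have := hA.incomeLaw_prob θ hθ
  obtain ⟨y, hy, hyx⟩ := exists_between_incomesInt hx (hA.iLo_lt_iHi θ hθ)
  calc (0 : ℝ) ≤ A.G θ (A.iLo θ) := G_nonneg _ _
    _ < A.G θ y := hA.G_lt_G hθ le_rfl hy.1 hy.2.le
    _ ≤ A.G θ x := measureReal_mono (Iic_subset_Iic.2 hyx)

theorem G_lt_one {θ x : ℝ} (hθ : θ ∈ A.types) (hx : (x : EReal) < A.iHi θ) : A.G θ x < 1 := by
  have := hA.incomeLaw_prob θ hθ
  obtain ⟨y, hy, hyx⟩ := exists_incomesInt_gt hx (hA.iLo_lt_iHi θ hθ)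
  rcases le_total (A.iLo θ) x with h | h
  · exact (hA.G_lt_G hθ h hyx hy.2.le).trans_le (hA.G_le_one hθ y)
  · rw [G_eq_zero h]
    exact one_pos

/-- The density is positive in the interior, so the distribution function alone identifies it.
Continuity of G in the type thereby becomes a statement about supports. -/
theorem mem_incomesInt_iff {θ x : ℝ} (hθ : θ ∈ A.types) :
    x ∈ A.incomesInt θ ↔ 0 < A.G θ x ∧ A.G θ x < 1 := by
  refine ⟨fun h => ⟨hA.G_pos hθ h.1, hA.G_lt_one hθ h.2⟩, fun h => ⟨?_, ?_⟩⟩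
  · by_contra h'
    exact h.1.ne' (G_eq_zero (not_lt.1 h'))
  · by_contra h'
    exact h.2.ne (hA.G_eq_one hθ (not_lt.1 h'))

/-- A law with a density cannot have its mean at an end point of its support, and the mean is the
type. Hence nearby interior types have overlapping supports, and the union of all supports is an
interval. -/
theorem mem_incomesInt_self {θ : ℝ} (hθ : θ ∈ A.types) : θ ∈ A.incomesInt θ := by
  have := hA.incomeLaw_prob θ hθ
  have hi := hA.income_integrable θ hθ
  have hm := hA.income_mean θ hθ
  constructor
  · by_contra h
    push Not at h
    have h0 : 0 ≤ᵐ[A.incomeLaw θ] fun x => x - A.iLo θ := by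
      filter_upwards [ae_mem_incomes θ] with x hx
      exact sub_nonneg.2 hx.1
    have hI : ∫ x, (x - A.iLo θ) ∂(A.incomeLaw θ) = θ - A.iLo θ := by
      rw [integral_sub hi (integrable_const _), hm]
      simp
    have h1 : ∫ x, (x - A.iLo θ) ∂(A.incomeLaw θ) = 0 :=
      le_antisymm (by linarith) (integral_nonneg_of_ae h0)
    rw [integral_eq_zero_iff_of_nonneg_ae h0 (hi.sub (integrable_const _))] at h1
    obtain ⟨x, hx1, hx2⟩ := (h1.and (ae_mem_incomesInt θ)).exists
    have := hx2.1
    simp only [Pi.zero_apply] at hx1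
    linarith
  · by_contra h
    push Not at h
    have hne : A.iHi θ = ((A.iHi θ).toReal : EReal) := by
      refine (EReal.coe_toReal ?_ ?_).symm
      · exact ne_top_of_le_ne_top (EReal.coe_ne_top _) h
      · exact ne_bot_of_gt (hA.iLo_lt_iHi θ hθ)
    set B := (A.iHi θ).toReal
    rw [hne, EReal.coe_le_coe_iff] at h
    have h0 : 0 ≤ᵐ[A.incomeLaw θ] fun x => B - x := by
      filter_upwards [ae_mem_incomes θ] with x hx
      have := hx.2
      rw [hne, EReal.coe_le_coe_iff] at this
      exact sub_nonneg.2 this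
    have hI : ∫ x, (B - x) ∂(A.incomeLaw θ) = B - θ := by
      rw [integral_sub (integrable_const _) hi, hm]
      simp
    have h1 : ∫ x, (B - x) ∂(A.incomeLaw θ) = 0 :=
      le_antisymm (by linarith) (integral_nonneg_of_ae h0)
    rw [integral_eq_zero_iff_of_nonneg_ae h0 ((integrable_const _).sub hi)] at h1
    obtain ⟨x, hx1, hx2⟩ := (h1.and (ae_mem_incomesInt θ)).exists
    have := hx2.2
    rw [hne, EReal.coe_lt_coe_iff] at this
    simp only [Pi.zero_apply] at hx1
    linarith

theorem types_subset_allIncomes : A.types ⊆ A.allIncomes := fun _ hθ =>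
  incomes_subset_allIncomes hθ (incomesInt_subset_incomes _ (hA.mem_incomesInt_self hθ))

theorem ordConnected_allIncomes : A.allIncomes.OrdConnected := by
  refine ⟨fun x hx z hz y hy => ?_⟩
  obtain ⟨θ₁, hθ₁, hx⟩ := mem_iUnion₂.1 hx
  obtain ⟨θ₂, hθ₂, hz⟩ := mem_iUnion₂.1 hz
  have h1 := incomesInt_subset_incomes _ (hA.mem_incomesInt_self hθ₁)
  have h2 := incomesInt_subset_incomes _ (hA.mem_incomesInt_self hθ₂)
  rcases le_total y θ₁ with h | h
  · exact incomes_subset_allIncomes hθ₁ ((ordConnected_incomes θ₁).out hx h1 ⟨hy.1, h⟩)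
  rcases le_total θ₂ y with h' | h'
  · exact incomes_subset_allIncomes hθ₂ ((ordConnected_incomes θ₂).out h2 hz ⟨h', hy.2⟩)
  · exact hA.types_subset_allIncomes ⟨hθ₁.1.trans h, h'.trans hθ₂.2⟩

theorem measurableSet_allIncomes : MeasurableSet A.allIncomes :=
  hA.ordConnected_allIncomes.measurableSet

theorem allIncomes_nonneg {x : ℝ} (hx : x ∈ A.allIncomes) : 0 ≤ x := by
  obtain ⟨θ, hθ, hx⟩ := mem_iUnion₂.1 hx
  exact (hA.iLo_nonneg θ hθ).trans hx.1

/-- Each support contains its own type, so such an income lies below all supports or above all of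
them, and G is constantly 0 or constantly 1. -/
theorem G_eq_of_notMem_allIncomes {x : ℝ} (hx : x ∉ A.allIncomes) {θ θ' : ℝ}
    (hθ : θ ∈ A.types) (hθ' : θ' ∈ A.types) : A.G θ x = A.G θ' x := by
  have hn : ∀ t ∈ A.types, x ∉ A.incomes t := fun t ht h => hx (incomes_subset_allIncomes ht h)
  have hxt : x ∉ A.types := fun h => hx (hA.types_subset_allIncomes h)
  by_cases h : x < A.tLo
  · have : ∀ t ∈ A.types, A.G t x = 0 := by
      intro t ht
      refine G_eq_zero (le_of_not_gt fun h' => hn t ht ⟨h'.le, ?_⟩)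
      exact (EReal.coe_le_coe_iff.2 (h.le.trans ht.1)).trans (hA.mem_incomesInt_self ht).2.le
    rw [this θ hθ, this θ' hθ']
  · have h2 : A.tHi < x := by
      by_contra h2
      exact hxt ⟨not_lt.1 h, not_lt.1 h2⟩
    have : ∀ t ∈ A.types, A.G t x = 1 := by
      intro t ht
      refine hA.G_eq_one ht (le_of_not_gt fun h' => hn t ht ⟨?_, h'.le⟩)
      exact (hA.mem_incomesInt_self ht).1.le.trans (ht.2.trans h2.le)
    rw [this θ hθ, this θ' hθ']

/-! ### The dependence of the income distribution on the type -/

theorem exists_bound : ∃ b : ℝ → ℝ, Integrable b ∧ (∀ x, 0 ≤ b x) ∧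
    ∀ x, ∀ θ ∈ A.types, ∀ θ' ∈ A.types, |A.G θ x - A.G θ' x| ≤ b x * |θ - θ'| := by
  obtain ⟨b, hb, hG⟩ := hA.G_bound
  refine ⟨A.allIncomes.indicator b, (integrable_indicator_iff hA.measurableSet_allIncomes).2 hb,
    fun x => ?_, fun x θ hθ θ' hθ' => ?_⟩
  · refine indicator_nonneg (fun x hx => ?_) x
    have h1 := (abs_nonneg _).trans (hG x hx A.tHi hA.tHi_mem A.tLo hA.tLo_mem)
    have h2 : 0 < |A.tHi - A.tLo| := abs_pos.2 (sub_pos.2 hA.types_lt).ne'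
    exact nonneg_of_mul_nonneg_left h1 h2
  · by_cases hx : x ∈ A.allIncomes
    · rw [indicator_of_mem hx]
      exact hG x hx θ hθ θ' hθ'
    · rw [indicator_of_notMem hx, hA.G_eq_of_notMem_allIncomes hx hθ hθ']
      simp

theorem continuousOn_G (x : ℝ) : ContinuousOn (fun t => A.G t x) A.types := by
  obtain ⟨b, -, hb0, hb⟩ := hA.exists_bound
  have : LipschitzOnWith (b x).toNNReal (fun t => A.G t x) A.types := by
    refine LipschitzOnWith.of_dist_le_mul fun s hs t ht => ?_
    rw [Real.dist_eq, Real.dist_eq, Real.coe_toNNReal _ (hb0 x)]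
    exact hb x s hs t ht
  exact this.continuousOn

theorem G₂_bound {b : ℝ → ℝ} (hb0 : ∀ x, 0 ≤ b x)
    (hb : ∀ x, ∀ θ ∈ A.types, ∀ θ' ∈ A.types, |A.G θ x - A.G θ' x| ≤ b x * |θ - θ'|)
    {θ : ℝ} (hθ : θ ∈ A.types) (x : ℝ) : |A.G₂ θ x| ≤ b x := by
  by_cases hd : DifferentiableWithinAt ℝ (fun t => A.G t x) A.types θ
  · have h := hasDerivWithinAt_iff_tendsto_slope.1 hd.hasDerivWithinAt
    have : (𝓝[A.types \ {θ}] θ).NeBot := by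
      have := (uniqueDiffOn_Icc hA.types_lt) θ hθ
      rw [uniqueDiffWithinAt_iff_accPt] at this
      rwa [accPt_principal_iff_nhdsWithin] at this
    refine le_of_tendsto h.abs (eventually_mem_nhdsWithin.mono fun t ht => ?_)
    have hne : t - θ ≠ 0 := sub_ne_zero.2 ht.2
    rw [slope_def_field, abs_div, div_le_iff₀ (abs_pos.2 hne)]
    exact hb x t ht.1 θ hθ
  · rw [G₂, derivWithin_zero_of_not_differentiableWithinAt hd, abs_zero]
    exact hb0 x

theorem hasDerivWithinAt_G {θ x : ℝ} (hθ : θ ∈ A.types) (h1 : x ≠ A.iLo θ)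
    (h2 : (x : EReal) ≠ A.iHi θ) :
    HasDerivWithinAt (fun t => A.G t x) (A.G₂ θ x) A.types θ := by
  refine DifferentiableWithinAt.hasDerivWithinAt ?_
  by_cases hx : x ∈ A.allIncomes
  · exact hA.G_diff x hx θ hθ h1 h2
  · exact (differentiableWithinAt_const (A.G θ x)).congr
      (fun t ht => hA.G_eq_of_notMem_allIncomes hx ht hθ) rfl

/-- Off the interior of the support G is 0 or 1, an extreme value, so the type is a local extremum
of G in the type. This includes the end points, where differentiability is not assumed but the
derivative defaults to 0. -/
theorem G₂_eq_zero {θ x : ℝ} (hθ : θ ∈ Ioo A.tLo A.tHi) (hx : x ∉ A.incomesInt θ) :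
    A.G₂ θ x = 0 := by
  have hθ' := Ioo_subset_Icc_self hθ
  rw [← deriv_G_eq_G₂ hθ]
  by_cases h0 : 0 < A.G θ x
  · have h1 : A.G θ x = 1 := by
      refine le_antisymm (hA.G_le_one hθ' x) (not_lt.1 fun h => hx ?_)
      exact (hA.mem_incomesInt_iff hθ').2 ⟨h0, h⟩
    refine IsLocalMax.deriv_eq_zero ?_
    filter_upwards [types_mem_nhds hθ] with t ht
    rw [h1]
    exact hA.G_le_one ht x
  · have h1 : A.G θ x = 0 := le_antisymm (not_lt.1 h0) (G_nonneg _ _)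
    exact IsLocalMin.deriv_eq_zero (Eventually.of_forall fun t => h1.trans_le (G_nonneg _ _))

/-- G is Lipschitz in the type, hence the integral of its derivative, which is nonpositive at
interior types. Higher types therefore have stochastically larger incomes. -/
theorem antitoneOn_G (x : ℝ) : AntitoneOn (fun t => A.G t x) A.types := by
  intro s hs t ht hst
  obtain ⟨b, -, hb0, hb⟩ := hA.exists_bound
  have hlip : LipschitzOnWith (b x).toNNReal (fun t => A.G t x) (uIcc s t) := by
    rw [uIcc_of_le hst]
    refine LipschitzOnWith.of_dist_le_mul fun u hu v hv => ?_
    rw [Real.dist_eq, Real.dist_eq, Real.coe_toNNReal _ (hb0 x)]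
    exact hb x u ⟨hs.1.trans hu.1, hu.2.trans ht.2⟩ v ⟨hs.1.trans hv.1, hv.2.trans ht.2⟩
  have h := hlip.absolutelyContinuousOnInterval.integral_deriv_eq_sub
  have h2 : ∫ u in s..t, deriv (fun t => A.G t x) u ≤ 0 := by
    rw [intervalIntegral.integral_of_le hst, integral_Ioc_eq_integral_Ioo]
    refine setIntegral_nonpos measurableSet_Ioo fun u hu => ?_
    have hu' : u ∈ Ioo A.tLo A.tHi := ⟨hs.1.trans_lt hu.1, hu.2.trans_le ht.2⟩
    rw [deriv_G_eq_G₂ hu']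
    by_cases hx : x ∈ A.incomesInt u
    · exact (hA.G₂_neg u hu' x hx).le
    · exact (hA.G₂_eq_zero hu' hx).le
  simp only at h ⊢
  linarith

theorem G₂_nonpos (θ x : ℝ) : A.G₂ θ x ≤ 0 := (hA.antitoneOn_G x).derivWithin_nonpos

theorem monotoneOn_iLo : MonotoneOn A.iLo A.types := by
  intro s hs t ht hst
  by_contra h
  push Not at h
  obtain ⟨x, h1, h2⟩ := exists_between h
  have := hA.antitoneOn_G x hs ht hst
  simp only [G_eq_zero h2.le] at this
  exact absurd (hA.G_pos ht h1) (not_lt.2 this)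

theorem monotoneOn_iHi : MonotoneOn A.iHi A.types := by
  intro s hs t ht hst
  by_contra h
  push Not at h
  obtain ⟨x, h1, h2⟩ := EReal.lt_iff_exists_real_btwn.1 h
  have := hA.antitoneOn_G x hs ht hst
  simp only [hA.G_eq_one ht h1.le] at this
  exact absurd (hA.G_lt_one hs h2) (not_lt.2 this)

theorem dominance {s t : ℝ} (hs : s ∈ A.types) (ht : t ∈ A.types) (hst : s ≤ t) (x : ℝ) :
    A.incomeLaw t (Iic x) ≤ A.incomeLaw s (Iic x) := by
  have := hA.incomeLaw_prob s hs
  have := hA.incomeLaw_prob t ht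
  exact (ENNReal.toReal_le_toReal (measure_ne_top _ _) (measure_ne_top _ _)).1
    (hA.antitoneOn_G x hs ht hst)

theorem ae_nonneg_income {θ : ℝ} (hθ : θ ∈ A.types) : ∀ᵐ x ∂(A.incomeLaw θ), 0 ≤ x := by
  filter_upwards [ae_mem_incomes θ] with x hx
  exact (hA.iLo_nonneg θ hθ).trans hx.1

theorem real_Ioi {θ : ℝ} (hθ : θ ∈ A.types) (x : ℝ) :
    (A.incomeLaw θ).real (Ioi x) = 1 - A.G θ x := by
  have := hA.incomeLaw_prob θ hθ
  rw [← compl_Iic, probReal_compl_eq_one_sub measurableSet_Iic, G]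

theorem integrable_primitive {θ : ℝ} (hθ : θ ∈ A.types) {k : ℝ → ℝ} (hk : Measurable k)
    {C : ℝ} (hC : ∀ x, |k x| ≤ C) :
    Integrable (fun x => ∫ t in (0 : ℝ)..x, k t) (A.incomeLaw θ) :=
  have := hA.incomeLaw_prob θ hθ
  (integral_primitive (hA.ae_nonneg_income hθ) (hA.income_integrable θ hθ) hk hC).1

theorem measurable_G (θ : ℝ) (hθ : θ ∈ A.types) : Measurable (A.G θ) :=
  have := hA.incomeLaw_prob θ hθ
  (show Monotone (A.G θ) from fun _ _ h => measureReal_mono (Iic_subset_Iic.2 h)).measurable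

theorem integrable_G_sub {s t : ℝ} (hs : s ∈ A.types) (ht : t ∈ A.types) :
    Integrable (fun x => A.G s x - A.G t x) := by
  obtain ⟨b, hbi, hb0, hb⟩ := hA.exists_bound
  refine Integrable.mono' (hbi.mul_const |s - t|)
    ((hA.measurable_G s hs).sub (hA.measurable_G t ht)).aestronglyMeasurable (ae_of_all _ fun x => ?_)
  exact hb x s hs t ht

/-- Integration by parts under both laws: a function of income enters only through its derivative
`k`, weighted by the difference of the tails. -/
theorem integral_primitive_sub {s t : ℝ} (hs : s ∈ A.types) (ht : t ∈ A.types) {k : ℝ → ℝ}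
    (hk : Measurable k) {C : ℝ} (hC : ∀ x, |k x| ≤ C) :
    ∫ x, (∫ y in (0 : ℝ)..x, k y) ∂(A.incomeLaw t) - ∫ x, (∫ y in (0 : ℝ)..x, k y) ∂(A.incomeLaw s)
      = ∫ x in Ioi 0, k x * (A.G s x - A.G t x) := by
  have := hA.incomeLaw_prob s hs
  have := hA.incomeLaw_prob t ht
  obtain ⟨-, i1, e1⟩ :=
    integral_primitive (hA.ae_nonneg_income hs) (hA.income_integrable s hs) hk hC
  obtain ⟨-, i2, e2⟩ :=
    integral_primitive (hA.ae_nonneg_income ht) (hA.income_integrable t ht) hk hC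
  rw [e1, e2, ← integral_sub i2 i1]
  refine integral_congr_ae (ae_of_all _ fun x => ?_)
  simp only [hA.real_Ioi hs, hA.real_Ioi ht]
  ring

/-- The case k = 1, where the primitive is income itself and its mean is the type. -/
theorem integral_G_sub {s t : ℝ} (hs : s ∈ A.types) (ht : t ∈ A.types) :
    ∫ x in Ioi 0, (A.G s x - A.G t x) = t - s := by
  have h := hA.integral_primitive_sub hs ht (k := fun _ => 1) measurable_const (C := 1) (by simp)
  simp only [intervalIntegral.integral_const, smul_eq_mul, mul_one, one_mul, sub_zero,
    hA.income_mean s hs, hA.income_mean t ht] at h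
  exact h.symm

/-- The difference of the two distribution functions has constant sign and total mass |t − s|. -/
theorem abs_integral_primitive_sub_le {s t : ℝ} (hs : s ∈ A.types) (ht : t ∈ A.types) {k : ℝ → ℝ}
    (hk : Measurable k) {C : ℝ} (hC : ∀ x, |k x| ≤ C) :
    |∫ x, (∫ y in (0 : ℝ)..x, k y) ∂(A.incomeLaw t)
      - ∫ x, (∫ y in (0 : ℝ)..x, k y) ∂(A.incomeLaw s)| ≤ C * |t - s| := by
  wlog hst : s ≤ t generalizing s t
  · rw [abs_sub_comm, abs_sub_comm t]
    exact this ht hs (le_of_not_ge hst)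
  rw [hA.integral_primitive_sub hs ht hk hC, abs_of_nonneg (sub_nonneg.2 hst),
    ← hA.integral_G_sub hs ht, ← integral_const_mul, ← Real.norm_eq_abs]
  refine norm_integral_le_of_norm_le ((hA.integrable_G_sub hs ht).integrableOn.const_mul C)
    (ae_of_all _ fun x => ?_)
  have h0 : 0 ≤ A.G s x - A.G t x := sub_nonneg.2 (hA.antitoneOn_G x hs ht hst)
  rw [norm_mul, Real.norm_eq_abs, Real.norm_of_nonneg h0]
  exact mul_le_mul_of_nonneg_right (hC x) h0

/-- Differentiation of an expected primitive with respect to the type. -/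
theorem hasDerivWithinAt_integral_primitive {θ : ℝ} (hθ : θ ∈ A.types) {k : ℝ → ℝ}
    (hk : Measurable k) {C : ℝ} (hC : ∀ x, |k x| ≤ C) :
    HasDerivWithinAt (fun t => ∫ x, (∫ y in (0 : ℝ)..x, k y) ∂(A.incomeLaw t))
      (∫ x in Ioi 0, k x * -A.G₂ θ x) A.types θ := by
  obtain ⟨b, hbi, hb0, hb⟩ := hA.exists_bound
  have hC0 : 0 ≤ C := (abs_nonneg _).trans (hC 0)
  rw [hasDerivWithinAt_iff_tendsto_slope]
  -- Dominated convergence: the difference quotients in the type are bounded by `b` and converge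
  -- except possibly at the two end points of the support.
  have hlim : Tendsto (fun t => ∫ x in Ioi 0, k x * -slope (fun t => A.G t x) θ t)
      (𝓝[A.types \ {θ}] θ) (𝓝 (∫ x in Ioi 0, k x * -A.G₂ θ x)) := by
    refine tendsto_integral_filter_of_dominated_convergence (fun x => C * b x) ?_ ?_
      (hbi.integrableOn.const_mul C) ?_
    · filter_upwards [self_mem_nhdsWithin] with t ht
      simp only [slope_def_field]
      exact (hk.mul (((hA.measurable_G t ht.1).sub (hA.measurable_G θ hθ)).div_const _).neg).aestronglyMeasurable
    · filter_upwards [self_mem_nhdsWithin] with t ht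
      refine ae_of_all _ fun x => ?_
      rw [norm_mul, norm_neg, Real.norm_eq_abs, Real.norm_eq_abs]
      refine mul_le_mul (hC x) ?_ (abs_nonneg _) hC0
      have hne : t - θ ≠ 0 := sub_ne_zero.2 ht.2
      rw [slope_def_field, abs_div, div_le_iff₀ (abs_pos.2 hne)]
      exact hb x t ht.1 θ hθ
    · filter_upwards [ae_ne_endpoints (A := A) θ (Measure.absolutelyContinuous_restrict)] with x hx
      exact ((hasDerivWithinAt_iff_tendsto_slope.1
        (hA.hasDerivWithinAt_G hθ hx.1 hx.2)).neg).const_mul (k x)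
  refine hlim.congr' ?_
  filter_upwards [self_mem_nhdsWithin] with t ht
  rw [slope_def_field, hA.integral_primitive_sub hθ ht.1 hk hC, ← integral_div]
  refine integral_congr_ae (ae_of_all _ fun x => ?_)
  simp only [slope_def_field]
  ring

/-- The derivative is an almost everywhere limit of difference quotients along a sequence of types,
each measurable in income. -/
theorem measurable_G₂ {θ : ℝ} (hθ : θ ∈ A.types) : AEMeasurable (A.G₂ θ) volume := by
  have : (𝓝[A.types \ {θ}] θ).NeBot := by
    have := (uniqueDiffOn_Icc hA.types_lt) θ hθ
    rw [uniqueDiffWithinAt_iff_accPt] at this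
    rwa [accPt_principal_iff_nhdsWithin] at this
  obtain ⟨u, hu⟩ := exists_seq_tendsto (𝓝[A.types \ {θ}] θ)
  obtain ⟨n, hn⟩ := (hu.eventually self_mem_nhdsWithin).exists_forall_of_atTop
  refine aemeasurable_of_tendsto_metrizable_ae (u := atTop)
    (f := fun m x => slope (fun t => A.G t x) θ (u (m + n))) (fun m => ?_) ?_
  · simp only [slope_def_field]
    exact (((hA.measurable_G _ (hn _ (Nat.le_add_left n m)).1).sub
      (hA.measurable_G θ hθ)).div_const _).aemeasurable
  · filter_upwards [ae_ne_endpoints (A := A) θ Measure.AbsolutelyContinuous.rfl] with x hx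
    exact ((hasDerivWithinAt_iff_tendsto_slope.1
        (hA.hasDerivWithinAt_G hθ hx.1 hx.2)).comp hu).comp (tendsto_add_atTop_nat n)

theorem integrable_G₂ {θ : ℝ} (hθ : θ ∈ A.types) : Integrable (A.G₂ θ) := by
  obtain ⟨b, hbi, hb0, hb⟩ := hA.exists_bound
  exact hbi.mono' (hA.measurable_G₂ hθ).aestronglyMeasurable (ae_of_all _ (hA.G₂_bound hb0 hb hθ))

/-- Mean income is the type, so its derivative in the type is 1; the general derivative formula with
k = 1 expresses the same derivative through G₂. -/
theorem integral_neg_G₂ {θ : ℝ} (hθ : θ ∈ A.types) : ∫ x in Ioi 0, -A.G₂ θ x = 1 := by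
  have h := hA.hasDerivWithinAt_integral_primitive hθ (k := fun _ => 1) measurable_const (C := 1)
    (by simp)
  simp only [intervalIntegral.integral_const, smul_eq_mul, mul_one, one_mul, sub_zero] at h
  have h2 : HasDerivWithinAt (fun t => ∫ x, x ∂(A.incomeLaw t)) 1 A.types θ :=
    (hasDerivWithinAt_id θ A.types).congr (fun t ht => hA.income_mean t ht) (hA.income_mean θ hθ)
  exact (uniqueDiffOn_Icc hA.types_lt θ hθ).eq_deriv _ h h2

end Valid

/-- The type closest to `θ`. -/
def clamp (A : Agent) (θ : ℝ) : ℝ := max A.tLo (min θ A.tHi)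

theorem monotone_clamp : Monotone A.clamp :=
  fun _ _ h => max_le_max_left _ (min_le_min_right _ h)

theorem clamp_of_mem {θ : ℝ} (hθ : θ ∈ A.types) : A.clamp θ = θ := by
  rw [clamp, min_eq_left hθ.2, max_eq_right hθ.1]

theorem typeLaw_absolutelyContinuous : A.typeLaw ≪ volume :=
  (withDensity_absolutelyContinuous _ _).trans Measure.absolutelyContinuous_restrict

theorem typeLaw_singleton (s : ℝ) : A.typeLaw {s} = 0 :=
  typeLaw_absolutelyContinuous (measure_singleton s)

theorem ae_mem_types : ∀ᵐ s ∂A.typeLaw, s ∈ A.types :=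
  (withDensity_absolutelyContinuous _ _).ae_le (ae_restrict_mem measurableSet_Icc)

theorem ae_mem_Ioo : ∀ᵐ s ∂A.typeLaw, s ∈ Ioo A.tLo A.tHi := by
  have h : ∀ t, ∀ᵐ s ∂A.typeLaw, s ≠ t := fun t => by
    rw [ae_iff]
    simpa using typeLaw_singleton t
  filter_upwards [ae_mem_types, h A.tLo, h A.tHi] with s hs h1 h2
  exact ⟨lt_of_le_of_ne hs.1 (Ne.symm h1), lt_of_le_of_ne hs.2 h2⟩

/-- The virtual value at types where it is finite. -/
def finiteVirtualValue (A : Agent) (θ : ℝ) : ℝ :=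
  θ - A.invHazard θ + ∫ x, max (A.mu θ x * A.φ - A.c) 0 ∂(A.incomeLaw θ)

theorem virtualValue_eq {θ : ℝ} (h : A.tLo < θ) :
    A.virtualValue θ = (A.finiteVirtualValue θ : EReal) :=
  if_neg fun h' => h.ne' h'.1

theorem toReal_virtualValue {θ : ℝ} (h : A.tLo < θ) :
    (A.virtualValue θ).toReal = A.finiteVirtualValue θ := by
  rw [virtualValue_eq h, EReal.toReal_coe]

namespace Valid

variable (hA : A.Valid)
include hA

theorem clamp_mem (θ : ℝ) : A.clamp θ ∈ A.types :=
  ⟨le_max_left _ _, max_le hA.types_lt.le (min_le_right _ _)⟩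

omit hA in
/-- The conditional income distribution as a Markov kernel on the whole line. -/
def incomeKernel (hA : A.Valid) : Kernel ℝ ℝ where
  toFun θ := A.incomeLaw (A.clamp θ)
  measurable' := by
    have := fun θ => hA.incomeLaw_prob _ (hA.clamp_mem θ)
    refine Measurable.measure_of_isPiSystem_of_isProbabilityMeasure (S := range Iic)
      (borel_eq_generateFrom_Iic ℝ ▸ BorelSpace.measurable_eq) isPiSystem_Iic ?_
    rintro _ ⟨x, rfl⟩
    -- Each distribution function value is monotone in the type, which gives measurability although
    -- no regularity of `g` in the type is assumed.
    have h : Antitone fun θ => A.incomeLaw (A.clamp θ) (Iic x) := fun s t hst =>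
      hA.dominance (hA.clamp_mem s) (hA.clamp_mem t) (monotone_clamp hst) x
    exact h.measurable

theorem incomeKernel_apply (θ : ℝ) : hA.incomeKernel θ = A.incomeLaw (A.clamp θ) := rfl

theorem incomeKernel_of_mem {θ : ℝ} (hθ : θ ∈ A.types) : hA.incomeKernel θ = A.incomeLaw θ := by
  rw [incomeKernel_apply, clamp_of_mem hθ]

theorem isMarkovKernel : IsMarkovKernel hA.incomeKernel :=
  ⟨fun θ => hA.incomeLaw_prob _ (hA.clamp_mem θ)⟩

theorem measurable_uncurry_G : Measurable fun p : ℝ × ℝ => A.G (A.clamp p.1) p.2 := by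
  have := hA.isMarkovKernel
  have hs : MeasurableSet {q : (ℝ × ℝ) × ℝ | q.2 ≤ q.1.2} :=
    measurableSet_le measurable_snd (measurable_snd.comp measurable_fst)
  have := (Kernel.measurable_kernel_prodMk_left
    (κ := hA.incomeKernel.comap Prod.fst measurable_fst) hs).ennreal_toReal
  exact this

omit hA in
/-- A version of `G₂` that is jointly measurable in type and income. -/
def G₂Meas (A : Agent) (θ x : ℝ) : ℝ :=
  limsup (fun n : ℕ => (A.G (A.clamp (θ + 1 / ((n : ℝ) + 1))) x - A.G (A.clamp θ) x)
    / (1 / ((n : ℝ) + 1))) atTop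

theorem measurable_G₂Meas : Measurable fun p : ℝ × ℝ => G₂Meas A p.1 p.2 := by
  have h : ∀ n : ℕ, Measurable fun p : ℝ × ℝ =>
      (A.G (A.clamp (p.1 + 1 / ((n : ℝ) + 1))) p.2 - A.G (A.clamp p.1) p.2)
        / (1 / ((n : ℝ) + 1)) := fun n =>
    ((hA.measurable_uncurry_G.comp ((measurable_fst.add_const _).prodMk measurable_snd)).sub
      hA.measurable_uncurry_G).div_const _
  exact Measurable.limsup h

theorem G₂Meas_eq {θ x : ℝ} (hθ : θ ∈ Ioo A.tLo A.tHi) (h1 : x ≠ A.iLo θ)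
    (h2 : (x : EReal) ≠ A.iHi θ) : G₂Meas A θ x = A.G₂ θ x := by
  have hθ' := Ioo_subset_Icc_self hθ
  refine Tendsto.limsup_eq ?_
  have hd := ((hA.hasDerivWithinAt_G hθ' h1 h2).hasDerivAt (types_mem_nhds hθ)).tendsto_slope
  have hu : Tendsto (fun n : ℕ => θ + 1 / ((n : ℝ) + 1)) atTop (𝓝[≠] θ) := by
    refine tendsto_nhdsWithin_iff.2 ⟨?_, Eventually.of_forall fun n => ?_⟩
    · simpa using tendsto_const_nhds.add (tendsto_one_div_add_atTop_nhds_zero_nat (𝕜 := ℝ))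
    · have : (0 : ℝ) < 1 / ((n : ℝ) + 1) := by positivity
      simp only [mem_compl_iff, mem_singleton_iff]
      linarith
  refine (hd.comp hu).congr' ?_
  filter_upwards [(tendsto_nhdsWithin_iff.1 hu).1.eventually (types_mem_nhds hθ)] with n hn
  rw [Function.comp_apply, slope_def_field, clamp_of_mem hn, clamp_of_mem hθ', add_sub_cancel_left]

/-! ### The type distribution -/

theorem F_le_one (s : ℝ) : A.F s ≤ 1 :=
  have := hA.typeLaw_prob
  measureReal_le_one

omit hA in
theorem F_nonneg (s : ℝ) : 0 ≤ A.F s := measureReal_nonneg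

theorem monotone_F : Monotone A.F :=
  have := hA.typeLaw_prob
  fun _ _ h => measureReal_mono (Iic_subset_Iic.2 h)

theorem typeLaw_real_Ioi (s : ℝ) : A.typeLaw.real (Ioi s) = 1 - A.F s := by
  have := hA.typeLaw_prob
  rw [← compl_Iic, probReal_compl_eq_one_sub measurableSet_Iic, F]

theorem invHazard_nonneg {s : ℝ} (hs : s ∈ Ioo A.tLo A.tHi) : 0 ≤ A.invHazard s :=
  div_nonneg (sub_nonneg.2 (hA.F_le_one s)) (hA.f_pos s hs).le

theorem f_mul_invHazard {s : ℝ} (hs : s ∈ Ioo A.tLo A.tHi) : A.f s * A.invHazard s = 1 - A.F s :=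
  mul_div_cancel₀ _ (hA.f_pos s hs).ne'

theorem aemeasurable_f : AEMeasurable A.f (volume.restrict A.types) :=
  hA.f_cont.aemeasurable measurableSet_Icc

theorem typeLaw_id_integrable : Integrable (fun s => s) A.typeLaw := by
  have := hA.typeLaw_prob
  refine Integrable.mono' (integrable_const (max |A.tLo| |A.tHi|)) measurable_id.aestronglyMeasurable ?_
  filter_upwards [ae_mem_types] with s hs
  exact abs_le_max_abs_abs hs.1 hs.2

omit hA in
theorem ae_restrict_types_mem_Ioo : ∀ᵐ s ∂(volume.restrict A.types), s ∈ Ioo A.tLo A.tHi := by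
  rw [types, Measure.restrict_congr_set Ioo_ae_eq_Icc.symm]
  exact ae_restrict_mem measurableSet_Ioo

/-- The tail 1 − F is the density times the inverse hazard rate, so a Lebesgue integral against the
tail is an expectation over types. -/
theorem integral_Ioi_mul_tail (h : ℝ → ℝ) :
    ∫ s in Ioi A.tLo, h s * A.typeLaw.real (Ioi s) = ∫ s, A.invHazard s * h s ∂A.typeLaw := by
  have e1 : ∫ s in Ioi A.tLo, h s * A.typeLaw.real (Ioi s)
      = ∫ s in Ioo A.tLo A.tHi, h s * A.typeLaw.real (Ioi s) := by
    refine setIntegral_eq_of_subset_of_forall_sdiff_eq_zero measurableSet_Ioi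
      Ioo_subset_Ioi_self fun s hs => ?_
    have h1 : A.tHi ≤ s := not_lt.1 fun h => hs.2 ⟨hs.1, h⟩
    have : A.typeLaw (Ioi s) = 0 := by
      refine measure_eq_zero_iff_ae_notMem.2 ?_
      filter_upwards [ae_mem_types] with t ht
      exact not_lt.2 (ht.2.trans h1)
    simp [measureReal_def, this]
  rw [e1]
  simp only [hA.typeLaw_real_Ioi]
  rw [typeLaw, integral_withDensity_eq_integral_toReal_smul₀ hA.aemeasurable_f.ennreal_ofReal
    (ae_of_all _ fun _ => ENNReal.ofReal_lt_top), types, ← Measure.restrict_congr_set Ioo_ae_eq_Icc]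
  refine setIntegral_congr_fun measurableSet_Ioo fun s hs => ?_
  have hs' := hA.f_mul_invHazard hs
  rw [ENNReal.toReal_ofReal (hA.f_pos s hs).le, smul_eq_mul, ← mul_assoc, hs', mul_comm]

/-- The inverse hazard rate may be unbounded, but the density cancels its denominator and leaves 1 −
F ≤ 1. -/
theorem integrable_invHazard_mul {k : ℝ → ℝ} (hk : Measurable k) {C : ℝ} (hC : ∀ s, |k s| ≤ C) :
    Integrable (fun s => A.invHazard s * k s) A.typeLaw := by
  rw [typeLaw, integrable_withDensity_iff_integrable_smul₀' hA.aemeasurable_f.ennreal_ofReal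
    (ae_of_all _ fun _ => ENNReal.ofReal_lt_top)]
  have : (fun s => (1 - A.F s) * k s) =ᵐ[volume.restrict A.types]
      fun s => (ENNReal.ofReal (A.f s)).toReal • (A.invHazard s * k s) := by
    filter_upwards [ae_restrict_types_mem_Ioo] with s hs
    rw [ENNReal.toReal_ofReal (hA.f_pos s hs).le, smul_eq_mul, ← mul_assoc, hA.f_mul_invHazard hs]
  refine Integrable.congr ?_ this
  refine Measure.integrableOn_of_bounded (M := 1 * C) (by simp [types])
    ((measurable_const.sub hA.monotone_F.measurable).mul hk).aestronglyMeasurable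
    (ae_of_all _ fun s => ?_)
  rw [norm_mul, Real.norm_eq_abs, Real.norm_eq_abs]
  refine mul_le_mul ?_ (hC s) (abs_nonneg _) zero_le_one
  rw [abs_of_nonneg (sub_nonneg.2 (hA.F_le_one s))]
  linarith [F_nonneg (A := A) s]

theorem integral_typeLaw_primitive {k : ℝ → ℝ} (hk : Measurable k) {C : ℝ} (hC : ∀ s, |k s| ≤ C) :
    Integrable (fun s => ∫ z in A.tLo..s, k z) A.typeLaw ∧
      ∫ s, (∫ z in A.tLo..s, k z) ∂A.typeLaw = ∫ s, A.invHazard s * k s ∂A.typeLaw := by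
  have := hA.typeLaw_prob
  obtain ⟨h1, -, h3⟩ := integral_primitive (ν := A.typeLaw) (a := A.tLo)
    (ae_mem_types.mono fun s hs => hs.1) hA.typeLaw_id_integrable hk hC
  exact ⟨h1, h3.trans (hA.integral_Ioi_mul_tail k)⟩

/-! ### Expectations of the impulse response -/

/-- The factor 1/g in the impulse response cancels the income density, and G₂ vanishes off the
support. -/
theorem integral_mul_mu {θ : ℝ} (hθ : θ ∈ Ioo A.tLo A.tHi) (a : ℝ → ℝ) :
    ∫ x, a x * A.mu θ x ∂(A.incomeLaw θ)
      = A.invHazard θ * ∫ x in Ioi 0, a x * -A.G₂ θ x := by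
  have hθ' := Ioo_subset_Icc_self hθ
  have hsub : A.incomesInt θ ⊆ Ioi 0 := fun x hx => (hA.iLo_nonneg θ hθ').trans_lt hx.1
  have hae : A.incomesInt θ =ᵐ[volume] A.incomes θ := by
    filter_upwards [ae_ne_endpoints (A := A) θ Measure.AbsolutelyContinuous.rfl] with x hx
    refine propext ⟨fun h => incomesInt_subset_incomes θ h, fun h => ?_⟩
    exact ⟨lt_of_le_of_ne h.1 (Ne.symm hx.1), lt_of_le_of_ne h.2 hx.2⟩
  rw [incomeLaw, integral_withDensity_eq_integral_toReal_smul₀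
    (hA.aemeasurable_g hθ').ennreal_ofReal (ae_of_all _ fun _ => ENNReal.ofReal_lt_top),
    ← Measure.restrict_congr_set hae, ← integral_const_mul]
  have e : ∫ x in Ioi 0, A.invHazard θ * (a x * -A.G₂ θ x)
      = ∫ x in A.incomesInt θ, A.invHazard θ * (a x * -A.G₂ θ x) := by
    refine setIntegral_eq_of_subset_of_forall_sdiff_eq_zero measurableSet_Ioi hsub fun x hx => ?_
    rw [hA.G₂_eq_zero hθ hx.2]
    ring
  rw [e]
  refine setIntegral_congr_fun (measurableSet_incomesInt θ) fun x hx => ?_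
  have := hA.g_pos θ hθ' x hx
  simp only [mu]
  rw [ENNReal.toReal_ofReal this.le, smul_eq_mul]
  field_simp

theorem integrable_mul_mu {θ : ℝ} (hθ : θ ∈ Ioo A.tLo A.tHi) {a : ℝ → ℝ}
    (ha : AEStronglyMeasurable a) {C : ℝ} (hC : ∀ x, |a x| ≤ C) :
    Integrable (fun x => a x * A.mu θ x) (A.incomeLaw θ) := by
  have hθ' := Ioo_subset_Icc_self hθ
  rw [incomeLaw, integrable_withDensity_iff_integrable_smul₀'
    (hA.aemeasurable_g hθ').ennreal_ofReal (ae_of_all _ fun _ => ENNReal.ofReal_lt_top)]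
  have hi : Integrable (fun x => a x * -A.G₂ θ x * A.invHazard θ) (volume.restrict (A.incomes θ)) := by
    refine Integrable.mul_const ?_ _
    exact ((hA.integrable_G₂ hθ').neg.bdd_mul ha (ae_of_all _ hC)).integrableOn
  refine hi.congr ?_
  filter_upwards [ae_ne_endpoints (A := A) θ Measure.absolutelyContinuous_restrict,
    ae_restrict_mem (measurableSet_incomes θ)] with x hx h
  have := hA.g_pos θ hθ' x ⟨lt_of_le_of_ne h.1 (Ne.symm hx.1), lt_of_le_of_ne h.2 hx.2⟩
  simp only [mu]
  rw [ENNReal.toReal_ofReal this.le, smul_eq_mul]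
  field_simp

theorem integrable_mu {θ : ℝ} (hθ : θ ∈ Ioo A.tLo A.tHi) :
    Integrable (A.mu θ) (A.incomeLaw θ) := by
  simpa using hA.integrable_mul_mu hθ (a := fun _ => 1) aestronglyMeasurable_const (C := 1) (by simp)

theorem integrable_net_mu {θ : ℝ} (hθ : θ ∈ Ioo A.tLo A.tHi) :
    Integrable (fun x => A.mu θ x * A.φ - A.c) (A.incomeLaw θ) :=
  have := hA.incomeLaw_prob θ (Ioo_subset_Icc_self hθ)
  ((hA.integrable_mu hθ).mul_const _).sub (integrable_const _)

theorem mu_nonneg {θ x : ℝ} (hθ : θ ∈ Ioo A.tLo A.tHi) (hx : x ∈ A.incomesInt θ) :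
    0 ≤ A.mu θ x := by
  refine mul_nonneg (neg_nonneg.2 ?_) (hA.invHazard_nonneg hθ)
  exact div_nonpos_of_nonpos_of_nonneg (hA.G₂_nonpos θ x)
    (hA.g_pos θ (Ioo_subset_Icc_self hθ) x hx).le

theorem integral_mu {θ : ℝ} (hθ : θ ∈ Ioo A.tLo A.tHi) :
    ∫ x, A.mu θ x ∂(A.incomeLaw θ) = A.invHazard θ := by
  have := hA.integral_mul_mu hθ fun _ => 1
  simpa only [one_mul, hA.integral_neg_G₂ (Ioo_subset_Icc_self hθ), mul_one] using this

theorem abs_finiteVirtualValue_le {θ : ℝ} (hθ : θ ∈ Ioo A.tLo A.tHi) :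
    |A.finiteVirtualValue θ| ≤ |θ| + 2 * A.invHazard θ + |A.c| := by
  have := hA.incomeLaw_prob θ (Ioo_subset_Icc_self hθ)
  have h0 : 0 ≤ ∫ x, max (A.mu θ x * A.φ - A.c) 0 ∂(A.incomeLaw θ) :=
    integral_nonneg fun _ => le_max_right _ _
  have h1 : ∫ x, max (A.mu θ x * A.φ - A.c) 0 ∂(A.incomeLaw θ)
      ≤ ∫ x, (A.mu θ x + |A.c|) ∂(A.incomeLaw θ) := by
    refine integral_mono_ae (hA.integrable_net_mu hθ).pos_part
      ((hA.integrable_mu hθ).add (integrable_const _)) ?_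
    filter_upwards [ae_mem_incomesInt θ] with x hx
    have h2 := hA.mu_nonneg hθ hx
    have h3 := neg_abs_le A.c
    have h4 := mul_le_of_le_one_right h2 hA.φ_mem.2
    exact max_le (by linarith) (by positivity)
  rw [integral_add (hA.integrable_mu hθ) (integrable_const _), hA.integral_mu hθ] at h1
  simp only [integral_const, probReal_univ, one_smul] at h1
  have h5 := hA.invHazard_nonneg hθ
  unfold finiteVirtualValue
  rw [abs_le]
  constructor <;> linarith [neg_abs_le θ, le_abs_self θ, abs_nonneg A.c]

end Valid

/-! ### The auditing threshold -/

/-- Auditing the income `x` of the type `θ` is worthwhile. -/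
def AuditWorthy (A : Agent) (θ x : ℝ) : Prop := x ∈ A.incomesInt θ ∧ A.c ≤ A.mu θ x * A.φ

theorem threshold_nonneg (θ : ℝ) : 0 ≤ A.threshold θ := le_max_left _ _

theorem AuditWorthy.le_threshold {θ x : ℝ} (h : A.AuditWorthy θ x) : (x : EReal) ≤ A.threshold θ :=
  le_max_of_le_right (le_sSup ⟨x, h, rfl⟩)

theorem exists_auditWorthy_gt {θ : ℝ} {a : EReal} (ha : 0 ≤ a) (h : a < A.threshold θ) :
    ∃ x, A.AuditWorthy θ x ∧ a < x := by
  rcases lt_max_iff.1 h with h | h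
  · exact absurd h (not_lt.2 ha)
  · obtain ⟨_, ⟨x, hx, rfl⟩, h2⟩ := lt_sSup_iff.1 h
    exact ⟨x, hx, h2⟩

/-- The threshold, set to infinity if all incomes are audited. -/
def extThreshold (A : Agent) (θ : ℝ) : EReal :=
  open Classical in if A.threshold θ = A.iHi θ then ⊤ else A.threshold θ

theorem threshold_le_extThreshold (θ : ℝ) : A.threshold θ ≤ A.extThreshold θ := by
  unfold extThreshold
  split_ifs
  · exact le_top
  · exact le_rfl

namespace Regular

variable (hreg : A.Regular)
include hreg

theorem auditWorthy_of_le {θ x y : ℝ} (hθ : θ ∈ Ioo A.tLo A.tHi) (hy : A.AuditWorthy θ y)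
    (hx : x ∈ A.incomesInt θ) (hxy : x ≤ y) : A.AuditWorthy θ x := by
  rcases hxy.eq_or_lt with rfl | hlt
  · exact hy
  refine ⟨hx, ?_⟩
  by_contra h
  have := (hreg.crossing_income θ hθ x hx y hy.1 hlt).2 (by linarith)
  linarith [hy.2]

theorem auditWorthy_of_lt_type {θ θ' x : ℝ} (hθ : θ ∈ Ioo A.tLo A.tHi) (hθ' : θ' ∈ Ioo A.tLo A.tHi)
    (hlt : θ < θ') (hy : A.AuditWorthy θ' x) (hx : x ∈ A.incomesInt θ) : A.AuditWorthy θ x := by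
  refine ⟨hx, ?_⟩
  by_contra h
  have := (hreg.crossing_type x θ ⟨hθ, hx⟩ θ' ⟨hθ', hy.1⟩ hlt).2 (by linarith)
  linarith [hy.2]

end Regular

namespace Valid

variable (hA : A.Valid)
include hA

theorem threshold_le_iHi {θ : ℝ} (hθ : θ ∈ A.types) : A.threshold θ ≤ A.iHi θ := by
  refine max_le ?_ (sSup_le ?_)
  · exact (EReal.coe_le_coe_iff.2 (hA.iLo_nonneg θ hθ)).trans (hA.iLo_lt_iHi θ hθ).le
  · rintro _ ⟨x, hx, rfl⟩
    exact hx.1.2.le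

theorem auditWorthy_of_lt_threshold (hreg : A.Regular) {θ x : ℝ} (hθ : θ ∈ Ioo A.tLo A.tHi)
    (hx : x ∈ A.incomesInt θ) (h : (x : EReal) < A.threshold θ) : A.AuditWorthy θ x := by
  have h0 : (0 : EReal) ≤ x :=
    EReal.coe_le_coe_iff.2 ((hA.iLo_nonneg θ (Ioo_subset_Icc_self hθ)).trans hx.1.le)
  obtain ⟨y, hy, hxy⟩ := exists_auditWorthy_gt h0 h
  exact hreg.auditWorthy_of_le hθ hy hx (EReal.coe_lt_coe_iff.1 hxy).le

theorem threshold_eq_iHi {θ : ℝ} (hθ : θ ∈ A.types)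
    (h : ∀ x ∈ A.incomesInt θ, (x : EReal) ≤ A.threshold θ) : A.threshold θ = A.iHi θ := by
  refine le_antisymm (hA.threshold_le_iHi hθ) (le_of_forall_lt fun a ha => ?_)
  obtain ⟨x, h1, h2⟩ := EReal.lt_iff_exists_real_btwn.1 (max_lt ha (hA.iLo_lt_iHi θ hθ))
  refine ((le_max_left _ _).trans_lt h1).trans_le (h x ⟨?_, h2⟩)
  exact EReal.coe_lt_coe_iff.1 ((le_max_right _ _).trans_lt h1)

/-! ### Audit-worthy incomes across types -/

theorem eventually_mem_incomesInt {θ x : ℝ} (hθ : θ ∈ A.types) (hx : x ∈ A.incomesInt θ) :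
    ∀ᶠ t in 𝓝[A.types] θ, x ∈ A.incomesInt t := by
  have h := (hA.mem_incomesInt_iff hθ).1 hx
  have hc := hA.continuousOn_G x θ hθ
  filter_upwards [hc.eventually (lt_mem_nhds h.1), hc.eventually (gt_mem_nhds h.2),
    self_mem_nhdsWithin] with t h1 h2 ht
  exact (hA.mem_incomesInt_iff ht).2 ⟨h1, h2⟩

/-- Carries the property that all incomes up to `y` are worth auditing down from `r'` to `r`,
provided the two supports share an interior point `y'`. -/
theorem auditWorthy_step (hreg : A.Regular) {r r' y y' : ℝ} (hr : r ∈ Ioo A.tLo A.tHi)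
    (hr' : r' ∈ Ioo A.tLo A.tHi) (hlt : r < r') (h1 : y' ∈ A.incomesInt r)
    (h2 : y' ∈ A.incomesInt r') (hy : A.iLo r' < y)
    (hS : ∀ x ∈ A.incomesInt r', x ≤ y → A.AuditWorthy r' x) :
    ∀ x ∈ A.incomesInt r, x ≤ y → A.AuditWorthy r x := by
  intro x hx hxy
  have hHi := hA.monotoneOn_iHi (Ioo_subset_Icc_self hr) (Ioo_subset_Icc_self hr') hlt.le
  set w := max x (min y' y) with hw
  have hwr : w ∈ A.incomesInt r := by
    refine ⟨hx.1.trans_le (le_max_left _ _), ?_⟩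
    rcases max_choice x (min y' y) with h | h
    · rw [hw, h]
      exact hx.2
    · rw [hw, h]
      exact (EReal.coe_le_coe_iff.2 (min_le_left _ _)).trans_lt h1.2
  have hwr' : w ∈ A.incomesInt r' :=
    ⟨(lt_min h2.1 hy).trans_le (le_max_right _ _), hwr.2.trans_le hHi⟩
  have hwy : w ≤ y := max_le hxy (min_le_right _ _)
  exact hreg.auditWorthy_of_le hr (hreg.auditWorthy_of_lt_type hr hr' hlt (hS w hwr' hwy) hwr) hx
    (le_max_left _ _)

/-- Auditing that is worthwhile for a type is worthwhile at all smaller incomes of lower types,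
even if the income supports are disjoint. -/
theorem auditWorthy_of_lt (hreg : A.Regular) {z t x y : ℝ} (hz : z ∈ Ioo A.tLo A.tHi)
    (ht : t ∈ Ioo A.tLo A.tHi) (hzt : z < t) (hy : A.AuditWorthy t y) (hx : x ∈ A.incomesInt z)
    (hxy : x ≤ y) : A.AuditWorthy z x := by
  have hsub : ∀ r ∈ Icc z t, r ∈ Ioo A.tLo A.tHi := fun r hr =>
    ⟨hz.1.trans_le hr.1, hr.2.trans_lt ht.2⟩
  have hlo : ∀ r ∈ Icc z t, A.iLo r < y := fun r hr =>
    (hA.monotoneOn_iLo (Ioo_subset_Icc_self (hsub r hr)) (Ioo_subset_Icc_self ht) hr.2).trans_lt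
      hy.1.1
  -- Continuous induction from `t` down to `z`: the infimum of this set belongs to it and equals
  -- `z`.
  set S : Set ℝ := {r | r ∈ Icc z t ∧ ∀ x ∈ A.incomesInt r, x ≤ y → A.AuditWorthy r x} with hS
  have htS : t ∈ S := ⟨right_mem_Icc.2 hzt.le, fun x hx hxy => hreg.auditWorthy_of_le ht hy hx hxy⟩
  have hbdd : BddBelow S := ⟨z, fun r hr => hr.1.1⟩
  set m := sInf S with hm
  have hm1 : z ≤ m := le_csInf ⟨t, htS⟩ fun r hr => hr.1.1
  have hm2 : m ≤ t := csInf_le hbdd htS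
  have hmI := hsub m ⟨hm1, hm2⟩
  have hmT := Ioo_subset_Icc_self hmI
  have hself := hA.mem_incomesInt_self hmT
  -- The number `m`, read as an income, is interior to the support of type `m` and so of all types
  -- nearby. It is the common point required by each step.
  have hev : ∀ᶠ r in 𝓝 m, m ∈ A.incomesInt r := by
    have := hA.eventually_mem_incomesInt hmT hself
    rwa [nhdsWithin_eq_nhds.2 (types_mem_nhds hmI)] at this
  obtain ⟨ε, hε, hev⟩ := Metric.eventually_nhds_iff.1 hev
  have hmS : m ∈ S := by
    obtain ⟨r, hr, hrm⟩ := exists_lt_of_csInf_lt ⟨t, htS⟩ (show sInf S < m + ε by linarith)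
    have hmr : m ≤ r := csInf_le hbdd hr
    rcases hmr.eq_or_lt with h | h
    · rwa [h]
    refine ⟨⟨hm1, hm2⟩, hA.auditWorthy_step hreg hmI (hsub r hr.1) h hself (hev ?_) (hlo r hr.1) hr.2⟩
    rw [Real.dist_eq, abs_of_nonneg (by linarith)]
    linarith
  -- Otherwise a type slightly below `m` would belong to the set as well.
  have hmz : m = z := by
    by_contra hne
    have hlt : z < m := lt_of_le_of_ne hm1 (Ne.symm hne)
    have hrm : max z (m - ε / 2) < m := max_lt hlt (by linarith)
    have hrI : max z (m - ε / 2) ∈ Icc z t := ⟨le_max_left _ _, hrm.le.trans hm2⟩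
    have hov : m ∈ A.incomesInt (max z (m - ε / 2)) := by
      refine hev ?_
      rw [Real.dist_eq, abs_of_neg (by linarith)]
      linarith [le_max_right z (m - ε / 2)]
    have : max z (m - ε / 2) ∈ S :=
      ⟨hrI, hA.auditWorthy_step hreg (hsub _ hrI) hmI hrm hov hself (hlo m ⟨hm1, hm2⟩) hmS.2⟩
    exact absurd (csInf_le hbdd this) (not_le.2 hrm)
  rw [hmz] at hmS
  exact hmS.2 x hx hxy

/-! ### Audit thresholds at the end types -/

theorem integral_g {θ x y : ℝ} (hθ : θ ∈ A.types) (hx : x ∈ A.incomesInt θ)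
    (hy : y ∈ A.incomesInt θ) (hxy : x ≤ y) :
    IntegrableOn (A.g θ) (Ioo x y) ∧ ∫ u in Ioo x y, A.g θ u = A.G θ y - A.G θ x := by
  have := hA.incomeLaw_prob θ hθ
  have hsub : Ioo x y ⊆ A.incomesInt θ := fun u hu =>
    (ordConnected_incomesInt θ).out hx hy ⟨hu.1.le, hu.2.le⟩
  have hm := (hA.aemeasurable_g hθ).ennreal_ofReal
  have hr : (volume.restrict (A.incomes θ)).restrict (Ioo x y) = volume.restrict (Ioo x y) := by
    rw [Measure.restrict_restrict measurableSet_Ioo,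
      inter_eq_left.2 (hsub.trans (incomesInt_subset_incomes θ))]
  have hg : ∀ u ∈ Ioo x y, (ENNReal.ofReal (A.g θ u)).toReal • (1 : ℝ) = A.g θ u := fun u hu => by
    rw [ENNReal.toReal_ofReal (hA.g_pos θ hθ u (hsub hu)).le, smul_eq_mul, mul_one]
  constructor
  · have hi : Integrable (fun _ => (1 : ℝ)) (A.incomeLaw θ) := integrable_const _
    rw [incomeLaw, integrable_withDensity_iff_integrable_smul₀' hm
      (ae_of_all _ fun _ => ENNReal.ofReal_lt_top)] at hi
    have hi' : IntegrableOn (fun u => (ENNReal.ofReal (A.g θ u)).toReal • (1 : ℝ)) (Ioo x y)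
        (volume.restrict (A.incomes θ)) := hi.integrableOn
    rw [IntegrableOn, hr] at hi'
    exact IntegrableOn.congr_fun hi' hg measurableSet_Ioo
  · have h1 : ∫ u in Ioo x y, (1 : ℝ) ∂(A.incomeLaw θ) = ∫ u in Ioo x y, A.g θ u := by
      rw [incomeLaw, setIntegral_withDensity_eq_setIntegral_toReal_smul₀ hm.restrict
        (ae_of_all _ fun _ => ENNReal.ofReal_lt_top) _ measurableSet_Ioo, hr]
      exact setIntegral_congr_fun measurableSet_Ioo hg
    rw [← h1, setIntegral_const, smul_eq_mul, mul_one]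
    have h2 : (A.incomeLaw θ).real (Ioo x y) = (A.incomeLaw θ).real (Ioc x y) := by
      refine measureReal_congr ((incomeLaw_absolutelyContinuous θ).ae_le ?_)
      exact Ioo_ae_eq_Ioc
    rw [h2, ← Iic_sdiff_Iic, measureReal_sdiff (Iic_subset_Iic.2 hxy) measurableSet_Iic]
    rfl

omit hA in
theorem F_tLo : A.F A.tLo = 0 := by
  have : A.typeLaw (Iic A.tLo) = 0 := by
    refine measure_eq_zero_iff_ae_notMem.2 ?_
    filter_upwards [ae_mem_Ioo] with s hs
    exact not_le.2 hs.1
  simp [F, measureReal_def, this]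

theorem nhdsGT_tLo_le : 𝓝[>] A.tLo ≤ 𝓝[A.types] A.tLo := by
  rw [← nhdsWithin_Ioo_eq_nhdsGT hA.types_lt]
  exact nhdsWithin_mono _ Ioo_subset_Icc_self

theorem f_tLo_nonneg : 0 ≤ A.f A.tLo := by
  have h : Tendsto A.f (𝓝[>] A.tLo) (𝓝 (A.f A.tLo)) :=
    (hA.f_cont A.tLo hA.tLo_mem).mono_left hA.nhdsGT_tLo_le
  refine ge_of_tendsto h ?_
  filter_upwards [Ioo_mem_nhdsGT hA.types_lt] with t ht
  exact (hA.f_pos t ht).le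

/-- The threshold of the lowest type is at least the limit of the thresholds of the types above. -/
theorem le_threshold_tLo (hreg : A.Regular) (hf : A.f A.tLo ≠ 0) {z x y : ℝ}
    (hz : z ∈ Ioo A.tLo A.tHi) (hy : A.AuditWorthy z y) (hx : x ∈ A.incomesInt A.tLo)
    (hxy : x ≤ y) : (x : EReal) ≤ A.threshold A.tLo := by
  by_contra hcon
  push Not at hcon
  have hT := hA.tLo_mem
  -- On the interval from `v` to `x`, above the threshold, auditing the lowest type is strictly not
  -- worthwhile, whereas for all types just above it is worthwhile.
  obtain ⟨v, hv1, hv2⟩ := EReal.lt_iff_exists_real_btwn.1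
    (max_lt hcon (EReal.coe_lt_coe_iff.2 hx.1))
  have hvx : v < x := EReal.coe_lt_coe_iff.1 hv2
  have hv : v ∈ A.incomesInt A.tLo :=
    ⟨EReal.coe_lt_coe_iff.1 ((le_max_right _ _).trans_lt hv1), hv2.trans hx.2⟩
  have hfp : 0 < A.f A.tLo := lt_of_le_of_ne hA.f_tLo_nonneg (Ne.symm hf)
  have hinv : A.invHazard A.tLo = 1 / A.f A.tLo := by
    rw [invHazard, F_tLo, sub_zero]
  obtain ⟨b, hbi, hb0, hb⟩ := hA.exists_bound
  have hsub : ∀ {t}, v ∈ A.incomesInt t → x ∈ A.incomesInt t → Ioo v x ⊆ A.incomesInt t :=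
    fun h1 h2 u hu => (ordConnected_incomesInt _).out h1 h2 ⟨hu.1.le, hu.2.le⟩
  have hev : ∀ᶠ t in 𝓝[>] A.tLo, t ∈ Ioo A.tLo A.tHi ∧ t < z ∧ v ∈ A.incomesInt t ∧
      x ∈ A.incomesInt t := by
    filter_upwards [Ioo_mem_nhdsGT hA.types_lt, Ioo_mem_nhdsGT hz.1,
      hA.nhdsGT_tLo_le (hA.eventually_mem_incomesInt hT hv),
      hA.nhdsGT_tLo_le (hA.eventually_mem_incomesInt hT hx)] with t h1 h2 h3 h4
    exact ⟨h1, h2.2, h3, h4⟩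
  -- The worthiness inequality is integrated over income because G is continuous in the type while
  -- `g` need not be. Replacing the inverse hazard rate by 1/f loses nothing in the limit, as F
  -- vanishes at the lowest type.
  have hineq : ∀ᶠ t in 𝓝[>] A.tLo, A.c * (A.G t x - A.G t v)
      ≤ 1 / A.f t * A.φ * ∫ u in Ioo v x, -A.G₂ t u := by
    filter_upwards [hev] with t ⟨ht, htz, hvt, hxt⟩
    have htT := Ioo_subset_Icc_self ht
    obtain ⟨hi, he⟩ := hA.integral_g htT hvt hxt hvx.le
    rw [← he, ← integral_const_mul, ← integral_const_mul]
    refine setIntegral_mono_on (hi.const_mul _) ((hA.integrable_G₂ htT).neg.integrableOn.const_mul _)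
      measurableSet_Ioo fun u hu => ?_
    have hu' := hsub hvt hxt hu
    have hg := hA.g_pos t htT u hu'
    have hw := (hA.auditWorthy_of_lt hreg ht hz htz hy hu' (hu.2.le.trans hxy)).2
    have h1 : A.c * A.g t u ≤ -A.G₂ t u * A.invHazard t * A.φ := by
      have := mul_le_mul_of_nonneg_right hw hg.le
      rw [mu] at this
      refine this.trans (le_of_eq ?_)
      field_simp
    have h2 : A.invHazard t ≤ 1 / A.f t := by
      refine div_le_div_of_nonneg_right ?_ (hA.f_pos t ht).le
      linarith [F_nonneg (A := A) t]
    have h3 : 0 ≤ -A.G₂ t u := neg_nonneg.2 (hA.G₂_nonpos t u)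
    calc A.c * A.g t u ≤ -A.G₂ t u * A.invHazard t * A.φ := h1
      _ ≤ -A.G₂ t u * (1 / A.f t) * A.φ :=
        mul_le_mul_of_nonneg_right (mul_le_mul_of_nonneg_left h2 h3) hA.φ_mem.1
      _ = 1 / A.f t * A.φ * -A.G₂ t u := by ring
  have hlim1 : Tendsto (fun t => A.c * (A.G t x - A.G t v)) (𝓝[>] A.tLo)
      (𝓝 (A.c * (A.G A.tLo x - A.G A.tLo v))) :=
    (((hA.continuousOn_G x A.tLo hT).mono_left hA.nhdsGT_tLo_le).sub
      ((hA.continuousOn_G v A.tLo hT).mono_left hA.nhdsGT_tLo_le)).const_mul _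
  have hlimG : Tendsto (fun t => ∫ u in Ioo v x, -A.G₂ t u) (𝓝[>] A.tLo)
      (𝓝 (∫ u in Ioo v x, -A.G₂ A.tLo u)) := by
    refine tendsto_integral_filter_of_dominated_convergence b ?_ ?_ hbi.integrableOn ?_
    · filter_upwards [hev] with t ht
      exact (hA.integrable_G₂ (Ioo_subset_Icc_self ht.1)).neg.aestronglyMeasurable.restrict
    · filter_upwards [hev] with t ht
      refine ae_of_all _ fun u => ?_
      rw [norm_neg]
      exact hA.G₂_bound hb0 hb (Ioo_subset_Icc_self ht.1) u
    · filter_upwards [ae_restrict_mem measurableSet_Ioo] with u hu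
      have hu0 := hsub hv hx hu
      have huall := incomes_subset_allIncomes hT (incomesInt_subset_incomes _ hu0)
      have hc := hA.G₂_cont u huall A.tLo ⟨hT, hu0.1.ne', hu0.2.ne⟩
      refine (hc.mono_left ?_).neg
      refine le_inf (nhdsWithin_le_nhds) (le_principal_iff.2 ?_)
      filter_upwards [hev] with t ⟨ht, htz, hvt, hxt⟩
      have hu' := hsub hvt hxt hu
      exact ⟨Ioo_subset_Icc_self ht, hu'.1.ne', hu'.2.ne⟩
  have hlimf : Tendsto (fun t => 1 / A.f t * A.φ) (𝓝[>] A.tLo) (𝓝 (1 / A.f A.tLo * A.φ)) :=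
    ((tendsto_const_nhds.div ((hA.f_cont A.tLo hT).mono_left hA.nhdsGT_tLo_le) hf)).mul_const _
  have hle := le_of_tendsto_of_tendsto hlim1 (hlimf.mul hlimG) hineq
  obtain ⟨hi, he⟩ := hA.integral_g hT hv hx hvx.le
  rw [← he, ← integral_const_mul, ← integral_const_mul] at hle
  have hi2 : IntegrableOn (fun u => 1 / A.f A.tLo * A.φ * -A.G₂ A.tLo u) (Ioo v x) :=
    (hA.integrable_G₂ hT).neg.integrableOn.const_mul _
  -- At the lowest type itself the inequality is strict the other way, which contradicts the limit.
  have hpos : ∀ u ∈ Ioo v x, 0 < A.c * A.g A.tLo u - 1 / A.f A.tLo * A.φ * -A.G₂ A.tLo u := by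
    intro u hu
    have hu' := hsub hv hx hu
    have hg := hA.g_pos A.tLo hT u hu'
    have hnw : A.mu A.tLo u * A.φ < A.c := by
      by_contra h
      have h1 : (u : EReal) ≤ A.threshold A.tLo := AuditWorthy.le_threshold ⟨hu', not_lt.1 h⟩
      have h2 : A.threshold A.tLo < v := (le_max_left _ _).trans_lt hv1
      exact absurd (EReal.coe_lt_coe_iff.1 (h1.trans_lt h2)) (not_lt.2 hu.1.le)
    have := mul_lt_mul_of_pos_right hnw hg
    rw [mu, hinv] at this
    have e : -(A.G₂ A.tLo u / A.g A.tLo u) * (1 / A.f A.tLo) * A.φ * A.g A.tLo u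
        = 1 / A.f A.tLo * A.φ * -A.G₂ A.tLo u := by
      field_simp
    linarith
  have hpos' : 0 < ∫ u in Ioo v x, (A.c * A.g A.tLo u - 1 / A.f A.tLo * A.φ * -A.G₂ A.tLo u) := by
    rw [setIntegral_pos_iff_support_of_nonneg_ae
      ((ae_restrict_mem measurableSet_Ioo).mono fun u hu => (hpos u hu).le)
      ((hi.const_mul _).sub hi2)]
    have : Ioo v x ⊆ Function.support
        (fun u => A.c * A.g A.tLo u - 1 / A.f A.tLo * A.φ * -A.G₂ A.tLo u) ∩ Ioo v x :=
      fun u hu => ⟨(hpos u hu).ne', hu⟩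
    refine lt_of_lt_of_le ?_ (measure_mono this)
    simpa using hvx
  rw [integral_sub (hi.const_mul _) hi2] at hpos'
  linarith

/-- What is audited at a higher type is audited at a lower one. If `x` lies above the support of
`s`, all incomes of `s` are worth auditing and the extended threshold is infinite. At a lowest type
with zero density the quotient defining the inverse hazard rate takes a default value, so that case
is excluded. -/
theorem le_extThreshold_of_gt (hreg : A.Regular) {s z x : ℝ} (hs : s ∈ A.types) (hsz : s < z)
    (hz : z ∈ Ioo A.tLo A.tHi) (hf : s = A.tLo → A.f A.tLo ≠ 0) (hx : x ∈ A.incomesInt z)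
    (hxz : (x : EReal) < A.threshold z) : (x : EReal) ≤ A.extThreshold s := by
  have hw := hA.auditWorthy_of_lt_threshold hreg hz hx hxz
  have key : ∀ y ∈ A.incomesInt s, y ≤ x → (y : EReal) ≤ A.threshold s := by
    intro y hy hyx
    rcases hs.1.eq_or_lt with h | h
    · rw [← h] at hy ⊢
      exact hA.le_threshold_tLo hreg (hf h.symm) hz hw hy hyx
    · exact (hA.auditWorthy_of_lt hreg ⟨h, hsz.trans hz.2⟩ hz hsz hw hy hyx).le_threshold
  have hlo : A.iLo s < x := (hA.monotoneOn_iLo hs (Ioo_subset_Icc_self hz) hsz.le).trans_lt hx.1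
  by_cases hxs : (x : EReal) < A.iHi s
  · exact (key x ⟨hlo, hxs⟩ le_rfl).trans (threshold_le_extThreshold s)
  · have : A.threshold s = A.iHi s := hA.threshold_eq_iHi hs fun y hy =>
      key y hy (EReal.coe_le_coe_iff.1 (hy.2.le.trans (not_lt.1 hxs)))
    rw [extThreshold, if_pos this]
    exact le_top

theorem le_threshold_of_lt (hreg : A.Regular) {s z x : ℝ} (hs : s ∈ A.types) (hzs : z < s)
    (hz : z ∈ Ioo A.tLo A.tHi) (hx : x ∈ A.incomesInt z)
    (hxs : (x : EReal) < A.extThreshold s) : (x : EReal) ≤ A.threshold z := by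
  have hzT := Ioo_subset_Icc_self hz
  have hx0 : 0 < x := (hA.iLo_nonneg z hzT).trans_lt hx.1
  have hxHi : (x : EReal) < A.iHi s := hx.2.trans_le (hA.monotoneOn_iHi hzT hs hzs.le)
  have hxτ : (x : EReal) < A.threshold s := by
    unfold extThreshold at hxs
    split_ifs at hxs with h
    · rwa [h]
    · exact hxs
  obtain ⟨y, hy, hxy⟩ := exists_auditWorthy_gt (EReal.coe_le_coe_iff.2 hx0.le) hxτ
  -- Regularity is silent at the highest type. There the inverse hazard rate is 0, so an audit can
  -- be worthwhile only if c ≤ 0, and then every interior income of `z` is worth auditing.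
  rcases hs.2.eq_or_lt with h | h
  · have hF : A.invHazard s = 0 := by
      have hF1 : A.F A.tHi = 1 := by
        have := hA.typeLaw_prob
        have : A.typeLaw (Iic A.tHi) = 1 := by
          rw [prob_compl_eq_zero_iff₀ measurableSet_Iic.nullMeasurableSet |>.symm]
          refine measure_eq_zero_iff_ae_notMem.2 ?_
          filter_upwards [ae_mem_types] with t ht
          simpa using ht.2
        simp [F, measureReal_def, this]
      rw [h, invHazard, hF1, sub_self, zero_div]
    have hc : A.c ≤ 0 := by
      have := hy.2
      rwa [mu, hF, mul_zero, zero_mul] at this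
    refine AuditWorthy.le_threshold ⟨hx, hc.trans ?_⟩
    exact mul_nonneg (hA.mu_nonneg hz hx) hA.φ_mem.1
  · exact (hA.auditWorthy_of_lt hreg hz ⟨hz.1.trans hzs, h⟩ hzs hy hx
      (EReal.coe_lt_coe_iff.1 hxy).le).le_threshold

/-- A superlevel set is a countable union, over rational incomes, of the sets of interior types at
which that income is worth auditing. These sets are order-connected; the two end types are treated
by hand. -/
theorem measurable_threshold_clamp (hreg : A.Regular) :
    Measurable fun θ => A.threshold (A.clamp θ) := by
  classical
  have h1 : Measurable ((Ioo A.tLo A.tHi).indicator A.threshold) := by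
    refine measurable_of_Ioi fun a => ?_
    by_cases ha : a < 0
    · convert MeasurableSet.univ
      refine eq_univ_of_forall fun θ => ?_
      refine ha.trans_le ?_
      exact indicator_nonneg (fun θ _ => threshold_nonneg θ) θ
    push Not at ha
    have e : (Ioo A.tLo A.tHi).indicator A.threshold ⁻¹' Ioi a
        = ⋃ q : ℚ, {θ | a < ((q : ℝ) : EReal) ∧ θ ∈ Ioo A.tLo A.tHi ∧ A.AuditWorthy θ q} := by
      ext θ
      simp only [mem_preimage, mem_Ioi, mem_iUnion, mem_ofPred_eq]
      by_cases hθ : θ ∈ Ioo A.tLo A.tHi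
      · rw [indicator_of_mem hθ]
        constructor
        · intro h
          obtain ⟨x, hx, hax⟩ := exists_auditWorthy_gt ha h
          obtain ⟨q, hq1, hq2⟩ := EReal.lt_iff_exists_rat_btwn.1
            (max_lt hax (EReal.coe_lt_coe_iff.2 hx.1.1))
          have hq3 : (q : ℝ) < x := EReal.coe_lt_coe_iff.1 hq2
          refine ⟨q, (le_max_left _ _).trans_lt hq1, hθ, hreg.auditWorthy_of_le hθ hx ⟨?_, ?_⟩ hq3.le⟩
          · exact EReal.coe_lt_coe_iff.1 ((le_max_right _ _).trans_lt hq1)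
          · exact hq2.trans hx.1.2
        · rintro ⟨q, hq, -, hw⟩
          exact hq.trans_le hw.le_threshold
      · rw [indicator_of_notMem hθ]
        exact ⟨fun h => absurd h (not_lt.2 ha), fun ⟨q, _, h, _⟩ => absurd h hθ⟩
    rw [e]
    -- Between two such types the income stays inside the support, since the end points of supports
    -- are monotone, and crossing in the type passes worthiness down from the upper one.
    refine MeasurableSet.iUnion fun q => OrdConnected.measurableSet ⟨?_⟩
    rintro s ⟨hq, hs, hws⟩ t ⟨-, ht, hwt⟩ r hr
    have hrI : r ∈ Ioo A.tLo A.tHi := ⟨hs.1.trans_le hr.1, hr.2.trans_lt ht.2⟩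
    refine ⟨hq, hrI, ?_⟩
    rcases hr.2.eq_or_lt with h | h
    · rwa [h]
    have hrT := Ioo_subset_Icc_self hrI
    refine hreg.auditWorthy_of_lt_type hrI ht h hwt ⟨?_, ?_⟩
    · exact (hA.monotoneOn_iLo hrT (Ioo_subset_Icc_self ht) hr.2).trans_lt hwt.1.1
    · exact hws.1.2.trans_le (hA.monotoneOn_iHi (Ioo_subset_Icc_self hs) hrT hr.1)
  have e : (fun θ => A.threshold (A.clamp θ)) = fun θ => if θ ≤ A.tLo then A.threshold A.tLo
      else if A.tHi ≤ θ then A.threshold A.tHi else (Ioo A.tLo A.tHi).indicator A.threshold θ := by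
    ext θ
    split_ifs with h2 h3
    · rw [clamp, max_eq_left ((min_le_left _ _).trans h2)]
    · rw [clamp, min_eq_right h3, max_eq_right hA.types_lt.le]
    · have : θ ∈ Ioo A.tLo A.tHi := ⟨not_le.1 h2, not_le.1 h3⟩
      rw [indicator_of_mem this, clamp_of_mem (Ioo_subset_Icc_self this)]
  rw [e]
  exact Measurable.ite measurableSet_Iic measurable_const
    (Measurable.ite measurableSet_Ici measurable_const h1)

theorem measurable_virtualValue_clamp (hreg : A.Regular) :
    Measurable fun θ => A.virtualValue (A.clamp θ) :=
  (show Monotone fun θ => A.virtualValue (A.clamp θ) from fun s t h =>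
    hreg.virtualValue_mono.monotoneOn (hA.clamp_mem s) (hA.clamp_mem t) (monotone_clamp h)).measurable

end Valid

end Agent

variable {N : ℕ} {A : Fin N → Agent}

/-! ### Profiles and report histories -/

theorem repl_self (θ : Fin N → ℝ) (i : Fin N) (s : ℝ) : repl θ i s i = s := Function.update_self ..

theorem repl_of_ne {i j : Fin N} (h : j ≠ i) (θ : Fin N → ℝ) (s : ℝ) : repl θ i s j = θ j :=
  Function.update_of_ne h ..

theorem repl_repl (θ : Fin N → ℝ) (i : Fin N) (s t : ℝ) : repl (repl θ i s) i t = repl θ i t :=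
  Function.update_idem ..

theorem repl_mem_profiles {θ : Fin N → ℝ} (hθ : θ ∈ profiles A) {i : Fin N} {s : ℝ}
    (hs : s ∈ (A i).types) : repl θ i s ∈ profiles A := by
  intro j
  rcases eq_or_ne j i with rfl | h
  · rwa [repl_self]
  · rw [repl_of_ne h]
    exact hθ j

theorem measurable_repl (i : Fin N) :
    Measurable fun p : (Fin N → ℝ) × ℝ => repl p.1 i p.2 := by
  refine measurable_pi_iff.2 fun j => ?_
  rcases eq_or_ne j i with rfl | h
  · simpa only [repl_self] using measurable_snd
  · simp only [repl_of_ne h]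
    exact (measurable_pi_apply j).comp measurable_fst

theorem measurable_repl_left (i : Fin N) (s : ℝ) :
    Measurable fun θ : Fin N → ℝ => repl θ i s :=
  (measurable_repl i).comp (measurable_id.prodMk measurable_const)

theorem measurableSet_profiles : MeasurableSet (profiles A) := by
  have : profiles A = ⋂ i, (fun θ : Fin N → ℝ => θ i) ⁻¹' (A i).types := by
    ext θ
    simp [profiles]
  rw [this]
  exact MeasurableSet.iInter fun i => measurable_pi_apply i measurableSet_Icc

section

variable (hA : ∀ i, (A i).Valid)
include hA

theorem isProbabilityMeasure_profileLaw : IsProbabilityMeasure (profileLaw A) :=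
  have := fun i => (hA i).typeLaw_prob
  inferInstanceAs (IsProbabilityMeasure (Measure.pi fun i => (A i).typeLaw))

theorem measurePreserving_eval (i : Fin N) :
    MeasurePreserving (fun θ : Fin N → ℝ => θ i) (profileLaw A) (A i).typeLaw :=
  have := fun i => (hA i).typeLaw_prob
  MeasureTheory.measurePreserving_eval (fun i => (A i).typeLaw) i

theorem ae_mem_profiles : ∀ᵐ θ ∂(profileLaw A), θ ∈ profiles A :=
  ae_all_iff.2 fun i => (measurePreserving_eval hA i).quasiMeasurePreserving.ae Agent.ae_mem_types

/-- Independence: redrawing one coordinate leaves the product law unchanged. This is what turns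
interim quantities, defined by overwriting the own type, into ex ante ones. -/
theorem measurePreserving_repl (i : Fin N) :
    MeasurePreserving (fun p : (Fin N → ℝ) × ℝ => repl p.1 i p.2)
      ((profileLaw A).prod (A i).typeLaw) (profileLaw A) := by
  classical
  have := fun i => (hA i).typeLaw_prob
  have := isProbabilityMeasure_profileLaw hA
  refine ⟨measurable_repl i, (Measure.pi_eq fun S hS => ?_).symm⟩
  rw [Measure.map_apply (measurable_repl i) (MeasurableSet.univ_pi hS)]
  have e : (fun p : (Fin N → ℝ) × ℝ => repl p.1 i p.2) ⁻¹' univ.pi S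
      = (univ.pi (Function.update S i univ)) ×ˢ S i := by
    ext ⟨θ, s⟩
    simp only [mem_preimage, mem_univ_pi, mem_prod]
    constructor
    · intro h
      refine ⟨fun j => ?_, by simpa only [repl_self] using h i⟩
      rcases eq_or_ne j i with rfl | hj
      · simp
      · simpa only [repl_of_ne hj, Function.update_of_ne hj] using h j
    · rintro ⟨h1, h2⟩ j
      rcases eq_or_ne j i with rfl | hj
      · simpa only [repl_self] using h2
      · simpa only [repl_of_ne hj, Function.update_of_ne hj] using h1 j
  rw [e, Measure.prod_prod, profileLaw, Measure.pi_pi]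
  have h1 : ∀ j, (A j).typeLaw (Function.update S i univ j)
      = Function.update (fun j => (A j).typeLaw (S j)) i 1 j := by
    intro j
    rcases eq_or_ne j i with rfl | hj
    · simp
    · simp [Function.update_of_ne hj]
  simp only [h1]
  rw [Finset.prod_update_of_mem (Finset.mem_univ i), one_mul, mul_comm,
    Finset.sdiff_singleton_eq_erase, Finset.mul_prod_erase _ (fun j => (A j).typeLaw (S j))
      (Finset.mem_univ i)]

theorem integral_repl (i : Fin N) {h : (Fin N → ℝ) → ℝ} (hh : Integrable h (profileLaw A)) :
    Integrable (fun s => ∫ θ, h (repl θ i s) ∂(profileLaw A)) (A i).typeLaw ∧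
      ∫ s, (∫ θ, h (repl θ i s) ∂(profileLaw A)) ∂(A i).typeLaw = ∫ θ, h θ ∂(profileLaw A) := by
  have := fun i => (hA i).typeLaw_prob
  have := isProbabilityMeasure_profileLaw hA
  have hmp := measurePreserving_repl hA i
  have hi : Integrable (fun p : (Fin N → ℝ) × ℝ => h (repl p.1 i p.2))
      ((profileLaw A).prod (A i).typeLaw) := hmp.integrable_comp_of_integrable hh
  refine ⟨hi.integral_prod_right, ?_⟩
  rw [← integral_prod_symm _ hi]
  have := integral_map hmp.measurable.aemeasurable (f := h)
    (by rw [hmp.map_eq]; exact hh.aestronglyMeasurable)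
  rw [hmp.map_eq] at this
  exact this.symm

theorem measurableSet_histories (i : Fin N) : MeasurableSet (histories A i) := by
  have hLo : Measurable fun θ => (A i).iLo ((A i).clamp θ) :=
    (show Monotone fun θ => (A i).iLo ((A i).clamp θ) from fun s t h =>
      (hA i).monotoneOn_iLo ((hA i).clamp_mem s) ((hA i).clamp_mem t)
        (Agent.monotone_clamp h)).measurable
  have hHi : Measurable fun θ => (A i).iHi ((A i).clamp θ) :=
    (show Monotone fun θ => (A i).iHi ((A i).clamp θ) from fun s t h =>
      (hA i).monotoneOn_iHi ((hA i).clamp_mem s) ((hA i).clamp_mem t)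
        (Agent.monotone_clamp h)).measurable
  have hev : Measurable fun h : (Fin N → ℝ) × ℝ => h.1 i := (measurable_pi_apply i).comp measurable_fst
  have e : histories A i = (Prod.fst ⁻¹' profiles A) ∩
      ({h | (A i).iLo ((A i).clamp (h.1 i)) ≤ h.2} ∩
        {h | (h.2 : EReal) ≤ (A i).iHi ((A i).clamp (h.1 i))}) := by
    ext h
    constructor
    · rintro ⟨h1, h2⟩
      have := Agent.clamp_of_mem (h1 i)
      refine ⟨h1, ?_, ?_⟩
      · change (A i).iLo ((A i).clamp (h.1 i)) ≤ h.2
        rw [this]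
        exact h2.1
      · change (h.2 : EReal) ≤ (A i).iHi ((A i).clamp (h.1 i))
        rw [this]
        exact h2.2
    · rintro ⟨h1, h2, h3⟩
      have := Agent.clamp_of_mem (h1 i)
      change (A i).iLo ((A i).clamp (h.1 i)) ≤ h.2 at h2
      change (h.2 : EReal) ≤ (A i).iHi ((A i).clamp (h.1 i)) at h3
      rw [this] at h2 h3
      exact ⟨h1, h2, h3⟩
  rw [e]
  exact (measurable_fst measurableSet_profiles).inter
    ((measurableSet_le (hLo.comp hev) measurable_snd).inter
      (measurableSet_le (measurable_coe_real_ereal.comp measurable_snd) (hHi.comp hev)))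

omit hA in
/-- The income of agent `i` given the type profile, as a Markov kernel. -/
def winnerKernel (hA : ∀ i, (A i).Valid) (i : Fin N) : Kernel (Fin N → ℝ) ℝ :=
  (hA i).incomeKernel.comap (fun θ => θ i) (measurable_pi_apply i)

theorem isMarkovKernel_winnerKernel (i : Fin N) : IsMarkovKernel (winnerKernel hA i) :=
  have := (hA i).isMarkovKernel
  inferInstanceAs (IsMarkovKernel ((hA i).incomeKernel.comap _ _))

theorem winnerKernel_of_mem {i : Fin N} {θ : Fin N → ℝ} (hθ : θ ∈ profiles A) :
    winnerKernel hA i θ = (A i).incomeLaw (θ i) :=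
  (hA i).incomeKernel_of_mem (hθ i)

theorem ae_histories (i : Fin N) :
    ∀ᵐ θ ∂(profileLaw A), ∀ᵐ x ∂((A i).incomeLaw (θ i)), (θ, x) ∈ histories A i := by
  filter_upwards [ae_mem_profiles hA] with θ hθ
  filter_upwards [Agent.ae_mem_incomes (θ i)] with x hx
  exact ⟨hθ, hx⟩

theorem integrable_winner_iff {i : Fin N} {J : (Fin N → ℝ) × ℝ → ℝ} (hJ : Measurable J) :
    Integrable J ((profileLaw A) ⊗ₘ (winnerKernel hA i)) ↔
      ∫⁻ θ, ∫⁻ x, ‖J (θ, x)‖ₑ ∂((A i).incomeLaw (θ i)) ∂(profileLaw A) < ⊤ := by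
  have := isProbabilityMeasure_profileLaw hA
  have := isMarkovKernel_winnerKernel hA i
  rw [Integrable, and_iff_right hJ.aestronglyMeasurable, HasFiniteIntegral,
    Measure.lintegral_compProd hJ.enorm]
  have e : (fun θ => ∫⁻ x, ‖J (θ, x)‖ₑ ∂(winnerKernel hA i θ)) =ᵐ[profileLaw A]
      fun θ => ∫⁻ x, ‖J (θ, x)‖ₑ ∂((A i).incomeLaw (θ i)) :=
    (ae_mem_profiles hA).mono fun θ hθ => by simp only [winnerKernel_of_mem hA hθ]
  rw [lintegral_congr_ae e]

/-- Averages of functions of the report history, computed by first fixing the own type. -/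
theorem integral_interim {i : Fin N} {J : (Fin N → ℝ) × ℝ → ℝ} (hJ : Measurable J)
    (hi : Integrable J ((profileLaw A) ⊗ₘ (winnerKernel hA i))) :
    (∀ᵐ s ∂(A i).typeLaw, Integrable (fun x => ∫ θ, J (repl θ i s, x) ∂(profileLaw A))
        ((A i).incomeLaw s)) ∧
      Integrable (fun s => ∫ x, (∫ θ, J (repl θ i s, x) ∂(profileLaw A)) ∂((A i).incomeLaw s))
        (A i).typeLaw ∧
      Integrable (fun θ => ∫ x, J (θ, x) ∂((A i).incomeLaw (θ i))) (profileLaw A) ∧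
      ∫ s, (∫ x, (∫ θ, J (repl θ i s, x) ∂(profileLaw A)) ∂((A i).incomeLaw s)) ∂(A i).typeLaw
        = ∫ θ, (∫ x, J (θ, x) ∂((A i).incomeLaw (θ i))) ∂(profileLaw A) := by
  have := fun i => (hA i).typeLaw_prob
  have := isProbabilityMeasure_profileLaw hA
  have := isMarkovKernel_winnerKernel hA i
  set j : (Fin N → ℝ) → ℝ := fun θ => ∫ x, J (θ, x) ∂(winnerKernel hA i θ) with hj
  have hji : Integrable j (profileLaw A) := hi.integral_compProd
  have hje : j =ᵐ[profileLaw A] fun θ => ∫ x, J (θ, x) ∂((A i).incomeLaw (θ i)) :=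
    (ae_mem_profiles hA).mono fun θ hθ => by simp only [hj, winnerKernel_of_mem hA hθ]
  have hjm : Measurable fun θ => ∫⁻ x, ‖J (θ, x)‖ₑ ∂(winnerKernel hA i θ) :=
    Measurable.lintegral_kernel_prod_right' (hJ.enorm)
  -- Tonelli for absolute values makes the interim integrals finite for almost every own type, so
  -- that the order of integration over profiles and incomes can be exchanged.
  have hfin : ∀ᵐ s ∂(A i).typeLaw,
      ∫⁻ θ, ∫⁻ x, ‖J (repl θ i s, x)‖ₑ ∂(winnerKernel hA i (repl θ i s)) ∂(profileLaw A) < ⊤ := by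
    refine ae_lt_top' ?_ ?_
    · exact (hjm.comp (measurable_repl i)).aemeasurable.lintegral_prod_left'
    · have e := lintegral_prod_symm (μ := profileLaw A) (ν := (A i).typeLaw) _
        (hjm.comp (measurable_repl i)).aemeasurable
      simp only [Function.comp_def] at e
      rw [← e, (measurePreserving_repl hA i).lintegral_comp hjm, ← Measure.lintegral_compProd hJ.enorm]
      exact hi.2.ne
  have hprod : ∀ᵐ s ∂(A i).typeLaw, Integrable (fun p : (Fin N → ℝ) × ℝ => J (repl p.1 i s, p.2))
      ((profileLaw A).prod ((A i).incomeLaw s)) := by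
    filter_upwards [hfin, Agent.ae_mem_types] with s hs hsT
    have := (hA i).incomeLaw_prob s hsT
    have hm : Measurable fun p : (Fin N → ℝ) × ℝ => J (repl p.1 i s, p.2) :=
      hJ.comp (((measurable_repl_left i s).comp measurable_fst).prodMk measurable_snd)
    refine ⟨hm.aestronglyMeasurable, ?_⟩
    rw [HasFiniteIntegral, lintegral_prod _ hm.enorm.aemeasurable]
    refine lt_of_eq_of_lt (lintegral_congr_ae ?_) hs
    filter_upwards [ae_mem_profiles hA] with θ hθ
    rw [winnerKernel_of_mem hA (repl_mem_profiles hθ hsT), repl_self]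
  have hrepl := integral_repl hA i hji
  have hse : (fun s => ∫ θ, j (repl θ i s) ∂(profileLaw A)) =ᵐ[(A i).typeLaw]
      fun s => ∫ x, (∫ θ, J (repl θ i s, x) ∂(profileLaw A)) ∂((A i).incomeLaw s) := by
    filter_upwards [hprod, Agent.ae_mem_types] with s hs hsT
    have := (hA i).incomeLaw_prob s hsT
    rw [← integral_integral_swap hs]
    refine integral_congr_ae ?_
    filter_upwards [ae_mem_profiles hA] with θ hθ
    simp only [hj]
    rw [winnerKernel_of_mem hA (repl_mem_profiles hθ hsT), repl_self]
  refine ⟨?_, hrepl.1.congr hse, hji.congr hje, ?_⟩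
  · filter_upwards [hprod, Agent.ae_mem_types] with s hs hsT
    have := (hA i).incomeLaw_prob s hsT
    exact hs.integral_prod_right
  · rw [← integral_congr_ae hse, hrepl.2, integral_congr_ae hje]

end

/-! ### Projection of incomes onto a reported support -/

namespace Agent

variable {A : Agent}

theorem proj_of_mem {θ x : ℝ} (hx : x ∈ A.incomes θ) : A.proj θ x = x := by
  rw [proj, min_eq_left hx.2, EReal.toReal_coe, max_eq_right hx.1]

theorem proj_of_le {θ x : ℝ} (hx : x ≤ A.iLo θ) (h : (A.iLo θ : EReal) < A.iHi θ) :
    A.proj θ x = A.iLo θ := by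
  rw [proj, min_eq_left ((EReal.coe_le_coe_iff.2 hx).trans h.le), EReal.toReal_coe, max_eq_left hx]

theorem proj_of_ge {θ x : ℝ} (hx : A.iHi θ ≤ x) (h : (A.iLo θ : EReal) < A.iHi θ) :
    (A.proj θ x : EReal) = A.iHi θ := by
  have e : ((A.iHi θ).toReal : EReal) = A.iHi θ :=
    EReal.coe_toReal (ne_top_of_le_ne_top (EReal.coe_ne_top _) hx) (ne_bot_of_gt h)
  rw [proj, min_eq_right hx, max_eq_right, e]
  rw [← EReal.coe_le_coe_iff, e]
  exact h.le

theorem proj_mem {θ : ℝ} (h : (A.iLo θ : EReal) < A.iHi θ) (x : ℝ) : A.proj θ x ∈ A.incomes θ := by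
  rcases le_total x (A.iLo θ) with h1 | h1
  · rw [proj_of_le h1 h]
    exact ⟨le_rfl, h.le⟩
  rcases le_total (A.iHi θ) x with h2 | h2
  · have e := proj_of_ge h2 h
    refine ⟨?_, e.le⟩
    rw [← EReal.coe_le_coe_iff, e]
    exact h.le
  · rw [proj_of_mem ⟨h1, h2⟩]
    exact ⟨h1, h2⟩

end Agent

variable {m : Mechanism N} {Y : Fin N → Set ℝ}

/-! ### Interim quantities of a mechanism -/

/-- The interim probability of winning. -/
def interimAlloc (A : Fin N → Agent) (m : Mechanism N) (i : Fin N) (s : ℝ) : ℝ :=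
  ∫ θ, m.q i (repl θ i s) ∂(profileLaw A)

/-- The probability of winning and being audited. -/
def auditFun (A : Fin N → Agent) (m : Mechanism N) (i : Fin N) : (Fin N → ℝ) × ℝ → ℝ :=
  (histories A i).indicator fun h => m.q i h.1 * m.a i h.1 h.2

/-- The interim probability of winning and being audited. -/
def interimAudit (A : Fin N → Agent) (m : Mechanism N) (i : Fin N) (s x : ℝ) : ℝ :=
  ∫ θ, auditFun A m i (repl θ i s, x) ∂(profileLaw A)

/-- The contingent payment of agent `i`, after a report history and an audit outcome. -/
def payFun (A : Fin N → Agent) (m : Mechanism N) (i : Fin N) : ((Fin N → ℝ) × ℝ) × ℝ → ℝ :=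
  (histories A i ×ˢ (A i).allIncomes).indicator fun h =>
    m.q i h.1.1 * (m.r i h.1.1 h.1.2 + m.a i h.1.1 h.1.2 * m.p i h.1.1 h.1.2 h.2)

/-- The interim utility of a truthful agent, net of the transfer. -/
def netUtility (A : Fin N → Agent) (m : Mechanism N) (i : Fin N) (s : ℝ) : ℝ :=
  expUtility A (utility A m) i s s - interimTransfer A m i s

namespace WellDefined

theorem q_le_one (hw : WellDefined A Y m) {θ : Fin N → ℝ} (hθ : θ ∈ profiles A) (i : Fin N) :
    m.q i θ ≤ 1 :=
  (Finset.single_le_sum (f := fun j => m.q j θ) (fun j _ => hw.q_nonneg θ hθ j)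
    (Finset.mem_univ i)).trans (hw.q_sum θ hθ)

theorem integrable_q (hw : WellDefined A Y m) (hA : ∀ i, (A i).Valid) (i : Fin N) :
    Integrable (m.q i) (profileLaw A) := by
  have := isProbabilityMeasure_profileLaw hA
  have hm := measurable_indicator_of_subtype measurableSet_profiles (hw.q_meas i)
  refine Integrable.of_bound (C := 1) ?_ ?_
  · exact hm.aestronglyMeasurable.congr
      ((ae_mem_profiles hA).mono fun θ hθ => indicator_of_mem hθ _)
  · filter_upwards [ae_mem_profiles hA] with θ hθ
    rw [Real.norm_of_nonneg (hw.q_nonneg θ hθ i)]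
    exact hw.q_le_one hθ i

theorem integrable_q_repl (hw : WellDefined A Y m) (hA : ∀ i, (A i).Valid) (i : Fin N) {s : ℝ}
    (hs : s ∈ (A i).types) : Integrable (fun θ => m.q i (repl θ i s)) (profileLaw A) := by
  have := isProbabilityMeasure_profileLaw hA
  have hm := measurable_indicator_of_subtype measurableSet_profiles (hw.q_meas i)
  refine Integrable.of_bound (C := 1) ?_ ?_
  · exact (hm.comp (measurable_repl_left i s)).aestronglyMeasurable.congr
      ((ae_mem_profiles hA).mono fun θ hθ => indicator_of_mem (repl_mem_profiles hθ hs) _)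
  · filter_upwards [ae_mem_profiles hA] with θ hθ
    rw [Real.norm_of_nonneg (hw.q_nonneg _ (repl_mem_profiles hθ hs) i)]
    exact hw.q_le_one (repl_mem_profiles hθ hs) i

theorem interimAlloc_nonneg (hw : WellDefined A Y m) (hA : ∀ i, (A i).Valid) (i : Fin N) {s : ℝ}
    (hs : s ∈ (A i).types) : 0 ≤ interimAlloc A m i s :=
  integral_nonneg_of_ae ((ae_mem_profiles hA).mono fun _ hθ =>
    hw.q_nonneg _ (repl_mem_profiles hθ hs) i)

theorem interimAlloc_le_one (hw : WellDefined A Y m) (hA : ∀ i, (A i).Valid) (i : Fin N) {s : ℝ}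
    (hs : s ∈ (A i).types) : interimAlloc A m i s ≤ 1 := by
  have := isProbabilityMeasure_profileLaw hA
  refine (integral_mono_ae (hw.integrable_q_repl hA i hs) (integrable_const 1)
    ((ae_mem_profiles hA).mono fun _ hθ => hw.q_le_one (repl_mem_profiles hθ hs) i)).trans ?_
  simp

theorem measurable_auditFun (hw : WellDefined A Y m) (hA : ∀ i, (A i).Valid) (i : Fin N) :
    Measurable (auditFun A m i) := by
  refine measurable_indicator_of_subtype (measurableSet_histories hA i) (Measurable.mul ?_ (hw.a_meas i))
  exact (hw.q_meas i).comp
    (g := fun θ : profiles A => m.q i θ) (f := fun h : histories A i => (⟨h.1.1, h.2.1⟩ : profiles A))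
    ((measurable_fst.comp measurable_subtype_coe).subtype_mk)

theorem auditFun_nonneg (hw : WellDefined A Y m) (i : Fin N) (h : (Fin N → ℝ) × ℝ) :
    0 ≤ auditFun A m i h :=
  indicator_nonneg (fun h hh => mul_nonneg (hw.q_nonneg _ hh.1 i) (hw.a_mem i h hh).1) h

theorem auditFun_le (hw : WellDefined A Y m) (i : Fin N) {h : (Fin N → ℝ) × ℝ}
    (hh : h.1 ∈ profiles A) : auditFun A m i h ≤ m.q i h.1 := by
  by_cases h1 : h ∈ histories A i
  · rw [auditFun, indicator_of_mem h1]
    exact mul_le_of_le_one_right (hw.q_nonneg _ hh i) (hw.a_mem i h h1).2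
  · rw [auditFun, indicator_of_notMem h1]
    exact hw.q_nonneg _ hh i

theorem abs_auditFun_le (hw : WellDefined A Y m) (i : Fin N) (h : (Fin N → ℝ) × ℝ) :
    |auditFun A m i h| ≤ 1 := by
  rw [abs_of_nonneg (hw.auditFun_nonneg i h)]
  by_cases h1 : h ∈ histories A i
  · exact (hw.auditFun_le i h1.1).trans (hw.q_le_one h1.1 i)
  · rw [auditFun, indicator_of_notMem h1]
    exact zero_le_one

theorem integrable_auditFun_repl (hw : WellDefined A Y m) (hA : ∀ i, (A i).Valid) (i : Fin N)
    (s x : ℝ) : Integrable (fun θ => auditFun A m i (repl θ i s, x)) (profileLaw A) := by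
  have := isProbabilityMeasure_profileLaw hA
  refine Integrable.of_bound (C := 1) ?_ (ae_of_all _ fun θ => hw.abs_auditFun_le i _)
  exact ((hw.measurable_auditFun hA i).comp
    ((measurable_repl_left i s).prodMk measurable_const)).aestronglyMeasurable

theorem measurable_interimAudit (hw : WellDefined A Y m) (hA : ∀ i, (A i).Valid) (i : Fin N)
    (s : ℝ) : Measurable (interimAudit A m i s) := by
  have := isProbabilityMeasure_profileLaw hA
  have h : Measurable fun p : (Fin N → ℝ) × ℝ => auditFun A m i (repl p.1 i s, p.2) :=
    (hw.measurable_auditFun hA i).comp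
      (((measurable_repl_left i s).comp measurable_fst).prodMk measurable_snd)
  exact h.stronglyMeasurable.integral_prod_left'.measurable

theorem interimAudit_nonneg (hw : WellDefined A Y m) (i : Fin N) (s x : ℝ) :
    0 ≤ interimAudit A m i s x :=
  integral_nonneg fun _ => hw.auditFun_nonneg i _

theorem interimAudit_le (hw : WellDefined A Y m) (hA : ∀ i, (A i).Valid) (i : Fin N) {s : ℝ}
    (hs : s ∈ (A i).types) (x : ℝ) : interimAudit A m i s x ≤ interimAlloc A m i s :=
  integral_mono_ae (hw.integrable_auditFun_repl hA i s x) (hw.integrable_q_repl hA i hs)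
    ((ae_mem_profiles hA).mono fun _ hθ => hw.auditFun_le i (repl_mem_profiles hθ hs))

theorem abs_interimAudit_le_one (hw : WellDefined A Y m) (hA : ∀ i, (A i).Valid) (i : Fin N) {s : ℝ}
    (hs : s ∈ (A i).types) (x : ℝ) : |interimAudit A m i s x| ≤ 1 := by
  rw [abs_of_nonneg (hw.interimAudit_nonneg i s x)]
  exact (hw.interimAudit_le hA i hs x).trans (hw.interimAlloc_le_one hA i hs)

theorem measurable_payFun (hw : WellDefined A (fun i => (A i).allIncomes) m)
    (hA : ∀ i, (A i).Valid) (i : Fin N) : Measurable (payFun A m i) := by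
  refine measurable_indicator_of_subtype
    ((measurableSet_histories hA i).prod (hA i).measurableSet_allIncomes) ?_
  have hq : Measurable fun h : ↥(histories A i ×ˢ (A i).allIncomes) => m.q i h.1.1.1 :=
    (hw.q_meas i).comp (g := fun θ : profiles A => m.q i θ)
      (f := fun h : ↥(histories A i ×ˢ (A i).allIncomes) => (⟨h.1.1.1, h.2.1.1⟩ : profiles A))
      (((measurable_fst.comp measurable_fst).comp measurable_subtype_coe).subtype_mk)
  have hh : Measurable fun h : ↥(histories A i ×ˢ (A i).allIncomes) =>
      (⟨h.1.1, h.2.1⟩ : histories A i) :=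
    (measurable_fst.comp measurable_subtype_coe).subtype_mk
  exact hq.mul (((hw.r_meas i).comp hh).add (((hw.a_meas i).comp hh).mul (hw.p_meas i)))

end WellDefined

theorem payFun_of_mem {i : Fin N} {θ : Fin N → ℝ} {s x' x : ℝ} (hθ : θ ∈ profiles A)
    (hs : s ∈ (A i).types) (hx' : x' ∈ (A i).incomes s) (hx : x ∈ (A i).allIncomes) :
    payFun A m i ((repl θ i s, x'), x) = m.q i (repl θ i s) * (m.r i (repl θ i s) x'
      + m.a i (repl θ i s) x' * m.p i (repl θ i s) x' x) := by
  have h : (repl θ i s, x') ∈ histories A i := by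
    refine ⟨repl_mem_profiles hθ hs, ?_⟩
    change x' ∈ (A i).incomes (repl θ i s i)
    rwa [repl_self]
  exact indicator_of_mem (show ((repl θ i s, x'), x) ∈ histories A i ×ˢ (A i).allIncomes from
    ⟨h, hx⟩) _

theorem integrable_payFun_repl (hA : ∀ i, (A i).Valid)
    (hw : WellDefined A (fun i => (A i).allIncomes) m) (hf : FinitePayments A m) {i : Fin N}
    {s x' x : ℝ} (hs : s ∈ (A i).types) (hx' : x' ∈ (A i).incomes s) (hx : x ∈ (A i).allIncomes) :
    Integrable (fun θ => payFun A m i ((repl θ i s, x'), x)) (profileLaw A) := by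
  refine ⟨((hw.measurable_payFun hA i).comp (((measurable_repl_left i s).prodMk
    measurable_const).prodMk measurable_const)).aestronglyMeasurable, ?_⟩
  refine lt_of_eq_of_lt (lintegral_congr_ae ?_) (hf.interim i s hs x' hx' x hx)
  filter_upwards [ae_mem_profiles hA] with θ hθ
  rw [payFun_of_mem hθ hs hx' hx]

/-- Separates the value of the asset from the payments. Finiteness of payments is what excludes the
default value 0 of an undefined integral. -/
theorem utility_eq (hA : ∀ i, (A i).Valid)
    (hw : WellDefined A (fun i => (A i).allIncomes) m) (hf : FinitePayments A m) {i : Fin N}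
    {s x' x : ℝ} (hs : s ∈ (A i).types) (hx' : x' ∈ (A i).incomes s) (hx : x ∈ (A i).allIncomes) :
    utility A m i s x' x = interimAlloc A m i s * x
      - ∫ θ, payFun A m i ((repl θ i s, x'), x) ∂(profileLaw A) := by
  rw [interimAlloc, ← integral_mul_const, ← integral_sub ((hw.integrable_q_repl hA i hs).mul_const x)
    (integrable_payFun_repl hA hw hf hs hx' hx)]
  refine integral_congr_ae ((ae_mem_profiles hA).mono fun θ hθ => ?_)
  simp only [payFun_of_mem hθ hs hx' hx]
  ring

theorem integral_add_sub_const_mul {α : Type*} [MeasurableSpace α] {μ : Measure α} {f g h : α → ℝ}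
    (hf : Integrable f μ) (hg : Integrable g μ) (hh : Integrable h μ) (c : ℝ) :
    ∫ x, (f x + (g x - c * h x)) ∂μ = ∫ x, f x ∂μ + (∫ x, g x ∂μ - c * ∫ x, h x ∂μ) := by
  have h1 : Integrable (fun x => c * h x) μ := hh.const_mul c
  have h2 : Integrable (fun x => g x - c * h x) μ := hg.sub h1
  rw [integral_add hf h2, integral_sub hg h1, integral_const_mul]

/-- The principal's payoff from agent `i` in terms of interim quantities. -/
theorem agentPayoff_eq (hA : ∀ i, (A i).Valid)
    (hw : WellDefined A (fun i => (A i).allIncomes) m) (hf : FinitePayments A m) (i : Fin N) :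
    Integrable (netUtility A m i) (A i).typeLaw ∧
    Integrable (fun s => interimAlloc A m i s * s) (A i).typeLaw ∧
    Integrable (fun s => ∫ x, interimAudit A m i s x ∂((A i).incomeLaw s)) (A i).typeLaw ∧
    ∫ θ, (m.t i θ + m.q i θ * ∫ x, (m.r i θ x + m.a i θ x * (m.p i θ x x - (A i).c))
      ∂((A i).incomeLaw (θ i))) ∂(profileLaw A)
    = ∫ s, (interimAlloc A m i s * s - netUtility A m i s
        - (A i).c * ∫ x, interimAudit A m i s x ∂((A i).incomeLaw s)) ∂(A i).typeLaw := by
  have := fun i => (hA i).typeLaw_prob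
  have := isProbabilityMeasure_profileLaw hA
  have := isMarkovKernel_winnerKernel hA i
  set J : (Fin N → ℝ) × ℝ → ℝ := fun h => payFun A m i (h, h.2) with hJ
  have hJe : ∀ h ∈ histories A i, J h = m.q i h.1 * (m.r i h.1 h.2 + m.a i h.1 h.2 * m.p i h.1 h.2 h.2) :=
    fun h hh => indicator_of_mem (show (h, h.2) ∈ histories A i ×ˢ (A i).allIncomes from
      ⟨hh, Agent.incomes_subset_allIncomes (hh.1 i) hh.2⟩) _
  have hJm : Measurable J := (hw.measurable_payFun hA i).comp (measurable_id.prodMk measurable_snd)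
  have hJi : Integrable J ((profileLaw A) ⊗ₘ (winnerKernel hA i)) := by
    rw [integrable_winner_iff hA hJm]
    refine lt_of_eq_of_lt (lintegral_congr_ae ?_) (hf.exAnte i)
    filter_upwards [ae_histories hA i] with θ hθ
    exact lintegral_congr_ae (hθ.mono fun x hx => by simp only [hJe _ hx])
  have hBm := hw.measurable_auditFun hA i
  have hBi : Integrable (auditFun A m i) ((profileLaw A) ⊗ₘ (winnerKernel hA i)) :=
    Integrable.of_bound hBm.aestronglyMeasurable 1 (ae_of_all _ fun h => hw.abs_auditFun_le i h)
  obtain ⟨hJ1, hJ2, hJ3, hJ4⟩ := integral_interim hA hJm hJi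
  obtain ⟨-, hB2, hB3, hB4⟩ := integral_interim hA hBm hBi
  obtain ⟨hT1, hT2⟩ := integral_repl hA i (hw.t_integrable i)
  obtain ⟨hQ1, -⟩ := integral_repl hA i (hw.integrable_q hA i)
  have hQs : Integrable (fun s => interimAlloc A m i s * s) (A i).typeLaw := by
    have hb : ∀ᵐ s ∂(A i).typeLaw, ‖interimAlloc A m i s‖ ≤ 1 := by
      filter_upwards [Agent.ae_mem_types] with s hs
      rw [Real.norm_of_nonneg (hw.interimAlloc_nonneg hA i hs)]
      exact hw.interimAlloc_le_one hA i hs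
    exact (hA i).typeLaw_id_integrable.bdd_mul hQ1.aestronglyMeasurable hb
  -- A truthful agent's income averages to his type, so gross utility is Q(s)s minus the expected
  -- contingent payment.
  have hU : (fun s => expUtility A (utility A m) i s s) =ᵐ[(A i).typeLaw] fun s =>
      interimAlloc A m i s * s
        - ∫ x, (∫ θ, J (repl θ i s, x) ∂(profileLaw A)) ∂((A i).incomeLaw s) := by
    filter_upwards [hJ1, Agent.ae_mem_types] with s hs hsT
    have e : (fun x => utility A m i s ((A i).proj s x) x) =ᵐ[(A i).incomeLaw s]
        fun x => interimAlloc A m i s * x - ∫ θ, J (repl θ i s, x) ∂(profileLaw A) := by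
      filter_upwards [Agent.ae_mem_incomes s] with x hx
      rw [Agent.proj_of_mem hx,
        utility_eq hA hw hf hsT hx (Agent.incomes_subset_allIncomes hsT hx)]
    rw [expUtility, integral_congr_ae e,
      integral_sub (((hA i).income_integrable s hsT).const_mul _) hs, integral_const_mul,
      (hA i).income_mean s hsT]
  have hUi : Integrable (fun s => expUtility A (utility A m) i s s) (A i).typeLaw :=
    (hQs.sub hJ2).congr hU.symm
  have hv : Integrable (netUtility A m i) (A i).typeLaw := hUi.sub hT1
  refine ⟨hv, hQs, hB2, ?_⟩
  have hL : (fun θ => m.t i θ + m.q i θ * ∫ x, (m.r i θ x + m.a i θ x * (m.p i θ x x - (A i).c))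
      ∂((A i).incomeLaw (θ i))) =ᵐ[profileLaw A] fun θ => m.t i θ
        + (∫ x, J (θ, x) ∂((A i).incomeLaw (θ i))
          - (A i).c * ∫ x, auditFun A m i (θ, x) ∂((A i).incomeLaw (θ i))) := by
    have hJθ : ∀ᵐ θ ∂(profileLaw A), Integrable (fun x => J (θ, x)) (winnerKernel hA i θ) :=
      ((Measure.integrable_compProd_iff hJi.aestronglyMeasurable).1 hJi).1
    have hBθ : ∀ᵐ θ ∂(profileLaw A), Integrable (fun x => auditFun A m i (θ, x)) (winnerKernel hA i θ) :=
      ((Measure.integrable_compProd_iff hBi.aestronglyMeasurable).1 hBi).1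
    filter_upwards [hJθ, hBθ, ae_mem_profiles hA, ae_histories hA i] with θ h1 h2 hθ hx
    rw [winnerKernel_of_mem hA hθ] at h1 h2
    rw [← integral_const_mul, ← integral_const_mul, ← integral_sub h1 (h2.const_mul _)]
    congr 1
    refine integral_congr_ae (hx.mono fun x hx => ?_)
    simp only [hJe _ hx, auditFun, indicator_of_mem hx]
    ring
  rw [integral_congr_ae hL, integral_add_sub_const_mul (hw.t_integrable i) hJ3 hB3, ← hJ4, ← hB4, ← hT2]
  -- Payments are transfers within the pair: what the principal receives is the surplus Q(s)s minus
  -- net utility, before audit costs.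
  have e2 : (fun s => interimAlloc A m i s * s - netUtility A m i s
        - (A i).c * ∫ x, interimAudit A m i s x ∂((A i).incomeLaw s)) =ᵐ[(A i).typeLaw] fun s =>
      interimTransfer A m i s + ((∫ x, (∫ θ, J (repl θ i s, x) ∂(profileLaw A)) ∂((A i).incomeLaw s))
        - (A i).c * ∫ x, interimAudit A m i s x ∂((A i).incomeLaw s)) := by
    filter_upwards [hU] with s hs
    rw [netUtility, hs]
    ring
  rw [integral_congr_ae e2]
  exact (integral_add_sub_const_mul hT1 hJ2 hB2 _).symm

theorem Agent.Valid.integrable_finiteVirtualValue {A : Agent} (hA : A.Valid) (hreg : A.Regular) :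
    Integrable A.finiteVirtualValue A.typeLaw := by
  have := hA.typeLaw_prob
  have hinv : Integrable A.invHazard A.typeLaw := by
    simpa using hA.integrable_invHazard_mul (k := fun _ => 1) measurable_const (C := 1) (by simp)
  refine Integrable.mono' (g := fun s => |s| + 2 * A.invHazard s + |A.c|)
    ((hA.typeLaw_id_integrable.abs.add (hinv.const_mul 2)).add (integrable_const _)) ?_ ?_
  · refine ((hA.measurable_virtualValue_clamp hreg).ereal_toReal).aestronglyMeasurable.congr ?_
    filter_upwards [Agent.ae_mem_Ioo] with s hs
    rw [Agent.clamp_of_mem (Ioo_subset_Icc_self hs), Agent.toReal_virtualValue hs.1]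
  · filter_upwards [Agent.ae_mem_Ioo] with s hs
    exact hA.abs_finiteVirtualValue_le hs

/-! ### The upper bound on the payoff of a feasible mechanism -/

section

variable (hA : ∀ i, (A i).Valid) (hm : Feasible A m)
include hA hm

/-- With the report fixed, the payment reacts to true income only through the penalty, with slope
between 0 and φ, and only when the agent wins and is audited. -/
theorem utility_sub_mem {i : Fin N} {s x' x y : ℝ} (hs : s ∈ (A i).types)
    (hx' : x' ∈ (A i).incomes s) (hx : x ∈ (A i).allIncomes) (hy : y ∈ (A i).allIncomes)
    (hxy : x ≤ y) :
    (interimAlloc A m i s - (A i).φ * interimAudit A m i s x') * (y - x)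
        ≤ utility A m i s x' y - utility A m i s x' x ∧
      utility A m i s x' y - utility A m i s x' x ≤ interimAlloc A m i s * (y - x) := by
  rcases hxy.eq_or_lt with rfl | hlt
  · simp
  have hw := hm.wellDefined
  have hix := integrable_payFun_repl hA hw hm.finite hs hx' hx
  have hiy := integrable_payFun_repl hA hw hm.finite hs hx' hy
  have key : ∀ᵐ θ ∂(profileLaw A),
      0 ≤ payFun A m i ((repl θ i s, x'), y) - payFun A m i ((repl θ i s, x'), x) ∧
        payFun A m i ((repl θ i s, x'), y) - payFun A m i ((repl θ i s, x'), x)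
          ≤ (A i).φ * (y - x) * auditFun A m i (repl θ i s, x') := by
    filter_upwards [ae_mem_profiles hA] with θ hθ
    have hh : (repl θ i s, x') ∈ histories A i := by
      refine ⟨repl_mem_profiles hθ hs, ?_⟩
      change x' ∈ (A i).incomes (repl θ i s i)
      rwa [repl_self]
    obtain ⟨h1, h2⟩ := hm.doubleMonotone i _ hh x hx y hy hlt
    have h3 := hw.auditFun_nonneg i (repl θ i s, x')
    have e : auditFun A m i (repl θ i s, x') = m.q i (repl θ i s) * m.a i (repl θ i s) x' :=
      indicator_of_mem hh _
    rw [payFun_of_mem hθ hs hx' hx, payFun_of_mem hθ hs hx' hy]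
    have e2 : m.q i (repl θ i s) * (m.r i (repl θ i s) x' + m.a i (repl θ i s) x' * m.p i (repl θ i s) x' y)
        - m.q i (repl θ i s) * (m.r i (repl θ i s) x' + m.a i (repl θ i s) x' * m.p i (repl θ i s) x' x)
        = auditFun A m i (repl θ i s, x') * (m.p i (repl θ i s) x' y - m.p i (repl θ i s) x' x) := by
      rw [e]
      ring
    rw [e2]
    refine ⟨mul_nonneg h3 h1, ?_⟩
    calc _ ≤ auditFun A m i (repl θ i s, x') * ((y - x) * (A i).φ) := mul_le_mul_of_nonneg_left h2 h3
      _ = _ := by ring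
  have h0 : 0 ≤ ∫ θ, (payFun A m i ((repl θ i s, x'), y) - payFun A m i ((repl θ i s, x'), x))
      ∂(profileLaw A) := integral_nonneg_of_ae (key.mono fun _ h => h.1)
  have h1 : ∫ θ, (payFun A m i ((repl θ i s, x'), y) - payFun A m i ((repl θ i s, x'), x))
      ∂(profileLaw A) ≤ (A i).φ * (y - x) * interimAudit A m i s x' := by
    rw [interimAudit, ← integral_const_mul]
    exact integral_mono_ae (hiy.sub hix) ((hw.integrable_auditFun_repl hA i s x').const_mul _)
      (key.mono fun _ h => h.2)
  rw [integral_sub hiy hix] at h0 h1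
  rw [utility_eq hA hw hm.finite hs hx' hx, utility_eq hA hw hm.finite hs hx' hy]
  constructor <;> linarith

theorem slope_nonneg {i : Fin N} {s x : ℝ} (hs : s ∈ (A i).types) :
    0 ≤ interimAlloc A m i s - (A i).φ * interimAudit A m i s x := by
  have h1 := hm.wellDefined.interimAudit_nonneg i s x
  have h2 := hm.wellDefined.interimAudit_le hA i hs x
  have h3 := mul_le_of_le_one_left h1 (hA i).φ_mem.2
  linarith

theorem utility_sub_mem' {i : Fin N} {s x' x y : ℝ} (hs : s ∈ (A i).types)
    (hx' : x' ∈ (A i).incomes s) (hx : x ∈ (A i).allIncomes) (hy : y ∈ (A i).allIncomes)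
    (hxy : x ≤ y) :
    0 ≤ utility A m i s x' y - utility A m i s x' x ∧
      utility A m i s x' y - utility A m i s x' x ≤ y - x := by
  obtain ⟨h1, h2⟩ := utility_sub_mem hA hm hs hx' hx hy hxy
  refine ⟨(mul_nonneg (slope_nonneg hA hm hs) (sub_nonneg.2 hxy)).trans h1, h2.trans ?_⟩
  exact mul_le_of_le_one_left (sub_nonneg.2 hxy) (hm.wellDefined.interimAlloc_le_one hA i hs)

/-- The lower bound comes from income `y` imitating the report `x`, the upper bound from income `x`
imitating the report `y`. -/
theorem truthful_sub_mem {i : Fin N} {s x y : ℝ} (hs : s ∈ (A i).types)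
    (hx : x ∈ (A i).incomes s) (hy : y ∈ (A i).incomes s) (hxy : x ≤ y) :
    (interimAlloc A m i s - (A i).φ * interimAudit A m i s x) * (y - x)
        ≤ utility A m i s y y - utility A m i s x x ∧
      utility A m i s y y - utility A m i s x x ≤ y - x := by
  have hxa := Agent.incomes_subset_allIncomes hs hx
  have hya := Agent.incomes_subset_allIncomes hs hy
  have h1 := hm.incentives.ic_income i s hs y hy x hx
  have h2 := hm.incentives.ic_income i s hs x hx y hy
  have h3 := (utility_sub_mem hA hm hs hx hxa hya hxy).1
  have h4 := (utility_sub_mem' hA hm hs hy hxa hya hxy).2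
  constructor <;> linarith

/-- Move from x to its projection, on to the projection of y, then to y: the report is fixed on the
outer pieces and truthful on the middle one. If the projections coincide, the report is fixed
throughout. -/
theorem projected_sub_mem {i : Fin N} {s x y : ℝ} (hs : s ∈ (A i).types)
    (hx : x ∈ (A i).allIncomes) (hy : y ∈ (A i).allIncomes) (hxy : x ≤ y) :
    0 ≤ utility A m i s ((A i).proj s y) y - utility A m i s ((A i).proj s x) x ∧
      utility A m i s ((A i).proj s y) y - utility A m i s ((A i).proj s x) x ≤ y - x := by
  have hlt := (hA i).iLo_lt_iHi s hs
  have hX := Agent.proj_mem hlt x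
  have hY := Agent.proj_mem hlt y
  by_cases he : (A i).proj s x = (A i).proj s y
  · rw [he]
    exact utility_sub_mem' hA hm hs hY hx hy hxy
  have h1 : (A i).iLo s < y := by
    by_contra h
    push Not at h
    exact he (by rw [Agent.proj_of_le h hlt, Agent.proj_of_le (hxy.trans h) hlt])
  have h2 : (x : EReal) < (A i).iHi s := by
    by_contra h
    push Not at h
    refine he (EReal.coe_eq_coe_iff.1 ?_)
    rw [Agent.proj_of_ge h hlt, Agent.proj_of_ge (h.trans (EReal.coe_le_coe_iff.2 hxy)) hlt]
  have hYy : (A i).proj s y ≤ y := by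
    rcases le_total ((A i).iHi s) y with h | h
    · rw [← EReal.coe_le_coe_iff, Agent.proj_of_ge h hlt]
      exact h
    · rw [Agent.proj_of_mem ⟨h1.le, h⟩]
  have hxX : x ≤ (A i).proj s x ∧ (A i).proj s x ≤ (A i).proj s y := by
    rcases le_total x ((A i).iLo s) with h | h
    · rw [Agent.proj_of_le h hlt]
      exact ⟨h, hY.1⟩
    · rw [Agent.proj_of_mem ⟨h, h2.le⟩]
      refine ⟨le_rfl, ?_⟩
      rcases le_total ((A i).iHi s) y with h' | h'
      · rw [← EReal.coe_le_coe_iff, Agent.proj_of_ge h' hlt]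
        exact h2.le
      · rwa [Agent.proj_of_mem ⟨h1.le, h'⟩]
  have hXa := Agent.incomes_subset_allIncomes hs hX
  have hYa := Agent.incomes_subset_allIncomes hs hY
  have b1 := utility_sub_mem' hA hm hs hY hYa hy hYy
  have b2 := truthful_sub_mem hA hm hs hX hY hxX.2
  have b3 := utility_sub_mem' hA hm hs hX hx hXa hxX.1
  have b4 := mul_nonneg (slope_nonneg hA hm (x := (A i).proj s x) hs) (sub_nonneg.2 hxX.2)
  constructor <;> linarith [b1.1, b1.2, b2.1, b2.2, b3.1, b3.2]

/-- The marginal utility of income after the type report `s`. -/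
theorem exists_marginal (i : Fin N) {s : ℝ} (hs : s ∈ (A i).types) :
    ∃ k : ℝ → ℝ, Measurable k ∧ (∀ x, |k x| ≤ 1) ∧
      (∃ C : ℝ, ∀ t ∈ (A i).types, expUtility A (utility A m) i s t
        = C + ∫ x, (∫ y in (0 : ℝ)..x, k y) ∂((A i).incomeLaw t)) ∧
      ∀ᵐ x, x ∈ (A i).incomesInt s →
        interimAlloc A m i s - (A i).φ * interimAudit A m i s x ≤ k x := by
  have hlip : LipschitzOnWith 1 (fun x => utility A m i s ((A i).proj s x) x) (A i).allIncomes := by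
    refine LipschitzOnWith.of_dist_le_mul fun x hx y hy => ?_
    rw [Real.dist_eq, Real.dist_eq, NNReal.coe_one, one_mul]
    rcases le_total x y with h | h
    · obtain ⟨h1, h2⟩ := projected_sub_mem hA hm hs hx hy h
      rw [abs_sub_comm, abs_of_nonneg h1, abs_sub_comm, abs_of_nonneg (sub_nonneg.2 h)]
      exact h2
    · obtain ⟨h1, h2⟩ := projected_sub_mem hA hm hs hy hx h
      rw [abs_of_nonneg h1, abs_of_nonneg (sub_nonneg.2 h)]
      exact h2
  -- The Lipschitz extension to the line is the integral of its bounded derivative, which serves as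
  -- the marginal utility.
  obtain ⟨w, hwl, hwe⟩ := hlip.extend_real
  have hb : ∀ x, |deriv w x| ≤ 1 := fun x => by
    have := norm_deriv_le_of_lipschitz (x₀ := x) hwl
    simpa using this
  refine ⟨deriv w, measurable_deriv w, hb, ⟨w 0, fun t ht => ?_⟩, ?_⟩
  · have := (hA i).incomeLaw_prob t ht
    have e : (fun x => utility A m i s ((A i).proj s x) x) =ᵐ[(A i).incomeLaw t]
        fun x => w 0 + ∫ y in (0 : ℝ)..x, deriv w y := by
      filter_upwards [Agent.ae_mem_incomes t] with x hx
      rw [← sub_eq_integral_deriv_of_lipschitz hwl, add_sub_cancel]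
      exact hwe (Agent.incomes_subset_allIncomes ht hx)
    rw [expUtility, integral_congr_ae e, integral_add (integrable_const _)
      ((hA i).integrable_primitive ht (measurable_deriv w) hb)]
    simp
  -- Inside the reported support the projection is the identity, so the right difference quotients
  -- inherit the bound for truthful reports.
  · filter_upwards [hwl.ae_differentiableAt_real] with x hd hx
    have hsl := hd.hasDerivAt.tendsto_slope
    have hle : 𝓝[>] x ≤ 𝓝[≠] x := nhdsWithin_mono _ fun y (hy : x < y) => hy.ne'
    refine ge_of_tendsto (hsl.mono_left hle) ?_
    obtain ⟨y', h1, h2⟩ := EReal.lt_iff_exists_real_btwn.1 hx.2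
    filter_upwards [Ioo_mem_nhdsGT (EReal.coe_lt_coe_iff.1 h1)] with y hy
    have hyI : y ∈ (A i).incomes s :=
      ⟨hx.1.le.trans hy.1.le, (EReal.coe_le_coe_iff.2 hy.2.le).trans h2.le⟩
    have hxI := Agent.incomesInt_subset_incomes _ hx
    rw [slope_def_field, le_div_iff₀ (sub_pos.2 hy.1),
      ← hwe (Agent.incomes_subset_allIncomes hs hxI), ← hwe (Agent.incomes_subset_allIncomes hs hyI)]
    simp only
    rw [Agent.proj_of_mem hxI, Agent.proj_of_mem hyI]
    exact (truthful_sub_mem hA hm hs hxI hyI hy.1.le).1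

/-- Type `s` may report `t`; compared with type `t` he then differs only by his income law, under
which a 1-Lipschitz function is averaged. -/
theorem netUtility_sub_le (i : Fin N) {s t : ℝ} (hs : s ∈ (A i).types) (ht : t ∈ (A i).types) :
    netUtility A m i t - netUtility A m i s ≤ |t - s| := by
  obtain ⟨k, hk, hk1, ⟨C, hC⟩, -⟩ := exists_marginal hA hm i ht
  have h1 := hm.incentives.ic_type i s hs t ht
  have h2 := (le_abs_self _).trans ((hA i).abs_integral_primitive_sub_le hs ht hk hk1)
  have h3 := hC s hs
  have h4 := hC t ht
  unfold netUtility
  linarith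

/-- The envelope inequality: information rents grow at least at the rate left by auditing. -/
theorem le_deriv_netUtility (i : Fin N) {z : ℝ} (hz : z ∈ Ioo (A i).tLo (A i).tHi) {v : ℝ → ℝ}
    (hv : EqOn (netUtility A m i) v (A i).types) (hd : DifferentiableAt ℝ v z) :
    interimAlloc A m i z - (A i).φ * ∫ x in Ioi 0, interimAudit A m i z x * -(A i).G₂ z x
      ≤ deriv v z := by
  have hzT := Ioo_subset_Icc_self hz
  have hw := hm.wellDefined
  obtain ⟨k, hk, hk1, ⟨C, hC⟩, hkz⟩ := exists_marginal hA hm i hzT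
  have hder := ((hA i).hasDerivWithinAt_integral_primitive hzT hk hk1).hasDerivAt
    (Agent.types_mem_nhds hz)
  -- No type gains by reporting `z`, so rents minus the payoff from that report are smallest at `z`.
  -- The first-order condition identifies the slope of rents there with the mean of `k` under −G₂.
  have hmin : IsLocalMin
      (fun t => v t - ∫ x, (∫ y in (0 : ℝ)..x, k y) ∂((A i).incomeLaw t)) z := by
    filter_upwards [Agent.types_mem_nhds hz] with t ht
    have h1 := hm.incentives.ic_type i t ht z hzT
    have h3 := hC z hzT
    have h4 := hC t ht
    rw [← hv hzT, ← hv ht]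
    unfold netUtility
    linarith
  have h0 := hmin.hasDerivAt_eq_zero (hd.hasDerivAt.sub hder)
  have hG := (hA i).integrable_G₂ hzT
  have hB := hw.measurable_interimAudit hA i z
  have hi1 : IntegrableOn (fun x => interimAudit A m i z x * -(A i).G₂ z x) (Ioi 0) :=
    (hG.neg.bdd_mul hB.aestronglyMeasurable
      (ae_of_all _ (hw.abs_interimAudit_le_one hA i hzT))).integrableOn
  have hi2 : IntegrableOn (fun x => k x * -(A i).G₂ z x) (Ioi 0) :=
    (hG.neg.bdd_mul hk.aestronglyMeasurable (ae_of_all _ hk1)).integrableOn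
  have hi3 : IntegrableOn (fun x => interimAlloc A m i z * -(A i).G₂ z x) (Ioi 0) :=
    hG.neg.integrableOn.const_mul _
  have e : interimAlloc A m i z - (A i).φ * ∫ x in Ioi 0, interimAudit A m i z x * -(A i).G₂ z x
      = ∫ x in Ioi 0, (interimAlloc A m i z * -(A i).G₂ z x
        - (A i).φ * (interimAudit A m i z x * -(A i).G₂ z x)) := by
    rw [integral_sub hi3 (hi1.const_mul _), integral_const_mul,
      integral_const_mul, (hA i).integral_neg_G₂ hzT, mul_one]
  rw [e, sub_eq_zero.1 h0]
  refine integral_mono_ae (hi3.sub (hi1.const_mul _)) hi2 ?_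
  filter_upwards [ae_restrict_of_ae hkz] with x hx
  by_cases hxz : x ∈ (A i).incomesInt z
  · have := mul_le_mul_of_nonneg_right (hx hxz) (neg_nonneg.2 ((hA i).G₂_nonpos z x))
    linarith
  · simp [(hA i).G₂_eq_zero hz hxz]

/-- Rents are Lipschitz, hence the integral of their derivative plus the rent of the lowest type,
which participation makes nonnegative. Integration by parts against the type law produces the
inverse hazard rate. -/
theorem integral_netUtility_ge (i : Fin N) : ∃ d : ℝ → ℝ,
    Integrable (fun s => (A i).invHazard s * d s) (A i).typeLaw ∧
      ∫ s, (A i).invHazard s * d s ∂(A i).typeLaw ≤ ∫ s, netUtility A m i s ∂(A i).typeLaw ∧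
      ∀ᵐ s ∂(A i).typeLaw, interimAlloc A m i s
        - (A i).φ * ∫ x in Ioi 0, interimAudit A m i s x * -(A i).G₂ s x ≤ d s := by
  have := (hA i).typeLaw_prob
  have hlip : LipschitzOnWith 1 (netUtility A m i) (A i).types := by
    refine LipschitzOnWith.of_dist_le_mul fun s hs t ht => ?_
    rw [Real.dist_eq, Real.dist_eq, NNReal.coe_one, one_mul, abs_le']
    refine ⟨netUtility_sub_le hA hm i ht hs, ?_⟩
    rw [neg_sub, abs_sub_comm]
    exact netUtility_sub_le hA hm i hs ht
  obtain ⟨v, hvl, hve⟩ := hlip.extend_real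
  have hb : ∀ x, |deriv v x| ≤ 1 := fun x => by
    have := norm_deriv_le_of_lipschitz (x₀ := x) hvl
    simpa using this
  obtain ⟨h1, h2⟩ := (hA i).integral_typeLaw_primitive (measurable_deriv v) hb
  refine ⟨deriv v, (hA i).integrable_invHazard_mul (measurable_deriv v) hb, ?_, ?_⟩
  · have e : netUtility A m i =ᵐ[(A i).typeLaw]
        fun s => v (A i).tLo + ∫ z in (A i).tLo..s, deriv v z := by
      filter_upwards [Agent.ae_mem_types] with s hs
      rw [← sub_eq_integral_deriv_of_lipschitz hvl, add_sub_cancel]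
      exact hve hs
    rw [integral_congr_ae e, integral_add (integrable_const _) h1, h2]
    have : 0 ≤ v (A i).tLo := by
      rw [← hve (hA i).tLo_mem]
      exact hm.incentives.ir i _ (hA i).tLo_mem
    simpa using this
  · filter_upwards [Agent.ae_mem_Ioo,
      Agent.typeLaw_absolutelyContinuous.ae_le hvl.ae_differentiableAt_real] with s hs hd
    exact le_deriv_netUtility hA hm i hs hve hd

theorem agentPayoff_le (hreg : ∀ i, (A i).Regular) (i : Fin N) :
    ∫ θ, (m.t i θ + m.q i θ * ∫ x, (m.r i θ x + m.a i θ x * (m.p i θ x x - (A i).c))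
      ∂((A i).incomeLaw (θ i))) ∂(profileLaw A)
    ≤ ∫ s, interimAlloc A m i s * (A i).finiteVirtualValue s ∂(A i).typeLaw := by
  have hw := hm.wellDefined
  obtain ⟨hv, hQ, hB, e⟩ := agentPayoff_eq hA hw hm.finite i
  obtain ⟨d, hd1, hd2, hd3⟩ := integral_netUtility_ge hA hm i
  have hcB := hB.const_mul (A i).c
  have hQv : Integrable (fun s => interimAlloc A m i s * (A i).finiteVirtualValue s)
      (A i).typeLaw := by
    refine ((hA i).integrable_finiteVirtualValue (hreg i)).bdd_mul (c := 1)
      (integral_repl hA i (hw.integrable_q hA i)).1.aestronglyMeasurable ?_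
    filter_upwards [Agent.ae_mem_types] with s hs
    rw [Real.norm_of_nonneg (hw.interimAlloc_nonneg hA i hs)]
    exact hw.interimAlloc_le_one hA i hs
  have hI : Integrable (fun s => interimAlloc A m i s * s - (A i).invHazard s * d s)
      (A i).typeLaw := hQ.sub hd1
  have hI' : Integrable (fun s => interimAlloc A m i s * s - netUtility A m i s)
      (A i).typeLaw := hQ.sub hv
  rw [e, integral_sub hI' hcB, integral_sub hQ hv]
  have h1 : ∫ s, (interimAlloc A m i s * s - (A i).invHazard s * d s
      - (A i).c * ∫ x, interimAudit A m i s x ∂((A i).incomeLaw s)) ∂(A i).typeLaw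
      ≤ ∫ s, interimAlloc A m i s * (A i).finiteVirtualValue s ∂(A i).typeLaw := by
    refine integral_mono_ae (hI.sub hcB) hQv ?_
    filter_upwards [hd3, Agent.ae_mem_Ioo] with s hs hsI
    have hsT := Ioo_subset_Icc_self hsI
    have := (hA i).incomeLaw_prob s hsT
    have hBm := hw.measurable_interimAudit hA i s
    have hB1 := hw.abs_interimAudit_le_one hA i hsT
    have hBmu := (hA i).integrable_mul_mu hsI hBm.aestronglyMeasurable hB1
    have hBi : Integrable (fun x => interimAudit A m i s x) ((A i).incomeLaw s) :=
      Integrable.of_bound hBm.aestronglyMeasurable 1 (ae_of_all _ hB1)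
    have hnet := (hA i).integrable_net_mu hsI
    -- The inverse hazard rate turns −G₂ into μ under the income law. The audit probability then
    -- multiplies μφ − c, and it lies between 0 and the winning probability.
    have hE : (A i).φ * ((A i).invHazard s
          * ∫ x in Ioi 0, interimAudit A m i s x * -(A i).G₂ s x)
        - (A i).c * ∫ x, interimAudit A m i s x ∂((A i).incomeLaw s)
        ≤ interimAlloc A m i s
          * ∫ x, max ((A i).mu s x * (A i).φ - (A i).c) 0 ∂((A i).incomeLaw s) := by
      rw [← (hA i).integral_mul_mu hsI, ← integral_const_mul, ← integral_const_mul,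
        ← integral_sub (hBmu.const_mul _) (hBi.const_mul _), ← integral_const_mul]
      refine integral_mono ((hBmu.const_mul _).sub (hBi.const_mul _)) (hnet.pos_part.const_mul _)
        fun x => ?_
      have h1 := hw.interimAudit_nonneg i s x
      have h2 := hw.interimAudit_le hA i hsT x
      calc (A i).φ * (interimAudit A m i s x * (A i).mu s x) - (A i).c * interimAudit A m i s x
          = interimAudit A m i s x * ((A i).mu s x * (A i).φ - (A i).c) := by ring
        _ ≤ interimAudit A m i s x * max ((A i).mu s x * (A i).φ - (A i).c) 0 :=
          mul_le_mul_of_nonneg_left (le_max_left _ _) h1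
        _ ≤ _ := mul_le_mul_of_nonneg_right h2 (le_max_right _ _)
    have hmul := mul_le_mul_of_nonneg_left hs ((hA i).invHazard_nonneg hsI)
    simp only [Agent.finiteVirtualValue]
    linarith
  rw [integral_sub hI hcB, integral_sub hQ hd1] at h1
  linarith

end

namespace Agent

variable {A : Agent}

/-! ### The contingent payments of the optimal mechanism -/

open Classical in
/-- Audit below the threshold, and at the top if the threshold is the top. -/
def auditRule (A : Agent) (θ x' : ℝ) : ℝ :=
  if (x' : EReal) < A.threshold θ ∨ ((x' : EReal) = A.threshold θ ∧ A.threshold θ = A.iHi θ)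
  then 1 else 0

/-- Income up to the threshold. -/
def cappedIncome (A : Agent) (θ x : ℝ) : ℝ := (min (x : EReal) (A.threshold θ)).toReal

/-- The royalty and the expected penalty after the type report `θ`, the income report `x'` and the
audit outcome `x`. -/
def contingentPay (A : Agent) (θ x' x : ℝ) : ℝ :=
  A.cappedIncome θ x' * A.φ + A.auditRule θ x' * ((x - x') * A.φ)

open Classical in
/-- The agent's share in an additional unit of income after the type report `θ`. -/
def share (A : Agent) (θ x : ℝ) : ℝ := 1 - A.φ * if (x : EReal) < A.extThreshold θ then 1 else 0

theorem extThreshold_nonneg (θ : ℝ) : 0 ≤ A.extThreshold θ :=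
  (threshold_nonneg θ).trans (threshold_le_extThreshold θ)

theorem toReal_min_nonneg {x : ℝ} (hx : 0 ≤ x) {τ : EReal} (hτ : 0 ≤ τ) :
    0 ≤ (min (x : EReal) τ).toReal :=
  EReal.toReal_nonneg (le_min (EReal.coe_le_coe_iff.2 hx) hτ)

theorem toReal_min_le {x : ℝ} (hx : 0 ≤ x) {τ : EReal} (hτ : 0 ≤ τ) :
    (min (x : EReal) τ).toReal ≤ x := by
  have h : (0 : EReal) ≤ min (x : EReal) τ := le_min (EReal.coe_le_coe_iff.2 hx) hτ
  have := EReal.toReal_le_toReal (min_le_left (x : EReal) τ)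
    (ne_bot_of_le_ne_bot (by simp) h) (EReal.coe_ne_top x)
  rwa [EReal.toReal_coe] at this

theorem cappedIncome_of_le {θ x : ℝ} (h : (x : EReal) ≤ A.threshold θ) : A.cappedIncome θ x = x := by
  rw [cappedIncome, min_eq_left h, EReal.toReal_coe]

theorem auditRule_mem (θ x : ℝ) : A.auditRule θ x ∈ Icc (0 : ℝ) 1 := by
  unfold auditRule
  split_ifs <;> simp

/-- Royalty and penalty telescope: concealed income is charged at the royalty rate. -/
theorem contingentPay_audited {θ x' : ℝ} (x : ℝ) (h : (x' : EReal) < A.threshold θ ∨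
    ((x' : EReal) = A.threshold θ ∧ A.threshold θ = A.iHi θ)) :
    A.contingentPay θ x' x = x * A.φ := by
  rw [contingentPay, auditRule, if_pos h, cappedIncome_of_le (h.elim le_of_lt fun h => h.1.le)]
  ring

theorem contingentPay_not_audited {θ x' : ℝ} (x : ℝ) (h : ¬((x' : EReal) < A.threshold θ ∨
    ((x' : EReal) = A.threshold θ ∧ A.threshold θ = A.iHi θ))) :
    A.contingentPay θ x' x = (A.threshold θ).toReal * A.φ := by
  rw [contingentPay, auditRule, if_neg h, cappedIncome, min_eq_right (not_lt.1 (not_or.1 h).1)]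
  ring

theorem contingentPay_self (θ x : ℝ) : A.contingentPay θ x x = A.cappedIncome θ x * A.φ := by
  rw [contingentPay]
  ring

theorem measurable_share (θ : ℝ) : Measurable (A.share θ) := by
  classical
  exact measurable_const.sub (measurable_const.mul (Measurable.ite
    (measurableSet_lt measurable_coe_real_ereal measurable_const) measurable_const measurable_const))

/-- The primitive of an indicator function. -/
theorem integral_ite_lt {x : ℝ} (hx : 0 ≤ x) {τ : EReal} (hτ : 0 ≤ τ) [∀ y : ℝ, Decidable ((y : EReal) < τ)] :
    ∫ y in (0 : ℝ)..x, (if (y : EReal) < τ then (1 : ℝ) else 0) = (min (x : EReal) τ).toReal := by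
  have hm : MeasurableSet {y : ℝ | (y : EReal) < τ} :=
    measurableSet_lt measurable_coe_real_ereal measurable_const
  have e : (fun y : ℝ => if (y : EReal) < τ then (1 : ℝ) else 0)
      = {y : ℝ | (y : EReal) < τ}.indicator fun _ => 1 := by
    ext y
    simp [indicator]
  rw [e, intervalIntegral.integral_of_le hx, setIntegral_indicator hm, setIntegral_const, smul_eq_mul,
    mul_one]
  rcases lt_or_ge (x : EReal) τ with h | h
  · have : Ioc 0 x ∩ {y : ℝ | (y : EReal) < τ} = Ioc 0 x :=
      inter_eq_left.2 fun y hy => (EReal.coe_le_coe_iff.2 hy.2).trans_lt h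
    rw [this, min_eq_left h.le, EReal.toReal_coe, Real.volume_real_Ioc_of_le hx, sub_zero]
  · lift τ to ℝ using ⟨ne_top_of_le_ne_top (EReal.coe_ne_top _) h, ne_bot_of_le_ne_bot (by simp) hτ⟩
    have hτ0 : 0 ≤ τ := EReal.coe_le_coe_iff.1 hτ
    have : Ioc 0 x ∩ {y : ℝ | (y : EReal) < τ} = Ioo 0 τ := by
      ext y
      constructor
      · rintro ⟨h1, h2⟩
        exact ⟨h1.1, EReal.coe_lt_coe_iff.1 h2⟩
      · rintro ⟨h1, h2⟩
        exact ⟨⟨h1, h2.le.trans (EReal.coe_le_coe_iff.1 h)⟩, EReal.coe_lt_coe_iff.2 h2⟩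
    rw [this, min_eq_right h, EReal.toReal_coe, Real.volume_real_Ioo_of_le hτ0, sub_zero]

theorem integral_share (θ : ℝ) {x : ℝ} (hx : 0 ≤ x) :
    ∫ y in (0 : ℝ)..x, A.share θ y
      = x - (min (x : EReal) (A.extThreshold θ)).toReal * A.φ := by
  classical
  have hi : IntervalIntegrable (fun y : ℝ => if (y : EReal) < A.extThreshold θ then (1 : ℝ) else 0)
      volume 0 x := by
    rw [intervalIntegrable_iff]
    refine Measure.integrableOn_of_bounded (M := 1) (by simp) ?_ (ae_of_all _ fun y => ?_)
    · exact (Measurable.ite (measurableSet_lt measurable_coe_real_ereal measurable_const)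
        measurable_const measurable_const).aestronglyMeasurable
    · split_ifs <;> simp
  have := integral_ite_lt hx (extThreshold_nonneg (A := A) θ)
  simp only [share]
  rw [intervalIntegral.integral_sub intervalIntegrable_const (hi.const_mul _),
    intervalIntegral.integral_const_mul]
  have e : ∫ y in (0 : ℝ)..x, (if (y : EReal) < A.extThreshold θ then (1 : ℝ) else 0)
      = (min (x : EReal) (A.extThreshold θ)).toReal := this
  rw [e]
  simp
  ring

open Classical in
/-- A measurable version of `1 - capPhi`, the share of the winner in a marginal increase of his
type. -/
def rentRate (A : Agent) : ℝ → ℝ :=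
  (Ioo A.tLo A.tHi).indicator fun z => 1 - A.φ * ∫ x : ℝ in Ioi 0,
    (if (x : EReal) ≤ A.threshold (A.clamp z) then 1 else 0) * -Valid.G₂Meas A z x

namespace Valid

variable (hA : A.Valid)
include hA

theorem abs_share_le (θ x : ℝ) : |A.share θ x| ≤ 1 := by
  have := hA.φ_mem.1
  have := hA.φ_mem.2
  unfold share
  rw [abs_le]
  split_ifs <;> constructor <;> linarith

theorem cappedIncome_mem {θ x : ℝ} (hθ : θ ∈ A.types) (hx : x ∈ A.incomes θ) :
    A.cappedIncome θ x ∈ Icc 0 x :=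
  ⟨toReal_min_nonneg ((hA.iLo_nonneg θ hθ).trans hx.1) (threshold_nonneg θ),
    toReal_min_le ((hA.iLo_nonneg θ hθ).trans hx.1) (threshold_nonneg θ)⟩

/-- Truth costs φ times the smaller of income and threshold; a misreport costs φ times income if it
is audited and φ times the threshold if not. -/
theorem contingentPay_self_le {θ x x' : ℝ} (hθ : θ ∈ A.types) (hx : x ∈ A.incomes θ) :
    A.contingentPay θ x x ≤ A.contingentPay θ x' x := by
  rw [contingentPay_self]
  by_cases h : (x' : EReal) < A.threshold θ ∨
    ((x' : EReal) = A.threshold θ ∧ A.threshold θ = A.iHi θ)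
  · rw [contingentPay_audited x h]
    exact mul_le_mul_of_nonneg_right (hA.cappedIncome_mem hθ hx).2 hA.φ_mem.1
  · rw [contingentPay_not_audited x h]
    have h1 : A.threshold θ ≤ x' := not_lt.1 (not_or.1 h).1
    refine mul_le_mul_of_nonneg_right ?_ hA.φ_mem.1
    refine EReal.toReal_le_toReal (min_le_right _ _) ?_ (ne_top_of_le_ne_top (EReal.coe_ne_top _) h1)
    exact ne_bot_of_le_ne_bot (by simp)
      (le_min (EReal.coe_le_coe_iff.2 ((hA.iLo_nonneg θ hθ).trans hx.1)) (threshold_nonneg θ))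

omit hA in
theorem cappedIncome_eq {θ x : ℝ} (hx : x ∈ A.incomes θ) :
    A.cappedIncome θ x = (min (x : EReal) (A.extThreshold θ)).toReal := by
  unfold cappedIncome extThreshold
  split_ifs with h
  · rw [h, min_eq_left hx.2, min_eq_left le_top]
  · rfl

/-- An income above the support is reported as the top income. That report is audited exactly when
the threshold is the top, and then the whole income is charged, as with an infinite threshold. This
is why the top report is audited. -/
theorem contingentPay_proj {θ x : ℝ} (hθ : θ ∈ A.types) (hx : 0 ≤ x) :
    A.contingentPay θ (A.proj θ x) x = (min (x : EReal) (A.extThreshold θ)).toReal * A.φ := by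
  have hlt := hA.iLo_lt_iHi θ hθ
  have hx0 : (0 : EReal) ≤ x := EReal.coe_le_coe_iff.2 hx
  have hHi : 0 < A.iHi θ := (EReal.coe_le_coe_iff.2 (hA.iLo_nonneg θ hθ)).trans_lt hlt
  rcases le_or_gt x (A.iLo θ) with h1 | h1
  · rw [proj_of_le h1 hlt]
    rcases (threshold_nonneg (A := A) θ).eq_or_lt with h0 | h0
    · have hne : A.threshold θ ≠ A.iHi θ := by
        rw [← h0]
        exact hHi.ne
      rw [contingentPay_not_audited, extThreshold, if_neg hne, ← h0, min_eq_right hx0]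
      rintro (h | h)
      · rw [← h0] at h
        exact absurd (EReal.coe_le_coe_iff.2 (hA.iLo_nonneg θ hθ)) (not_le.2 h)
      · exact hne h.2
    · obtain ⟨y, hy, -⟩ := exists_auditWorthy_gt le_rfl h0
      -- A positive threshold stems from some interior income worth auditing, so it exceeds the
      -- lower end and the bottom report is audited.
      have hlo : (A.iLo θ : EReal) < A.threshold θ :=
        (EReal.coe_lt_coe_iff.2 hy.1.1).trans_le hy.le_threshold
      rw [contingentPay_audited x (Or.inl hlo), min_eq_left, EReal.toReal_coe]
      exact ((EReal.coe_le_coe_iff.2 h1).trans hlo.le).trans (threshold_le_extThreshold θ)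
  rcases le_or_gt (A.iHi θ) x with h2 | h2
  · have hp := proj_of_ge h2 hlt
    by_cases h : A.threshold θ = A.iHi θ
    · rw [contingentPay_audited x (Or.inr ⟨hp.trans h.symm, h⟩), extThreshold, if_pos h,
        min_eq_left le_top, EReal.toReal_coe]
    · have hlt' : A.threshold θ < A.iHi θ := lt_of_le_of_ne (hA.threshold_le_iHi hθ) h
      rw [contingentPay_not_audited, extThreshold, if_neg h, min_eq_right (hlt'.le.trans h2)]
      rintro (h' | h')
      · rw [hp] at h'
        exact absurd h' (not_lt.2 hlt'.le)
      · exact h h'.2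
  · have hmem : x ∈ A.incomes θ := ⟨h1.le, h2.le⟩
    rw [proj_of_mem hmem, contingentPay_self, cappedIncome_eq hmem]

/-- Expected income net of contingent payments, for a type `s` who reports `θ`. -/
theorem integral_sub_contingentPay {θ s : ℝ} (hθ : θ ∈ A.types) (hs : s ∈ A.types) :
    ∫ x, (x - A.contingentPay θ (A.proj θ x) x) ∂(A.incomeLaw s)
      = ∫ x, (∫ y in (0 : ℝ)..x, A.share θ y) ∂(A.incomeLaw s) := by
  refine integral_congr_ae ?_
  filter_upwards [hA.ae_nonneg_income hs] with x hx
  rw [hA.contingentPay_proj hθ hx, integral_share θ hx]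

theorem integral_sub_cappedIncome {s : ℝ} (hs : s ∈ A.types) :
    ∫ x, (x - A.cappedIncome s x * A.φ) ∂(A.incomeLaw s)
      = ∫ x, (∫ y in (0 : ℝ)..x, A.share s y) ∂(A.incomeLaw s) := by
  rw [← hA.integral_sub_contingentPay hs hs]
  refine integral_congr_ae ?_
  filter_upwards [ae_mem_incomes s] with x hx
  rw [proj_of_mem hx, contingentPay_self]

theorem integral_sub_cappedIncome_mem {s : ℝ} (hs : s ∈ A.types) :
    ∫ x, (x - A.cappedIncome s x * A.φ) ∂(A.incomeLaw s) ∈ Icc 0 s := by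
  have hb : ∀ᵐ x ∂(A.incomeLaw s), x - A.cappedIncome s x * A.φ ∈ Icc 0 x := by
    filter_upwards [ae_mem_incomes s] with x hx
    obtain ⟨h1, h2⟩ := hA.cappedIncome_mem hs hx
    have h3 := mul_le_of_le_one_right h1 hA.φ_mem.2
    have h4 := mul_nonneg h1 hA.φ_mem.1
    exact ⟨by linarith, by linarith⟩
  have h0 := integral_nonneg_of_ae (hb.mono fun _ h => h.1)
  refine ⟨h0, ?_⟩
  calc _ ≤ ∫ x, x ∂(A.incomeLaw s) :=
        integral_mono_of_nonneg (hb.mono fun _ h => h.1) (hA.income_integrable s hs)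
          (hb.mono fun _ h => h.2)
    _ = s := hA.income_mean s hs

/-! ### Information rents in the optimal mechanism -/

omit hA in
open Classical in
theorem capPhi_eq (z : ℝ) : A.capPhi z = A.φ * ∫ x : ℝ in Ioi 0,
    (if (x : EReal) ≤ A.threshold z then 1 else 0) * -A.G₂ z x := by
  have hm : MeasurableSet {x : ℝ | (x : EReal) ≤ A.threshold z} :=
    measurableSet_le measurable_coe_real_ereal measurable_const
  have e : ∀ x : ℝ, (if (x : EReal) ≤ A.threshold z then (1 : ℝ) else 0) * -A.G₂ z x
      = {x : ℝ | (x : EReal) ≤ A.threshold z}.indicator (fun x => -A.G₂ z x) x := by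
    intro x
    by_cases h : (x : EReal) ≤ A.threshold z <;> simp [indicator, h]
  simp only [e]
  rw [setIntegral_indicator hm, integral_neg, capPhi, neg_mul, mul_neg]
  rfl

open Classical in
theorem rentRate_eq {z : ℝ} (hz : z ∈ Ioo A.tLo A.tHi) : A.rentRate z = 1 - A.capPhi z := by
  rw [rentRate, indicator_of_mem hz, capPhi_eq, clamp_of_mem (Ioo_subset_Icc_self hz)]
  congr 2
  refine integral_congr_ae ?_
  filter_upwards [ae_ne_endpoints (A := A) z Measure.absolutelyContinuous_restrict] with x hx
  rw [hA.G₂Meas_eq hz hx.1 hx.2]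

theorem measurable_rentRate (hreg : A.Regular) : Measurable A.rentRate := by
  classical
  refine Measurable.indicator ?_ measurableSet_Ioo
  refine measurable_const.sub (measurable_const.mul ?_)
  have h : Measurable fun p : ℝ × ℝ =>
      (if (p.2 : EReal) ≤ A.threshold (A.clamp p.1) then (1 : ℝ) else 0) * -G₂Meas A p.1 p.2 :=
    (Measurable.ite (measurableSet_le (measurable_coe_real_ereal.comp measurable_snd)
      ((hA.measurable_threshold_clamp hreg).comp measurable_fst)) measurable_const
      measurable_const).mul hA.measurable_G₂Meas.neg
  exact h.stronglyMeasurable.integral_prod_right'.measurable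

theorem integrableOn_ite_mul_G₂ {z : ℝ} (hz : z ∈ A.types) {p : ℝ → Prop}
    [DecidablePred p] (hp : MeasurableSet {x | p x}) :
    IntegrableOn (fun x => (if p x then (1 : ℝ) else 0) * -A.G₂ z x) (Ioi 0) := by
  refine ((hA.integrable_G₂ hz).neg.bdd_mul (c := 1) ?_ (ae_of_all _ fun x => ?_)).integrableOn
  · exact (Measurable.ite hp measurable_const measurable_const).aestronglyMeasurable
  · split_ifs <;> simp

theorem integral_ite_mul_G₂_mem {z : ℝ} (hz : z ∈ A.types) {p : ℝ → Prop}
    [DecidablePred p] (hp : MeasurableSet {x | p x}) :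
    ∫ x in Ioi 0, (if p x then (1 : ℝ) else 0) * -A.G₂ z x ∈ Icc (0 : ℝ) 1 := by
  constructor
  · refine integral_nonneg fun x => mul_nonneg ?_ (neg_nonneg.2 (hA.G₂_nonpos z x))
    split_ifs <;> simp
  · refine (integral_mono (hA.integrableOn_ite_mul_G₂ hz hp)
      (hA.integrable_G₂ hz).neg.integrableOn fun x => ?_).trans_eq (hA.integral_neg_G₂ hz)
    refine mul_le_of_le_one_left (neg_nonneg.2 (hA.G₂_nonpos z x)) ?_
    split_ifs <;> simp

theorem capPhi_mem {z : ℝ} (hz : z ∈ A.types) : A.capPhi z ∈ Icc (0 : ℝ) 1 := by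
  classical
  have h := hA.integral_ite_mul_G₂_mem hz (p := fun x : ℝ => (x : EReal) ≤ A.threshold z)
    (measurableSet_le measurable_coe_real_ereal measurable_const)
  rw [capPhi_eq]
  exact ⟨mul_nonneg hA.φ_mem.1 h.1, mul_le_one₀ hA.φ_mem.2 h.1 h.2⟩

theorem rentRate_mem (z : ℝ) : A.rentRate z ∈ Icc (0 : ℝ) 1 := by
  by_cases hz : z ∈ Ioo A.tLo A.tHi
  · rw [hA.rentRate_eq hz]
    have := hA.capPhi_mem (Ioo_subset_Icc_self hz)
    exact ⟨by linarith [this.2], by linarith [this.1]⟩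
  · rw [rentRate, indicator_of_notMem hz]
    simp

open Classical in
theorem integral_share_mul_G₂ {z : ℝ} (hz : z ∈ A.types) (s : ℝ) :
    ∫ x in Ioi 0, A.share s x * -A.G₂ z x = 1 - A.φ * ∫ x : ℝ in Ioi 0,
      (if (x : EReal) < A.extThreshold s then (1 : ℝ) else 0) * -A.G₂ z x := by
  have hi := hA.integrableOn_ite_mul_G₂ hz (p := fun x : ℝ => (x : EReal) < A.extThreshold s)
    (measurableSet_lt measurable_coe_real_ereal measurable_const)
  have hn : IntegrableOn (fun x => -A.G₂ z x) (Ioi 0) := (hA.integrable_G₂ hz).neg.integrableOn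
  have e := integral_sub hn (hi.const_mul A.φ)
  rw [hA.integral_neg_G₂ hz, integral_const_mul] at e
  rw [← e]
  refine integral_congr_ae (ae_of_all _ fun x => ?_)
  simp only [share]
  split_ifs <;> ring

omit hA in
theorem ae_coe_ne (μ : Measure ℝ) (hμ : μ ≪ volume) (τ : EReal) : ∀ᵐ x : ℝ ∂μ, (x : EReal) ≠ τ := by
  have h : ∀ᵐ x ∂μ, x ≠ τ.toReal := by
    rw [ae_iff]
    simpa using hμ (measure_singleton τ.toReal)
  filter_upwards [h] with x hx h'
  exact hx (by rw [← h', EReal.toReal_coe])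

/-- Rents grow faster than the gain from reporting a lower type. -/
theorem integral_share_le_of_gt (hreg : A.Regular) {s z : ℝ} (hs : s ∈ A.types) (hsz : s < z)
    (hz : z ∈ Ioo A.tLo A.tHi) (hf : s = A.tLo → A.f A.tLo ≠ 0) :
    ∫ x in Ioi 0, A.share s x * -A.G₂ z x ≤ A.rentRate z := by
  classical
  have hzT := Ioo_subset_Icc_self hz
  rw [hA.integral_share_mul_G₂ hzT, hA.rentRate_eq hz, capPhi_eq]
  refine sub_le_sub_left (mul_le_mul_of_nonneg_left ?_ hA.φ_mem.1) 1
  refine integral_mono_ae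
    (hA.integrableOn_ite_mul_G₂ hzT (p := fun x : ℝ => (x : EReal) ≤ A.threshold z)
      (measurableSet_le measurable_coe_real_ereal measurable_const))
    (hA.integrableOn_ite_mul_G₂ hzT (p := fun x : ℝ => (x : EReal) < A.extThreshold s)
      (measurableSet_lt measurable_coe_real_ereal measurable_const)) ?_
  -- Discarding the two thresholds reconciles strict and weak comparisons.
  filter_upwards [ae_coe_ne _ Measure.absolutelyContinuous_restrict (A.threshold z),
    ae_coe_ne _ Measure.absolutelyContinuous_restrict (A.extThreshold s)] with x h1 h2
  by_cases hx : x ∈ A.incomesInt z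
  · refine mul_le_mul_of_nonneg_right ?_ (neg_nonneg.2 (hA.G₂_nonpos z x))
    by_cases h : (x : EReal) ≤ A.threshold z
    · have h3 := hA.le_extThreshold_of_gt hreg hs hsz hz hf hx (lt_of_le_of_ne h h1)
      rw [if_pos h, if_pos (lt_of_le_of_ne h3 h2)]
    · rw [if_neg h]
      split_ifs <;> simp
  · simp [hA.G₂_eq_zero hz hx]

/-- Rents grow more slowly than the gain from reporting a higher type. -/
theorem le_integral_share_of_lt (hreg : A.Regular) {s z : ℝ} (hs : s ∈ A.types) (hzs : z < s)
    (hz : z ∈ Ioo A.tLo A.tHi) :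
    A.rentRate z ≤ ∫ x in Ioi 0, A.share s x * -A.G₂ z x := by
  classical
  have hzT := Ioo_subset_Icc_self hz
  rw [hA.integral_share_mul_G₂ hzT, hA.rentRate_eq hz, capPhi_eq]
  refine sub_le_sub_left (mul_le_mul_of_nonneg_left ?_ hA.φ_mem.1) 1
  refine integral_mono_ae
    (hA.integrableOn_ite_mul_G₂ hzT (p := fun x : ℝ => (x : EReal) < A.extThreshold s)
      (measurableSet_lt measurable_coe_real_ereal measurable_const))
    (hA.integrableOn_ite_mul_G₂ hzT (p := fun x : ℝ => (x : EReal) ≤ A.threshold z)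
      (measurableSet_le measurable_coe_real_ereal measurable_const)) (ae_of_all _ fun x => ?_)
  by_cases hx : x ∈ A.incomesInt z
  · refine mul_le_mul_of_nonneg_right ?_ (neg_nonneg.2 (hA.G₂_nonpos z x))
    by_cases h : (x : EReal) < A.extThreshold s
    · have h3 := hA.le_threshold_of_lt hreg hs hzs hz hx h
      rw [if_pos h, if_pos h3]
    · rw [if_neg h]
      split_ifs <;> simp
  · simp [hA.G₂_eq_zero hz hx]

omit hA in
theorem measurable_auditRule (θ : ℝ) : Measurable (A.auditRule θ) := by
  classical
  refine Measurable.ite ?_ measurable_const measurable_const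
  exact (measurableSet_lt measurable_coe_real_ereal measurable_const).union
    ((measurableSet_eq_fun measurable_coe_real_ereal measurable_const).inter
      (MeasurableSet.const _))

/-- The virtual value is attained by auditing below the threshold. -/
theorem finiteVirtualValue_eq (hreg : A.Regular) {s : ℝ} (hs : s ∈ Ioo A.tLo A.tHi) :
    A.finiteVirtualValue s = s - A.invHazard s * A.rentRate s
      - A.c * ∫ x, A.auditRule s x ∂(A.incomeLaw s) := by
  classical
  have hsT := Ioo_subset_Icc_self hs
  have := hA.incomeLaw_prob s hsT
  have hb : ∀ x, |A.auditRule s x| ≤ 1 := fun x => by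
    rw [abs_of_nonneg (auditRule_mem s x).1]
    exact (auditRule_mem s x).2
  have hm := measurable_auditRule (A := A) s
  have hmu := hA.integrable_mul_mu hs hm.aestronglyMeasurable hb
  have hi : Integrable (A.auditRule s) (A.incomeLaw s) :=
    Integrable.of_bound hm.aestronglyMeasurable 1 (ae_of_all _ hb)
  have e1 : A.invHazard s * A.capPhi s = A.φ * ∫ x, A.auditRule s x * A.mu s x ∂(A.incomeLaw s) := by
    rw [hA.integral_mul_mu hs, capPhi_eq, mul_left_comm]
    congr 2
    refine integral_congr_ae ?_
    filter_upwards [ae_coe_ne _ Measure.absolutelyContinuous_restrict (A.threshold s)] with x hx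
    congr 1
    unfold auditRule
    by_cases h : (x : EReal) < A.threshold s
    · rw [if_pos h.le, if_pos (Or.inl h)]
    · rw [if_neg (fun h' => h (lt_of_le_of_ne h' hx)), if_neg]
      rintro (h' | h')
      · exact h h'
      · exact hx h'.1
  -- Up to a null set the rule audits exactly the incomes with μφ ≥ c, so it collects the positive
  -- part.
  have e2 : ∫ x, max (A.mu s x * A.φ - A.c) 0 ∂(A.incomeLaw s)
      = A.φ * ∫ x, A.auditRule s x * A.mu s x ∂(A.incomeLaw s)
        - A.c * ∫ x, A.auditRule s x ∂(A.incomeLaw s) := by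
    rw [← integral_const_mul, ← integral_const_mul, ← integral_sub (hmu.const_mul _) (hi.const_mul _)]
    refine integral_congr_ae ?_
    filter_upwards [ae_mem_incomesInt s,
      ae_coe_ne _ (incomeLaw_absolutelyContinuous s) (A.threshold s)] with x hx hne
    by_cases h : (x : EReal) < A.threshold s
    · have hw := hA.auditWorthy_of_lt_threshold hreg hs hx h
      rw [max_eq_left (sub_nonneg.2 hw.2), auditRule, if_pos (Or.inl h)]
      ring
    · have hw : ¬ A.c ≤ A.mu s x * A.φ := fun h' =>
        h (lt_of_le_of_ne (AuditWorthy.le_threshold ⟨hx, h'⟩) hne)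
      rw [max_eq_right (by linarith), auditRule, if_neg]
      · ring
      · rintro (h' | h')
        · exact h h'
        · exact hne h'.1
  rw [finiteVirtualValue, e2, ← e1, hA.rentRate_eq hs]
  ring

end Valid

/-- Expected income net of contingent payments for type `s` after the report `θ`. -/
def netIncome (A : Agent) (θ s : ℝ) : ℝ :=
  ∫ x, (∫ y in (0 : ℝ)..x, A.share θ y) ∂(A.incomeLaw s)

namespace Valid

variable (hA : A.Valid)
include hA

theorem hasDerivAt_netIncome (θ : ℝ) {z : ℝ} (hz : z ∈ Ioo A.tLo A.tHi) :
    HasDerivAt (A.netIncome θ) (∫ x in Ioi 0, A.share θ x * -A.G₂ z x) z :=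
  (hA.hasDerivWithinAt_integral_primitive (Ioo_subset_Icc_self hz) (measurable_share θ)
    (hA.abs_share_le θ)).hasDerivAt (types_mem_nhds hz)

theorem lipschitzOnWith_netIncome (θ : ℝ) : LipschitzOnWith 1 (A.netIncome θ) A.types := by
  refine LipschitzOnWith.of_dist_le_mul fun s hs t ht => ?_
  rw [Real.dist_eq, Real.dist_eq, NNReal.coe_one]
  exact hA.abs_integral_primitive_sub_le ht hs (measurable_share θ) (hA.abs_share_le θ)

theorem netIncome_sub_eq (θ : ℝ) {s t : ℝ} (hs : s ∈ A.types) (ht : t ∈ A.types) (hst : s ≤ t) :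
    IntervalIntegrable (deriv (A.netIncome θ)) volume s t ∧
      A.netIncome θ t - A.netIncome θ s = ∫ z in s..t, deriv (A.netIncome θ) z := by
  have h := ((hA.lipschitzOnWith_netIncome θ).mono (s := uIcc s t) (by
    rw [uIcc_of_le hst]
    exact Icc_subset_Icc hs.1 ht.2)).absolutelyContinuousOnInterval
  exact ⟨h.intervalIntegrable_deriv, h.integral_deriv_eq_sub.symm⟩

/-- Revenue from misreports is dominated by the rents if the latter have slope `Q z * rentRate z`
with a nondecreasing winning probability `Q`. -/
theorem mul_netIncome_sub_le (hreg : A.Regular) {Q : ℝ → ℝ} (hQ : MonotoneOn Q A.types)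
    (hQ0 : ∀ z ∈ A.types, 0 ≤ Q z) (hQlo : A.f A.tLo = 0 → Q A.tLo = 0) {ρ : ℝ → ℝ}
    (hρ : Measurable ρ) (hρ1 : ∀ z, |ρ z| ≤ 1)
    (hρe : ∀ z ∈ Ioo A.tLo A.tHi, ρ z = Q z * A.rentRate z) {θ s : ℝ} (hθ : θ ∈ A.types)
    (hs : s ∈ A.types) : Q θ * (A.netIncome θ s - A.netIncome θ θ) ≤ ∫ z in θ..s, ρ z := by
  have hi : ∀ a b : ℝ, IntervalIntegrable ρ volume a b := fun a b => by
    rw [intervalIntegrable_iff]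
    exact Measure.integrableOn_of_bounded (M := 1) (by simp) hρ.aestronglyMeasurable
      (ae_of_all _ hρ1)
  -- Slopes are compared pointwise. Types above `θ` win at least as often and keep at least the
  -- share left by the report `θ`; for types below `θ` both comparisons reverse.
  rcases le_total θ s with h | h
  · obtain ⟨i1, e1⟩ := hA.netIncome_sub_eq θ hθ hs h
    rw [e1, ← intervalIntegral.integral_const_mul]
    refine intervalIntegral.integral_mono_on_of_le_Ioo h (i1.const_mul _) (hi _ _) fun z hz => ?_
    have hz' : z ∈ Ioo A.tLo A.tHi := ⟨hθ.1.trans_lt hz.1, hz.2.trans_le hs.2⟩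
    rw [(hA.hasDerivAt_netIncome θ hz').deriv, hρe z hz']
    have hr := (hA.rentRate_mem z).1
    have hzT := Ioo_subset_Icc_self hz'
    -- A lowest type with zero density never wins, so his threshold is irrelevant.
    by_cases hlo : θ = A.tLo ∧ A.f A.tLo = 0
    · rw [hlo.1, hQlo hlo.2, zero_mul]
      exact mul_nonneg (hQ0 z hzT) hr
    · exact (mul_le_mul_of_nonneg_left (hA.integral_share_le_of_gt hreg hθ hz.1 hz'
        fun h1 h2 => hlo ⟨h1, h2⟩) (hQ0 θ hθ)).trans
        (mul_le_mul_of_nonneg_right (hQ hθ hzT hz.1.le) hr)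
  · obtain ⟨i1, e1⟩ := hA.netIncome_sub_eq θ hs hθ h
    rw [intervalIntegral.integral_symm, ← neg_sub (A.netIncome θ θ), mul_neg, neg_le_neg_iff, e1,
      ← intervalIntegral.integral_const_mul]
    refine intervalIntegral.integral_mono_on_of_le_Ioo h (hi _ _) (i1.const_mul _) fun z hz => ?_
    have hz' : z ∈ Ioo A.tLo A.tHi := ⟨hs.1.trans_lt hz.1, hz.2.trans_le hθ.2⟩
    rw [(hA.hasDerivAt_netIncome θ hz').deriv, hρe z hz']
    have hr := (hA.rentRate_mem z).1
    have hzT := Ioo_subset_Icc_self hz'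
    exact (mul_le_mul_of_nonneg_right (hQ hzT hθ hz.2.le) hr).trans
      (mul_le_mul_of_nonneg_left (hA.le_integral_share_of_lt hreg hθ hz.2 hz') (hQ0 θ hθ))

/-- A measurable version of the net income of a truthful type. -/
theorem measurable_netIncome_self (hreg : A.Regular) :
    ∃ n : ℝ → ℝ, Measurable n ∧ ∀ s ∈ A.types, n s = A.netIncome s s := by
  have := hA.isMarkovKernel
  have hm : Measurable fun p : ℝ × ℝ =>
      p.2 - (min (p.2 : EReal) (A.threshold (A.clamp p.1))).toReal * A.φ :=
    measurable_snd.sub (((measurable_coe_real_ereal.comp measurable_snd).min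
      ((hA.measurable_threshold_clamp hreg).comp measurable_fst)).ereal_toReal.mul_const _)
  refine ⟨fun s => ∫ x, (x - (min (x : EReal) (A.threshold (A.clamp s))).toReal * A.φ)
    ∂(hA.incomeKernel s), (hm.stronglyMeasurable.integral_kernel_prod_right').measurable,
    fun s hs => ?_⟩
  simp only [hA.incomeKernel_of_mem hs, clamp_of_mem hs]
  exact hA.integral_sub_cappedIncome hs

theorem netIncome_self_mem {s : ℝ} (hs : s ∈ A.types) : A.netIncome s s ∈ Icc 0 s := by
  have := hA.integral_sub_cappedIncome_mem hs
  rwa [hA.integral_sub_cappedIncome hs] at this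

end Valid

end Agent

/-! ### The allocation rule of the optimal mechanism -/

theorem starQ_mem (i : Fin N) (θ : Fin N → ℝ) : starQ A i θ ∈ Icc (0 : ℝ) 1 := by
  unfold starQ
  split_ifs <;> simp

theorem starQ_eq_zero_of_ne {i j : Fin N} (hij : j ≠ i) {θ : Fin N → ℝ} (h : starQ A i θ ≠ 0) :
    starQ A j θ = 0 := by
  have hi := (ite_ne_right_iff.1 h).1
  refine if_neg fun hj => ?_
  exact lt_asymm ((le_max_left _ _).trans_lt (hi.2 j hij)) ((le_max_left _ _).trans_lt (hj.2 i hij.symm))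

theorem sum_starQ_mul {i : Fin N} {θ : Fin N → ℝ} (h : starQ A i θ ≠ 0) (v : Fin N → ℝ) :
    ∑ j, starQ A j θ * v j = v i := by
  have h1 : starQ A i θ = 1 := if_pos (ite_ne_right_iff.1 h).1
  rw [Finset.sum_eq_single i (fun j _ hj => by rw [starQ_eq_zero_of_ne hj h, zero_mul])
    (fun hi => absurd (Finset.mem_univ i) hi), h1, one_mul]

theorem sum_starQ_le (θ : Fin N → ℝ) : ∑ i, starQ A i θ ≤ 1 := by
  by_cases h : ∃ i, starQ A i θ ≠ 0
  · obtain ⟨i, hi⟩ := h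
    have := sum_starQ_mul hi fun _ => 1
    simp only [mul_one] at this
    exact this.le
  · push Not at h
    simp [h]

theorem starQ_repl_mono (hreg : ∀ i, (A i).Regular) (i : Fin N) (θ : Fin N → ℝ) :
    MonotoneOn (fun s => starQ A i (repl θ i s)) (A i).types := by
  intro s hs t ht hst
  have hv := (hreg i).virtualValue_mono.monotoneOn hs ht hst
  by_cases h : starQ A i (repl θ i s) = 0
  · simp only [h]
    exact (starQ_mem _ _).1
  · obtain ⟨h1, h2⟩ := (ite_ne_right_iff.1 h).1
    simp only [repl_self] at h1 h2
    have e : starQ A i (repl θ i t) = 1 := by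
      refine if_pos ⟨?_, fun j hj => ?_⟩
      · rw [repl_self]
        exact h1.trans_le hv
      · have := h2 j hj
        rw [repl_of_ne hj] at this ⊢
        rw [repl_self]
        exact this.trans_le hv
    simp only [e]
    exact (starQ_mem _ _).2

theorem starQ_repl_tLo {i : Fin N} (hf : (A i).f (A i).tLo = 0) (θ : Fin N → ℝ) :
    starQ A i (repl θ i (A i).tLo) = 0 := by
  refine if_neg fun h => ?_
  have e : (A i).virtualValue (A i).tLo = ⊥ := if_pos ⟨rfl, hf⟩
  have := h.1
  rw [repl_self, e] at this
  exact not_lt_bot this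

/-- The allocation rule, extended to profiles outside the type space. -/
def starAlloc (A : Fin N → Agent) (i : Fin N) (θ : Fin N → ℝ) : ℝ :=
  starQ A i fun j => (A j).clamp (θ j)

theorem starAlloc_mem (i : Fin N) (θ : Fin N → ℝ) : starAlloc A i θ ∈ Icc (0 : ℝ) 1 :=
  starQ_mem i _

theorem abs_starAlloc_le (i : Fin N) (θ : Fin N → ℝ) : |starAlloc A i θ| ≤ 1 := by
  rw [abs_of_nonneg (starAlloc_mem i θ).1]
  exact (starAlloc_mem i θ).2

theorem starAlloc_of_mem {θ : Fin N → ℝ} (hθ : θ ∈ profiles A) (i : Fin N) :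
    starAlloc A i θ = starQ A i θ := by
  rw [starAlloc]
  congr 1
  ext j
  exact Agent.clamp_of_mem (hθ j)

section

variable (hA : ∀ i, (A i).Valid) (hreg : ∀ i, (A i).Regular)
include hA hreg

theorem measurable_starAlloc (i : Fin N) : Measurable (starAlloc A i) := by
  classical
  have hv : ∀ j, Measurable fun θ : Fin N → ℝ => (A j).virtualValue ((A j).clamp (θ j)) := fun j =>
    ((hA j).measurable_virtualValue_clamp (hreg j)).comp (measurable_pi_apply j)
  refine Measurable.ite ?_ measurable_const measurable_const
  have e : {θ : Fin N → ℝ | 0 < (A i).virtualValue ((A i).clamp (θ i)) ∧ ∀ j, j ≠ i →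
      max ((A j).virtualValue ((A j).clamp (θ j))) 0 < (A i).virtualValue ((A i).clamp (θ i))}
      = {θ | 0 < (A i).virtualValue ((A i).clamp (θ i))} ∩ ⋂ j, ⋂ (_ : j ≠ i),
        {θ | max ((A j).virtualValue ((A j).clamp (θ j))) 0
          < (A i).virtualValue ((A i).clamp (θ i))} := by
    ext θ
    simp
  exact e ▸ (measurableSet_lt measurable_const (hv i)).inter
    (MeasurableSet.iInter fun j => MeasurableSet.iInter fun _ =>
      measurableSet_lt ((hv j).max measurable_const) (hv i))

/-! ### Rents in the optimal mechanism -/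

omit hA hreg in
/-- The slope of the interim rent of agent `i`. -/
def rentSlope (A : Fin N → Agent) (i : Fin N) (z : ℝ) : ℝ :=
  (∫ θ, starAlloc A i (repl θ i z) ∂(profileLaw A)) * (A i).rentRate z

theorem measurable_starAlloc_repl (i : Fin N) :
    Measurable fun p : (Fin N → ℝ) × ℝ => starAlloc A i (repl p.1 i p.2) :=
  (measurable_starAlloc hA hreg i).comp (measurable_repl i)

theorem measurable_rentSlope (i : Fin N) : Measurable (rentSlope A i) := by
  have := isProbabilityMeasure_profileLaw hA
  exact ((measurable_starAlloc_repl hA hreg i).stronglyMeasurable.integral_prod_left').measurable.mul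
    ((hA i).measurable_rentRate (hreg i))

omit hreg in
theorem integral_starAlloc_repl {i : Fin N} {s : ℝ} (hs : s ∈ (A i).types) :
    ∫ θ, starAlloc A i (repl θ i s) ∂(profileLaw A) = interimAlloc A (star A) i s :=
  integral_congr_ae ((ae_mem_profiles hA).mono fun _ hθ =>
    starAlloc_of_mem (repl_mem_profiles hθ hs) i)

omit hreg in
theorem rentSlope_mem (i : Fin N) (z : ℝ) : rentSlope A i z ∈ Icc (0 : ℝ) 1 := by
  have := isProbabilityMeasure_profileLaw hA
  have h0 : 0 ≤ ∫ θ, starAlloc A i (repl θ i z) ∂(profileLaw A) :=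
    integral_nonneg fun θ => (starAlloc_mem i _).1
  have h1 : ∫ θ, starAlloc A i (repl θ i z) ∂(profileLaw A) ≤ 1 := by
    refine (integral_mono_of_nonneg (ae_of_all _ fun θ => (starAlloc_mem i _).1)
      (integrable_const 1) (ae_of_all _ fun θ => (starAlloc_mem i _).2)).trans ?_
    simp
  have h2 := (hA i).rentRate_mem z
  exact ⟨mul_nonneg h0 h2.1, mul_le_one₀ h1 h2.1 h2.2⟩

/-- The transfer integrates the raw derivative G₂, whose joint measurability is unclear. Replacing
it by its measurable version and clamping profiles changes nothing at type profiles, because the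
integral ignores end types. -/
theorem exists_measurable_starT (i : Fin N) : ∃ τ : (Fin N → ℝ) → ℝ, Measurable τ ∧
    (∀ θ ∈ profiles A, starT A i θ = τ θ) ∧
    (∀ θ ∈ profiles A, τ θ = starAlloc A i θ * (A i).netIncome (θ i) (θ i)
      - ∫ z in Ioc (A i).tLo (θ i), starAlloc A i (repl θ i z) * (A i).rentRate z) := by
  obtain ⟨n, hn, hne⟩ := (hA i).measurable_netIncome_self (hreg i)
  have hm : Measurable fun p : (Fin N → ℝ) × ℝ =>
      {p : (Fin N → ℝ) × ℝ | (A i).tLo < p.2 ∧ p.2 ≤ p.1 i}.indicator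
        (fun p => starAlloc A i (repl p.1 i p.2) * (A i).rentRate p.2) p := by
    refine Measurable.indicator ?_ ?_
    · exact (measurable_starAlloc_repl hA hreg i).mul
        (((hA i).measurable_rentRate (hreg i)).comp measurable_snd)
    · exact (measurableSet_lt measurable_const measurable_snd).inter
        (measurableSet_le measurable_snd ((measurable_pi_apply i).comp measurable_fst))
  have hI : ∀ θ : Fin N → ℝ, ∫ z, {p : (Fin N → ℝ) × ℝ | (A i).tLo < p.2 ∧ p.2 ≤ p.1 i}.indicator
        (fun p => starAlloc A i (repl p.1 i p.2) * (A i).rentRate p.2) (θ, z)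
      = ∫ z in Ioc (A i).tLo (θ i), starAlloc A i (repl θ i z) * (A i).rentRate z := by
    intro θ
    rw [← integral_indicator measurableSet_Ioc]
    rfl
  have h2 := hm.stronglyMeasurable.integral_prod_right' (ν := volume)
  refine ⟨_, ((measurable_starAlloc hA hreg i).mul (hn.comp (measurable_pi_apply i))).sub
    h2.measurable, fun θ hθ => ?_, fun θ hθ => ?_⟩
  · simp only [Pi.sub_apply, Pi.mul_apply, Function.comp_apply, hI, hne _ (hθ i),
      starAlloc_of_mem hθ]
    rw [starT, intervalIntegral.integral_of_le (hθ i).1]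
    congr 1
    · congr 1
      exact (hA i).integral_sub_cappedIncome (hθ i)
    · rw [integral_Ioc_eq_integral_Ioo, integral_Ioc_eq_integral_Ioo]
      refine setIntegral_congr_fun measurableSet_Ioo fun z hz => ?_
      have hz' : z ∈ Ioo (A i).tLo (A i).tHi := ⟨hz.1, hz.2.trans_le (hθ i).2⟩
      simp only [(hA i).rentRate_eq hz',
        starAlloc_of_mem (repl_mem_profiles hθ (Ioo_subset_Icc_self hz'))]
  · simp only [Pi.sub_apply, Pi.mul_apply, Function.comp_apply, hI, hne _ (hθ i)]

theorem exists_bound_starT (i : Fin N) : ∃ C, ∀ θ ∈ profiles A, |starT A i θ| ≤ C := by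
  obtain ⟨τ, -, h1, h2⟩ := exists_measurable_starT hA hreg i
  refine ⟨(A i).tHi + ((A i).tHi - (A i).tLo), fun θ hθ => ?_⟩
  rw [h1 θ hθ, h2 θ hθ]
  refine (abs_sub _ _).trans (add_le_add ?_ ?_)
  · have h := (hA i).netIncome_self_mem (hθ i)
    rw [abs_mul, abs_of_nonneg h.1]
    exact (mul_le_of_le_one_left h.1 (abs_starAlloc_le i θ)).trans (h.2.trans (hθ i).2)
  · have hb : ∀ z, ‖starAlloc A i (repl θ i z) * (A i).rentRate z‖ ≤ 1 := fun z => by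
      have h3 := (hA i).rentRate_mem z
      rw [norm_mul, Real.norm_eq_abs, Real.norm_of_nonneg h3.1]
      exact mul_le_one₀ (abs_starAlloc_le i _) h3.1 h3.2
    have := norm_setIntegral_le_of_norm_le_const (μ := volume) (s := Ioc (A i).tLo (θ i)) (C := 1)
      (by simp) fun z _ => hb z
    rw [Real.norm_eq_abs, one_mul, Real.volume_real_Ioc_of_le (hθ i).1] at this
    linarith [(hθ i).2]

theorem integrable_starT_repl (i : Fin N) {s : ℝ} (hs : s ∈ (A i).types) :
    Integrable (fun θ => starT A i (repl θ i s)) (profileLaw A) := by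
  have := isProbabilityMeasure_profileLaw hA
  obtain ⟨τ, hτ, h1, -⟩ := exists_measurable_starT hA hreg i
  obtain ⟨C, hC⟩ := exists_bound_starT hA hreg i
  refine Integrable.of_bound (C := C) ((hτ.comp (measurable_repl_left i s)).aestronglyMeasurable.congr
    ?_) ?_
  · filter_upwards [ae_mem_profiles hA] with θ hθ
    exact (h1 _ (repl_mem_profiles hθ hs)).symm
  · filter_upwards [ae_mem_profiles hA] with θ hθ
    exact hC _ (repl_mem_profiles hθ hs)

theorem integrable_starT (i : Fin N) : Integrable (starT A i) (profileLaw A) := by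
  have := isProbabilityMeasure_profileLaw hA
  obtain ⟨τ, hτ, h1, -⟩ := exists_measurable_starT hA hreg i
  obtain ⟨C, hC⟩ := exists_bound_starT hA hreg i
  refine Integrable.of_bound (C := C) (hτ.aestronglyMeasurable.congr ?_) ?_
  · filter_upwards [ae_mem_profiles hA] with θ hθ
    exact (h1 _ hθ).symm
  · filter_upwards [ae_mem_profiles hA] with θ hθ
    exact hC _ hθ

/-- Averaging over the other types commutes with the integral over lower own types, so the transfer
leaves exactly a rent of slope `rentSlope`. -/
theorem interimTransfer_star (i : Fin N) {s : ℝ} (hs : s ∈ (A i).types) :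
    interimTransfer A (star A) i s = interimAlloc A (star A) i s * (A i).netIncome s s
      - ∫ z in (A i).tLo..s, rentSlope A i z := by
  have := isProbabilityMeasure_profileLaw hA
  obtain ⟨τ, -, h1, h2⟩ := exists_measurable_starT hA hreg i
  have hm : Measurable fun p : (Fin N → ℝ) × ℝ => starAlloc A i (repl p.1 i p.2) * (A i).rentRate p.2 :=
    (measurable_starAlloc_repl hA hreg i).mul
      (((hA i).measurable_rentRate (hreg i)).comp measurable_snd)
  have hi : Integrable (Function.uncurry fun (θ : Fin N → ℝ) (z : ℝ) =>
      starAlloc A i (repl θ i z) * (A i).rentRate z)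
      ((profileLaw A).prod (volume.restrict (Ioc (A i).tLo s))) := by
    refine Integrable.of_bound (C := 1) hm.aestronglyMeasurable (ae_of_all _ fun p => ?_)
    have h3 := (hA i).rentRate_mem p.2
    simp only [Function.uncurry]
    rw [norm_mul, Real.norm_eq_abs, Real.norm_of_nonneg h3.1]
    exact mul_le_one₀ (abs_starAlloc_le i _) h3.1 h3.2
  have hi2 : Integrable (fun θ => ∫ z in Ioc (A i).tLo s, starAlloc A i (repl θ i z) * (A i).rentRate z)
      (profileLaw A) := hi.integral_prod_left
  have hi1 : Integrable (fun θ => starAlloc A i (repl θ i s) * (A i).netIncome s s) (profileLaw A) :=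
    (Integrable.of_bound (C := 1) ((measurable_starAlloc hA hreg i).comp
      (measurable_repl_left i s)).aestronglyMeasurable
      (ae_of_all _ fun θ => abs_starAlloc_le i _)).mul_const _
  have e : (fun θ => starT A i (repl θ i s)) =ᵐ[profileLaw A] fun θ =>
      starAlloc A i (repl θ i s) * (A i).netIncome s s
        - ∫ z in Ioc (A i).tLo s, starAlloc A i (repl θ i z) * (A i).rentRate z := by
    filter_upwards [ae_mem_profiles hA] with θ hθ
    have hr := repl_mem_profiles hθ hs
    rw [h1 _ hr, h2 _ hr]
    simp only [repl_self, repl_repl]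
  rw [interimTransfer]
  change ∫ θ, starT A i (repl θ i s) ∂(profileLaw A) = _
  rw [integral_congr_ae e, integral_sub hi1 hi2, integral_mul_const, integral_starAlloc_repl hA hs,
    integral_integral_swap hi, intervalIntegral.integral_of_le hs.1]
  simp only [integral_mul_const, rentSlope]

/-! ### Feasibility of the optimal mechanism -/

theorem star_wellDefined : WellDefined A Y (star A) where
  q_nonneg θ _ i := (starQ_mem i θ).1
  q_sum θ _ := sum_starQ_le θ
  a_mem i h _ := Agent.auditRule_mem (A := A i) _ _
  q_meas i := by
    have e : (fun θ : profiles A => (star A).q i θ) = fun θ : profiles A => starAlloc A i θ :=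
      funext fun θ => (starAlloc_of_mem θ.2 i).symm
    rw [e]
    exact (measurable_starAlloc hA hreg i).comp measurable_subtype_coe
  t_meas i := by
    obtain ⟨τ, hτ, h1, -⟩ := exists_measurable_starT hA hreg i
    have e : (fun θ : profiles A => (star A).t i θ) = fun θ : profiles A => τ θ :=
      funext fun θ => h1 θ θ.2
    rw [e]
    exact hτ.comp measurable_subtype_coe
  r_meas i := by
    have hm : Measurable fun h : (Fin N → ℝ) × ℝ =>
        (min (h.2 : EReal) ((A i).threshold ((A i).clamp (h.1 i)))).toReal * (A i).φ :=
      ((measurable_coe_real_ereal.comp measurable_snd).min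
        (((hA i).measurable_threshold_clamp (hreg i)).comp
          ((measurable_pi_apply i).comp measurable_fst))).ereal_toReal.mul_const _
    have e : (fun h : histories A i => (star A).r i h.1.1 h.1.2) = fun h : histories A i =>
        (min (h.1.2 : EReal) ((A i).threshold ((A i).clamp (h.1.1 i)))).toReal * (A i).φ := by
      funext h
      rw [Agent.clamp_of_mem (h.2.1 i)]
      rfl
    rw [e]
    exact hm.comp measurable_subtype_coe
  a_meas i := by
    classical
    have hx : Measurable fun h : (Fin N → ℝ) × ℝ => (h.2 : EReal) :=
      measurable_coe_real_ereal.comp measurable_snd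
    have hτ : Measurable fun h : (Fin N → ℝ) × ℝ => (A i).threshold ((A i).clamp (h.1 i)) :=
      ((hA i).measurable_threshold_clamp (hreg i)).comp ((measurable_pi_apply i).comp measurable_fst)
    have hHi : Measurable fun h : (Fin N → ℝ) × ℝ => (A i).iHi ((A i).clamp (h.1 i)) :=
      (show Monotone fun θ => (A i).iHi ((A i).clamp θ) from fun s t h =>
        (hA i).monotoneOn_iHi ((hA i).clamp_mem s) ((hA i).clamp_mem t)
          (Agent.monotone_clamp h)).measurable.comp ((measurable_pi_apply i).comp measurable_fst)
    have hm : Measurable fun h : (Fin N → ℝ) × ℝ =>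
        if (h.2 : EReal) < (A i).threshold ((A i).clamp (h.1 i)) ∨
          ((h.2 : EReal) = (A i).threshold ((A i).clamp (h.1 i)) ∧
            (A i).threshold ((A i).clamp (h.1 i)) = (A i).iHi ((A i).clamp (h.1 i)))
        then (1 : ℝ) else 0 :=
      Measurable.ite ((measurableSet_lt hx hτ).union ((measurableSet_eq_fun hx hτ).inter
        (measurableSet_eq_fun hτ hHi))) measurable_const measurable_const
    have e : (fun h : histories A i => (star A).a i h.1.1 h.1.2) = fun h : histories A i =>
        if (h.1.2 : EReal) < (A i).threshold ((A i).clamp (h.1.1 i)) ∨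
          ((h.1.2 : EReal) = (A i).threshold ((A i).clamp (h.1.1 i)) ∧
            (A i).threshold ((A i).clamp (h.1.1 i)) = (A i).iHi ((A i).clamp (h.1.1 i)))
        then (1 : ℝ) else 0 := by
      funext h
      rw [Agent.clamp_of_mem (h.2.1 i)]
      simp only [star, starA]
    rw [e]
    exact hm.comp measurable_subtype_coe
  p_meas i := by
    have hm : Measurable fun h : ((Fin N → ℝ) × ℝ) × ℝ => (h.2 - h.1.2) * (A i).φ :=
      (measurable_snd.sub (measurable_snd.comp measurable_fst)).mul_const _
    exact hm.comp measurable_subtype_coe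
  t_integrable := integrable_starT hA hreg
  t_interim i _ hs := integrable_starT_repl hA hreg i hs

omit hA hreg in
theorem star_pay (i : Fin N) (θ : Fin N → ℝ) (x' x : ℝ) :
    (star A).r i θ x' + (star A).a i θ x' * (star A).p i θ x' x
      = (A i).contingentPay (θ i) x' x := rfl

omit hreg in
theorem star_finitePayments : FinitePayments A (star A) where
  interim i s hs x' hx' x hx := by
    have := isProbabilityMeasure_profileLaw hA
    refine lt_of_le_of_lt (lintegral_mono (g := fun _ => ‖(A i).contingentPay s x' x‖ₑ) fun θ => ?_)
      (by simp)
    rw [star_pay, repl_self, enorm_mul]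
    refine mul_le_of_le_one_left' ?_
    rw [← enorm_one (G := ℝ), enorm_le_iff_norm_le]
    have := starQ_mem (A := A) i (repl θ i s)
    simp only [star]
    rw [Real.norm_of_nonneg this.1]
    simpa using this.2
  exAnte i := by
    have := isProbabilityMeasure_profileLaw hA
    refine lt_of_le_of_lt (lintegral_mono_ae (g := fun _ => ENNReal.ofReal (A i).tHi) ?_) (by simp)
    filter_upwards [ae_mem_profiles hA] with θ hθ
    have h1 : ∫⁻ x, ‖x‖ₑ ∂((A i).incomeLaw (θ i)) = ENNReal.ofReal (θ i) := by
      rw [← ofReal_integral_norm_eq_lintegral_enorm ((hA i).income_integrable _ (hθ i))]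
      congr 1
      exact (integral_congr_ae (((hA i).ae_nonneg_income (hθ i)).mono fun x hx =>
        Real.norm_of_nonneg hx)).trans ((hA i).income_mean _ (hθ i))
    refine (lintegral_mono_ae ?_).trans (h1.le.trans (ENNReal.ofReal_le_ofReal (hθ i).2))
    filter_upwards [Agent.ae_mem_incomes (θ i)] with x hx
    have hq := starQ_mem (A := A) i θ
    have hc := (hA i).cappedIncome_mem (hθ i) hx
    rw [star_pay, Agent.contingentPay_self, enorm_le_iff_norm_le, norm_mul, norm_mul]
    simp only [star]
    rw [Real.norm_of_nonneg hq.1, Real.norm_of_nonneg hc.1, Real.norm_of_nonneg (hA i).φ_mem.1,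
      Real.norm_of_nonneg (hc.1.trans hc.2)]
    have h2 := mul_nonneg hc.1 (hA i).φ_mem.1
    exact (mul_le_of_le_one_left h2 hq.2).trans
      ((mul_le_of_le_one_right hc.1 (hA i).φ_mem.2).trans hc.2)

omit hreg in
theorem star_doubleMonotone : DoubleMonotone A Y (star A) := by
  intro i h _ y _ y' _ hy
  have e : (star A).p i h.1 h.2 y' - (star A).p i h.1 h.2 y = (y' - y) * (A i).φ := by
    simp only [star]
    ring
  rw [e]
  exact ⟨mul_nonneg (sub_nonneg.2 hy.le) (hA i).φ_mem.1, le_rfl⟩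

omit hA hreg in
-- Contingent payments depend on the profile only through the own type, so the winning probability
-- factors out.
theorem utility_star (i : Fin N) (s x' x : ℝ) :
    utility A (star A) i s x' x
      = interimAlloc A (star A) i s * (x - (A i).contingentPay s x' x) := by
  rw [utility, interimAlloc, ← integral_mul_const]
  refine integral_congr_ae (ae_of_all _ fun θ => ?_)
  have := star_pay (A := A) i (repl θ i s) x' x
  rw [repl_self] at this
  simp only
  rw [sub_sub, this]

omit hreg in
theorem expUtility_star (i : Fin N) {s' s : ℝ} (hs' : s' ∈ (A i).types) (hs : s ∈ (A i).types) :
    expUtility A (utility A (star A)) i s' s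
      = interimAlloc A (star A) i s' * (A i).netIncome s' s := by
  simp only [expUtility, utility_star]
  rw [integral_const_mul, (hA i).integral_sub_contingentPay hs' hs]
  rfl

theorem netUtility_star (i : Fin N) {s : ℝ} (hs : s ∈ (A i).types) :
    netUtility A (star A) i s = ∫ z in (A i).tLo..s, rentSlope A i z := by
  rw [netUtility, expUtility_star hA i hs hs, interimTransfer_star hA hreg i hs]
  ring

theorem interimAlloc_star_monotoneOn (i : Fin N) :
    MonotoneOn (interimAlloc A (star A) i) (A i).types := fun _ hs _ ht hst =>
  integral_mono ((star_wellDefined (Y := fun _ => univ) hA hreg).integrable_q_repl hA i hs)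
    ((star_wellDefined (Y := fun _ => univ) hA hreg).integrable_q_repl hA i ht)
    fun θ => starQ_repl_mono hreg i θ hs ht hst

theorem star_incentives : Incentives A (utility A (star A)) (star A) where
  ic_income i s hs x hx x' _ := by
    rw [utility_star, utility_star]
    exact mul_le_mul_of_nonneg_left (sub_le_sub_left ((hA i).contingentPay_self_le hs hx) x)
      ((star_wellDefined (Y := fun _ => univ) hA hreg).interimAlloc_nonneg hA i hs)
  ic_type i s hs s' hs' := by
    have hw := star_wellDefined (Y := fun _ => univ) hA hreg
    have hm := measurable_rentSlope hA hreg i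
    have hb : ∀ z, |rentSlope A i z| ≤ 1 := fun z => by
      rw [abs_of_nonneg (rentSlope_mem hA i z).1]
      exact (rentSlope_mem hA i z).2
    -- Reporting `s'` yields the rent of `s'` plus the change in net income weighted by Q(s'), which
    -- is at most the rent accumulated between the two types.
    have h1 := (hA i).mul_netIncome_sub_le (hreg i) (interimAlloc_star_monotoneOn hA hreg i)
      (fun z hz => hw.interimAlloc_nonneg hA i hz) (fun hf => by
        simp only [interimAlloc, star, starQ_repl_tLo hf, integral_zero]) hm hb
      (fun z hz => by rw [rentSlope, integral_starAlloc_repl hA (Ioo_subset_Icc_self hz)]) hs' hs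
    have hi : ∀ a b : ℝ, IntervalIntegrable (rentSlope A i) volume a b := fun a b => by
      rw [intervalIntegrable_iff]
      exact Measure.integrableOn_of_bounded (M := 1) (by simp) hm.aestronglyMeasurable
        (ae_of_all _ hb)
    have h2 := intervalIntegral.integral_add_adjacent_intervals (hi (A i).tLo s') (hi s' s)
    have h3 := netUtility_star hA hreg i hs
    rw [netUtility] at h3
    rw [h3, expUtility_star hA i hs' hs, interimTransfer_star hA hreg i hs', ← h2]
    linarith
  ir i s hs := by
    have h3 := netUtility_star hA hreg i hs
    rw [netUtility] at h3
    rw [h3]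
    exact intervalIntegral.integral_nonneg hs.1 fun z _ => (rentSlope_mem hA i z).1

theorem star_feasible : Feasible A (star A) where
  wellDefined := star_wellDefined hA hreg
  finite := star_finitePayments hA
  doubleMonotone := star_doubleMonotone hA
  incentives := star_incentives hA hreg

end

section

variable (hA : ∀ i, (A i).Valid) (hreg : ∀ i, (A i).Regular)
include hA hreg

/-! ### Optimality of the optimal mechanism under perfect auditing -/

omit hreg in
theorem interimAudit_star (i : Fin N) {s x : ℝ} (hs : s ∈ (A i).types) (hx : x ∈ (A i).incomes s) :
    interimAudit A (star A) i s x = interimAlloc A (star A) i s * (A i).auditRule s x := by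
  rw [interimAudit, interimAlloc, ← integral_mul_const]
  refine integral_congr_ae ((ae_mem_profiles hA).mono fun θ hθ => ?_)
  have h : (repl θ i s, x) ∈ histories A i := by
    refine ⟨repl_mem_profiles hθ hs, ?_⟩
    simp only [repl_self]
    exact hx
  simp only [auditFun, indicator_of_mem h]
  congr 1
  change (A i).auditRule (repl θ i s i) x = _
  rw [repl_self]

/-- Every inequality behind the upper bound binds: the lowest type has no rent, rents have the
minimal slope, and audits occur, given a win, exactly where they pay. -/
theorem agentPayoff_star (i : Fin N) :
    ∫ θ, ((star A).t i θ + (star A).q i θ * ∫ x, ((star A).r i θ x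
      + (star A).a i θ x * ((star A).p i θ x x - (A i).c)) ∂((A i).incomeLaw (θ i))) ∂(profileLaw A)
    = ∫ s, interimAlloc A (star A) i s * (A i).finiteVirtualValue s ∂(A i).typeLaw := by
  have hF := star_feasible hA hreg
  obtain ⟨hv, hQ, hB, e⟩ := agentPayoff_eq hA hF.wellDefined hF.finite i
  have hm := measurable_rentSlope hA hreg i
  have hb : ∀ z, |rentSlope A i z| ≤ 1 := fun z => by
    rw [abs_of_nonneg (rentSlope_mem hA i z).1]
    exact (rentSlope_mem hA i z).2
  have hinv := (hA i).integrable_invHazard_mul hm hb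
  have hv2 : ∫ s, netUtility A (star A) i s ∂(A i).typeLaw
      = ∫ s, (A i).invHazard s * rentSlope A i s ∂(A i).typeLaw := by
    rw [← ((hA i).integral_typeLaw_primitive hm hb).2]
    exact integral_congr_ae (Agent.ae_mem_types.mono fun s hs => netUtility_star hA hreg i hs)
  have h1 : Integrable (fun s => interimAlloc A (star A) i s * s - netUtility A (star A) i s)
      (A i).typeLaw := hQ.sub hv
  have h2 : Integrable (fun s => interimAlloc A (star A) i s * s
      - (A i).invHazard s * rentSlope A i s) (A i).typeLaw := hQ.sub hinv
  rw [e, integral_sub h1 (hB.const_mul _), integral_sub hQ hv, hv2, ← integral_sub hQ hinv,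
    ← integral_sub h2 (hB.const_mul _)]
  refine integral_congr_ae ?_
  filter_upwards [Agent.ae_mem_Ioo] with s hs
  have hsT := Ioo_subset_Icc_self hs
  have e2 : ∫ x, interimAudit A (star A) i s x ∂((A i).incomeLaw s)
      = interimAlloc A (star A) i s * ∫ x, (A i).auditRule s x ∂((A i).incomeLaw s) := by
    rw [← integral_const_mul]
    exact integral_congr_ae ((Agent.ae_mem_incomes s).mono fun x hx =>
      interimAudit_star hA i hsT hx)
  rw [e2, (hA i).finiteVirtualValue_eq (hreg i) hs, rentSlope, integral_starAlloc_repl hA hsT]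
  ring

theorem integrable_mul_finiteVirtualValue (hw : WellDefined A Y m) (i : Fin N) :
    Integrable (fun θ => m.q i θ * (A i).finiteVirtualValue (θ i)) (profileLaw A) := by
  refine ((measurePreserving_eval hA i).integrable_comp_of_integrable
    ((hA i).integrable_finiteVirtualValue (hreg i))).bdd_mul (c := 1)
    (hw.integrable_q hA i).aestronglyMeasurable ?_
  filter_upwards [ae_mem_profiles hA] with θ hθ
  rw [Real.norm_of_nonneg (hw.q_nonneg θ hθ i)]
  exact hw.q_le_one hθ i

theorem integral_interimAlloc_mul (hw : WellDefined A Y m) (i : Fin N) :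
    ∫ s, interimAlloc A m i s * (A i).finiteVirtualValue s ∂(A i).typeLaw
      = ∫ θ, m.q i θ * (A i).finiteVirtualValue (θ i) ∂(profileLaw A) := by
  rw [← (integral_repl hA i (integrable_mul_finiteVirtualValue hA hreg hw i)).2]
  refine integral_congr_ae (ae_of_all _ fun s => ?_)
  simp only [repl_self, interimAlloc, integral_mul_const]

/-- Given the other types, a strictly increasing virtual value meets a given level at most once, and
the type law has no atoms. Leaving the asset unassigned at ties is therefore costless. -/
theorem ae_virtualValue_ne {i j : Fin N} (hij : j ≠ i) :
    ∀ᵐ θ ∂(profileLaw A), (A i).virtualValue (θ i) ≠ (A j).virtualValue (θ j) := by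
  have := fun i => (hA i).typeLaw_prob
  have := isProbabilityMeasure_profileLaw hA
  have hv : ∀ j, Measurable fun θ : Fin N → ℝ => (A j).virtualValue ((A j).clamp (θ j)) := fun j =>
    ((hA j).measurable_virtualValue_clamp (hreg j)).comp (measurable_pi_apply j)
  set T : Set (Fin N → ℝ) := {θ | (A i).virtualValue ((A i).clamp (θ i))
    = (A j).virtualValue ((A j).clamp (θ j))} with hT
  have hTm : MeasurableSet T := measurableSet_eq_fun (hv i) (hv j)
  have h0 : profileLaw A T = 0 := by
    have hmp := measurePreserving_repl hA i
    rw [← hmp.measure_preimage hTm.nullMeasurableSet, Measure.measure_prod_null (hmp.measurable hTm)]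
    refine ae_of_all _ fun θ => ?_
    refine measure_mono_null (t := {s | s ∉ (A i).types} ∪ {s | s ∈ (A i).types ∧
      (A i).virtualValue s = (A j).virtualValue ((A j).clamp (θ j))}) (fun s hs => ?_)
      (measure_union_null (ae_iff.1 Agent.ae_mem_types) ?_)
    · by_cases hsT : s ∈ (A i).types
      · refine Or.inr ⟨hsT, ?_⟩
        have h := (show (A i).virtualValue ((A i).clamp (repl θ i s i))
          = (A j).virtualValue ((A j).clamp (repl θ i s j)) from hs)
        rwa [repl_self, repl_of_ne hij, Agent.clamp_of_mem hsT] at h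
      · exact Or.inl hsT
    · have : NullSingletonClass (A i).typeLaw := ⟨Agent.typeLaw_singleton⟩
      refine Set.Subsingleton.measure_zero ?_ _
      intro s hs t ht
      exact (hreg i).virtualValue_mono.injOn hs.1 ht.1 (hs.2.trans ht.2.symm)
  filter_upwards [ae_mem_profiles hA, measure_eq_zero_iff_ae_notMem.1 h0] with θ hθ hn h
  refine hn ?_
  change (A i).virtualValue ((A i).clamp (θ i)) = (A j).virtualValue ((A j).clamp (θ j))
  rwa [Agent.clamp_of_mem (hθ i), Agent.clamp_of_mem (hθ j)]

omit hA hreg in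
/-- The optimal allocation maximizes the virtual surplus. -/
theorem sum_mul_le_sum_starQ_mul {θ q v : Fin N → ℝ} (hq : ∀ i, 0 ≤ q i) (hq1 : ∑ i, q i ≤ 1)
    (hv : ∀ i, (A i).virtualValue (θ i) = (v i : EReal)) (hne : ∀ i j, j ≠ i → v i ≠ v j) :
    ∑ i, q i * v i ≤ ∑ i, starQ A i θ * v i := by
  by_cases h : ∃ i, starQ A i θ ≠ 0
  · obtain ⟨i, hi⟩ := h
    obtain ⟨h1, h2⟩ := (ite_ne_right_iff.1 hi).1
    simp only [hv] at h1 h2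
    have hi0 : 0 < v i := EReal.coe_lt_coe_iff.1 h1
    have hle : ∀ j, v j ≤ v i := fun j => by
      rcases eq_or_ne j i with rfl | hj
      · exact le_rfl
      · exact EReal.coe_le_coe_iff.1 ((le_max_left _ _).trans (h2 j hj).le)
    rw [sum_starQ_mul hi]
    calc ∑ j, q j * v j ≤ ∑ j, q j * v i :=
          Finset.sum_le_sum fun j _ => mul_le_mul_of_nonneg_left (hle j) (hq j)
      _ = (∑ j, q j) * v i := (Finset.sum_mul ..).symm
      _ ≤ v i := mul_le_of_le_one_left hi0.le hq1
  · push Not at h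
    simp only [h, zero_mul, Finset.sum_const_zero]
    rcases isEmpty_or_nonempty (Fin N) with hN | hN
    · simp
    obtain ⟨i, hi⟩ := Finite.exists_max v
    refine Finset.sum_nonpos fun j _ => mul_nonpos_of_nonneg_of_nonpos (hq j) ((hi j).trans ?_)
    by_contra hpos
    push Not at hpos
    have h1 : starQ A i θ = 1 := by
      refine if_pos ⟨?_, fun j hj => ?_⟩
      · rw [hv]
        exact EReal.coe_lt_coe_iff.2 hpos
      · rw [hv, hv]
        exact max_lt (EReal.coe_lt_coe_iff.2 (lt_of_le_of_ne (hi j) (hne i j hj).symm))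
          (EReal.coe_lt_coe_iff.2 hpos)
    rw [h i] at h1
    exact zero_ne_one h1

/-- The interim bounds of the agents are rewritten ex ante and added, because the constraint on the
allocation holds profile by profile. -/
theorem payoff_le_star (hm : Feasible A m) : payoff A m ≤ payoff A (star A) := by
  have hws := star_wellDefined (Y := fun i => (A i).allIncomes) hA hreg
  have hw := hm.wellDefined
  calc payoff A m ≤ ∑ i, ∫ s, interimAlloc A m i s * (A i).finiteVirtualValue s ∂(A i).typeLaw :=
        Finset.sum_le_sum fun i _ => agentPayoff_le hA hm hreg i
    _ = ∫ θ, ∑ i, m.q i θ * (A i).finiteVirtualValue (θ i) ∂(profileLaw A) := by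
        rw [integral_finsetSum _ fun i _ => integrable_mul_finiteVirtualValue hA hreg hw i]
        exact Finset.sum_congr rfl fun i _ => integral_interimAlloc_mul hA hreg hw i
    _ ≤ ∫ θ, ∑ i, (star A).q i θ * (A i).finiteVirtualValue (θ i) ∂(profileLaw A) := by
        refine integral_mono_ae
          (integrable_finsetSum _ fun i _ => integrable_mul_finiteVirtualValue hA hreg hw i)
          (integrable_finsetSum _ fun i _ => integrable_mul_finiteVirtualValue hA hreg hws i) ?_
        have hI : ∀ᵐ θ ∂(profileLaw A), ∀ i, (A i).virtualValue (θ i)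
            = ((A i).finiteVirtualValue (θ i) : EReal) := ae_all_iff.2 fun i =>
          (measurePreserving_eval hA i).quasiMeasurePreserving.ae
            (Agent.ae_mem_Ioo.mono fun s hs => Agent.virtualValue_eq hs.1)
        have hne : ∀ᵐ θ ∂(profileLaw A), ∀ i j, j ≠ i →
            (A i).virtualValue (θ i) ≠ (A j).virtualValue (θ j) :=
          ae_all_iff.2 fun i => ae_all_iff.2 fun j => by
            by_cases hj : j = i
            · exact ae_of_all _ fun θ h => absurd hj h
            · exact (ae_virtualValue_ne hA hreg hj).mono fun θ h _ => h
        filter_upwards [hI, hne, ae_mem_profiles hA] with θ h1 h2 hθ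
        refine sum_mul_le_sum_starQ_mul (fun i => hw.q_nonneg θ hθ i) (hw.q_sum θ hθ) h1
          fun i j hj h => h2 i j hj ?_
        rw [h1 i, h1 j, h]
    _ = payoff A (star A) := by
        rw [integral_finsetSum _ fun i _ => integrable_mul_finiteVirtualValue hA hreg hws i]
        refine Finset.sum_congr rfl fun i _ => ?_
        rw [agentPayoff_star hA hreg i, integral_interimAlloc_mul hA hreg hws i]

theorem star_optimal : Optimal A (star A) :=
  ⟨star_feasible hA hreg, fun _ h => payoff_le_star hA hreg h⟩

end

/-! ### Noisy auditing -/

/-- The slope bounds make the function monotone on `S`, hence measurable, and of at most linear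
growth. -/
theorem integrable_of_slope_le {ν : Measure ℝ} [IsProbabilityMeasure ν] {S : Set ℝ}
    (hS : MeasurableSet S) (hν : ∀ᵐ z ∂ν, z ∈ S) (hi : Integrable (fun z => z) ν) {p : ℝ → ℝ} {φ : ℝ}
    (hp : ∀ y ∈ S, ∀ y' ∈ S, y < y' → 0 ≤ p y' - p y ∧ p y' - p y ≤ (y' - y) * φ) :
    Integrable p ν := by
  have hmono : MonotoneOn p S := fun y hy y' hy' h => by
    rcases h.eq_or_lt with rfl | h
    · exact le_rfl
    · exact sub_nonneg.1 (hp y hy y' hy' h).1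
  have hm : AEMeasurable p ν := by
    have := aemeasurable_restrict_of_monotoneOn (μ := ν) hS hmono
    rwa [Measure.restrict_eq_self_of_ae_mem hν] at this
  obtain ⟨z₀, hz₀⟩ := hν.exists
  refine Integrable.mono' (g := fun z => |p z₀| + |(z - z₀) * φ|)
    ((integrable_const _).add ((hi.sub (integrable_const _)).mul_const φ).abs)
    hm.aestronglyMeasurable ?_
  filter_upwards [hν] with z hz
  have h : |p z - p z₀| ≤ |(z - z₀) * φ| := by
    rcases lt_trichotomy z z₀ with h | h | h
    · obtain ⟨h1, h2⟩ := hp z hz z₀ hz₀ h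
      rw [abs_sub_comm, abs_of_nonneg h1]
      refine h2.trans ((le_abs_self _).trans_eq ?_)
      rw [abs_mul, abs_mul, abs_sub_comm]
    · simp [h]
    · obtain ⟨h1, h2⟩ := hp z₀ hz₀ z hz h
      rw [abs_of_nonneg h1]
      exact h2.trans (le_abs_self _)
  have := abs_sub_abs_le_abs_sub (p z) (p z₀)
  rw [Real.norm_eq_abs]
  linarith

theorem integral_mul_add_mul {ν : Measure ℝ} [IsProbabilityMeasure ν] {p : ℝ → ℝ}
    (hp : Integrable p ν) (q α β : ℝ) :
    ∫ z, q * (α + β * p z) ∂ν = q * (α + β * ∫ z, p z ∂ν) := by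
  rw [integral_const_mul, integral_add (integrable_const _) (hp.const_mul _), integral_const_mul,
    integral_const]
  simp

variable {K : Fin N → Kernel ℝ ℝ}

/-- The constraints see utilities only at reports in the reported support, where projections land,
and at incomes that some type can have. -/
theorem Incentives.congr {u u' : Fin N → ℝ → ℝ → ℝ → ℝ} {m' : Mechanism N} (hA : ∀ i, (A i).Valid)
    (h : Incentives A u m) (ht : m'.t = m.t) (hu : ∀ i, ∀ s ∈ (A i).types, ∀ x' ∈ (A i).incomes s,
      ∀ x ∈ (A i).allIncomes, u' i s x' x = u i s x' x) : Incentives A u' m' := by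
  have e1 : ∀ i, ∀ s' ∈ (A i).types, ∀ s ∈ (A i).types,
      expUtility A u' i s' s = expUtility A u i s' s := fun i s' hs' s hs =>
    integral_congr_ae ((Agent.ae_mem_incomes s).mono fun x hx => hu i s' hs' _
      (Agent.proj_mem ((hA i).iLo_lt_iHi s' hs') x) x (Agent.incomes_subset_allIncomes hs hx))
  have e2 : ∀ i s, interimTransfer A m' i s = interimTransfer A m i s := fun i s => by
    simp only [interimTransfer, ht]
  refine ⟨fun i s hs x hx x' hx' => ?_, fun i s hs s' hs' => ?_, fun i s hs => ?_⟩
  · have hx2 := Agent.incomes_subset_allIncomes hs hx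
    rw [hu i s hs x' hx' x hx2, hu i s hs x hx x hx2]
    exact h.ic_income i s hs x hx x' hx'
  · rw [e1 i s' hs' s hs, e1 i s hs s hs, e2, e2]
    exact h.ic_type i s hs s' hs'
  · rw [e1 i s hs s hs, e2]
    exact h.ir i s hs

theorem isClosed_signalSupport (i : Fin N) : IsClosed (signalSupport A K i) := isClosed_closure

theorem ae_mem_signalSupport {i : Fin N} {x : ℝ} (hx : x ∈ (A i).allIncomes) :
    ∀ᵐ z ∂(K i x), z ∈ signalSupport A K i := by
  filter_upwards [Measure.support_mem_ae (μ := K i x)] with z hz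
  exact subset_closure (mem_biUnion hx hz)

theorem repl_mem_histories {i : Fin N} {θ : Fin N → ℝ} {s x' : ℝ} (hθ : θ ∈ profiles A)
    (hs : s ∈ (A i).types) (hx' : x' ∈ (A i).incomes s) : (repl θ i s, x') ∈ histories A i := by
  refine ⟨repl_mem_profiles hθ hs, ?_⟩
  simp only [repl_self]
  exact hx'

section

variable (hK : ValidSignal A K)
include hK

theorem integrable_penalty (hm : DoubleMonotone A (signalSupport A K) m) {i : Fin N}
    {h : (Fin N → ℝ) × ℝ} (hh : h ∈ histories A i) {x : ℝ} (hx : x ∈ (A i).allIncomes) :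
    Integrable (fun z => m.p i h.1 h.2 z) (K i x) :=
  have := hK.markov i
  integrable_of_slope_le (isClosed_signalSupport i).measurableSet (ae_mem_signalSupport hx)
    (hK.integrable i x hx) (hm i h hh)

/-- Effective penalty rules inherit generalized double monotonicity. -/
theorem doubleMonotone_effective (hm : DoubleMonotone A (signalSupport A K) m) :
    DoubleMonotone A (fun i => (A i).allIncomes) (effective K m) := by
  intro i h hh x hx y hy hxy
  have := hK.markov i
  have hd := hK.dominance i x hx y hy hxy
  have ix := integrable_penalty hK hm hh hx
  have iy := integrable_penalty hK hm hh hy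
  have jx : Integrable (fun z => z * (A i).φ) (K i x) := (hK.integrable i x hx).mul_const _
  have jy : Integrable (fun z => z * (A i).φ) (K i y) := (hK.integrable i y hy).mul_const _
  have sx := ae_mem_signalSupport (K := K) hx
  have sy := ae_mem_signalSupport (K := K) hy
  have h1 := integral_le_of_dominance hd sx sy (f := fun z => m.p i h.1 h.2 z)
    (fun z hz z' hz' hzz => by
      rcases hzz.eq_or_lt with rfl | hzz
      · exact le_rfl
      · exact sub_nonneg.1 (hm i h hh z hz z' hz' hzz).1) ix iy
  -- The upper slope bound is dominance for φz minus the penalty, which is also nondecreasing;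
  -- unbiasedness evaluates its linear part.
  have h2 := integral_le_of_dominance hd sx sy (f := fun z => z * (A i).φ - m.p i h.1 h.2 z)
    (fun z hz z' hz' hzz => by
      rcases hzz.eq_or_lt with rfl | hzz
      · exact le_rfl
      · have := (hm i h hh z hz z' hz' hzz).2
        simp only
        linarith) (jx.sub ix) (jy.sub iy)
  rw [integral_sub jx ix, integral_sub jy iy, integral_mul_const, integral_mul_const,
    hK.unbiased i x hx, hK.unbiased i y hy] at h2
  simp only [effective]
  exact ⟨sub_nonneg.2 h1, by linarith⟩

/-- Utility is affine in the penalty, so the expectation over the signal passes onto the penalty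
alone. -/
theorem noisyUtility_eq (hA : ∀ i, (A i).Valid) (hm : DoubleMonotone A (signalSupport A K) m)
    {i : Fin N} {s x' x : ℝ} (hs : s ∈ (A i).types) (hx' : x' ∈ (A i).incomes s)
    (hx : x ∈ (A i).allIncomes) :
    noisyUtility A K m i s x' x = utility A (effective K m) i s x' x := by
  have := hK.markov i
  refine integral_congr_ae ((ae_mem_profiles hA).mono fun θ hθ => ?_)
  have h := integral_mul_add_mul (integrable_penalty hK hm (repl_mem_histories hθ hs hx') hx)
    (m.q i (repl θ i s)) (x - m.r i (repl θ i s) x') (-m.a i (repl θ i s) x')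
  simp only [neg_mul, ← sub_eq_add_neg] at h
  exact h

theorem noisyPayoff_eq (hA : ∀ i, (A i).Valid) (hm : DoubleMonotone A (signalSupport A K) m) :
    noisyPayoff A K m = payoff A (effective K m) := by
  refine Finset.sum_congr rfl fun i _ => ?_
  have := hK.markov i
  refine integral_congr_ae ?_
  filter_upwards [ae_histories hA i, ae_mem_profiles hA] with θ hx hθ
  simp only [effective]
  congr 2
  refine integral_congr_ae (hx.mono fun x hx => ?_)
  have hp := integrable_penalty hK hm hx (Agent.incomes_subset_allIncomes (hθ i) hx.2)
  have h := integral_mul_add_mul hp 1 (m.r i θ x - m.a i θ x * (A i).c) (m.a i θ x)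
  simp only [one_mul] at h
  calc _ = ∫ z, (m.r i θ x - m.a i θ x * (A i).c + m.a i θ x * m.p i θ x z) ∂(K i x) := by
        refine integral_congr_ae (ae_of_all _ fun z => ?_)
        ring
    _ = _ := by
        rw [h]
        ring

theorem effective_wellDefined (hA : ∀ i, (A i).Valid) (hm : WellDefined A (signalSupport A K) m) :
    WellDefined A (fun i => (A i).allIncomes) (effective K m) where
  q_nonneg := hm.q_nonneg
  q_sum := hm.q_sum
  a_mem := hm.a_mem
  q_meas := hm.q_meas
  t_meas := hm.t_meas
  r_meas := hm.r_meas
  a_meas := hm.a_meas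
  t_integrable := hm.t_integrable
  t_interim := hm.t_interim
  p_meas i := by
    have := hK.markov i
    set S := histories A i ×ˢ signalSupport A K i with hS
    -- Extension by zero gives a jointly measurable integrand on the whole space; the signal lies in
    -- its support almost surely, so the integral is unchanged.
    have hP := measurable_indicator_of_subtype
      (f := fun h : ((Fin N → ℝ) × ℝ) × ℝ => m.p i h.1.1 h.1.2 h.2)
      ((measurableSet_histories hA i).prod (isClosed_signalSupport i).measurableSet) (hm.p_meas i)
    have hQ : Measurable fun q : (((Fin N → ℝ) × ℝ) × ℝ) × ℝ =>
        S.indicator (fun h : ((Fin N → ℝ) × ℝ) × ℝ => m.p i h.1.1 h.1.2 h.2) (q.1.1, q.2) :=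
      hP.comp ((measurable_fst.comp measurable_fst).prodMk measurable_snd)
    have hR := hQ.stronglyMeasurable.integral_kernel_prod_right'
      (κ := (K i).comap (Prod.snd : ((Fin N → ℝ) × ℝ) × ℝ → ℝ) measurable_snd)
    have e : (fun h : ↥(histories A i ×ˢ (A i).allIncomes) =>
        (effective K m).p i h.1.1.1 h.1.1.2 h.1.2) = fun h : ↥(histories A i ×ˢ (A i).allIncomes) =>
        ∫ z, S.indicator (fun h : ((Fin N → ℝ) × ℝ) × ℝ => m.p i h.1.1 h.1.2 h.2) (h.1.1, z)
          ∂(K i h.1.2) := by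
      funext h
      refine integral_congr_ae ((ae_mem_signalSupport h.2.2).mono fun z hz => ?_)
      exact (indicator_of_mem (show (h.1.1, z) ∈ S from ⟨h.2.1, hz⟩)
        (fun h : ((Fin N → ℝ) × ℝ) × ℝ => m.p i h.1.1 h.1.2 h.2)).symm
    rw [e]
    exact hR.measurable.comp measurable_subtype_coe

/-- Averaging over the signal can only lower expected absolute payments. -/
theorem effective_finitePayments (hA : ∀ i, (A i).Valid)
    (hm : DoubleMonotone A (signalSupport A K) m) (hf : NoisyFinitePayments A K m) :
    FinitePayments A (effective K m) where
  interim i s hs x' hx' x hx := by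
    have := hK.markov i
    refine lt_of_le_of_lt (lintegral_mono_ae ?_) (hf.interim i s hs x' hx' x hx)
    filter_upwards [ae_mem_profiles hA] with θ hθ
    have h := integral_mul_add_mul (integrable_penalty hK hm (repl_mem_histories hθ hs hx') hx)
      (m.q i (repl θ i s)) (m.r i (repl θ i s) x') (m.a i (repl θ i s) x')
    simp only [effective]
    rw [← h]
    exact enorm_integral_le_lintegral_enorm _
  exAnte i := by
    have := hK.markov i
    refine lt_of_le_of_lt (lintegral_mono_ae ?_) (hf.exAnte i)
    filter_upwards [ae_histories hA i, ae_mem_profiles hA] with θ hx hθ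
    refine lintegral_mono_ae (hx.mono fun x hx => ?_)
    have hp := integrable_penalty hK hm hx (Agent.incomes_subset_allIncomes (hθ i) hx.2)
    have h := integral_mul_add_mul hp (m.q i θ) (m.r i θ x) (m.a i θ x)
    simp only [effective]
    rw [← h]
    exact enorm_integral_le_lintegral_enorm _

theorem effective_feasible (hA : ∀ i, (A i).Valid) (hm : NoisyFeasible A K m) :
    Feasible A (effective K m) where
  wellDefined := effective_wellDefined hK hA hm.wellDefined
  finite := effective_finitePayments hK hA hm.doubleMonotone hm.finite
  doubleMonotone := doubleMonotone_effective hK hm.doubleMonotone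
  incentives := hm.incentives.congr hA rfl fun _ _ hs _ hx' _ hx =>
    (noisyUtility_eq hK hA hm.doubleMonotone hs hx' hx).symm

/-! ### The optimal mechanism under noisy auditing -/

theorem effective_star_p (i : Fin N) (θ : Fin N → ℝ) (x' : ℝ) {x : ℝ} (hx : x ∈ (A i).allIncomes) :
    (effective K (star A)).p i θ x' x = (star A).p i θ x' x := by
  have := hK.markov i
  simp only [effective, star]
  rw [integral_mul_const, integral_sub (hK.integrable i x hx) (integrable_const _),
    hK.unbiased i x hx]
  simp

variable (hA : ∀ i, (A i).Valid)
include hA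

theorem noisyUtility_star {i : Fin N} {s x' x : ℝ} (hs : s ∈ (A i).types)
    (hx' : x' ∈ (A i).incomes s) (hx : x ∈ (A i).allIncomes) :
    noisyUtility A K (star A) i s x' x = utility A (star A) i s x' x := by
  rw [noisyUtility_eq hK hA (star_doubleMonotone hA) hs hx' hx]
  simp only [utility, effective_star_p hK i _ _ hx]
  rfl

theorem noisyPayoff_star : noisyPayoff A K (star A) = payoff A (star A) := by
  rw [noisyPayoff_eq hK hA (star_doubleMonotone hA)]
  refine Finset.sum_congr rfl fun i _ => integral_congr_ae ?_
  filter_upwards [ae_mem_profiles hA] with θ hθ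
  refine congrArg₂ (· + ·) rfl (congrArg₂ (· * ·) rfl ?_)
  refine integral_congr_ae ((Agent.ae_mem_incomes (θ i)).mono fun x hx => ?_)
  simp only [effective_star_p hK i _ _ (Agent.incomes_subset_allIncomes (hθ i) hx)]
  rfl

/-- Signals have linearly bounded absolute first moments. -/
theorem exists_integral_abs_signal_le (i : Fin N) : ∃ C : ℝ, 0 ≤ C ∧
    ∀ x ∈ (A i).allIncomes, ∫ z, |z| ∂(K i x) ≤ x + C := by
  have := hK.markov i
  -- The lowest possible income. As min(z, 0) is nondecreasing in z, dominance makes its mean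
  -- smallest there, and |z| = z − 2 min(z, 0) bounds the absolute moment.
  set x₀ := (A i).iLo (A i).tLo with hx₀
  have hT := (hA i).tLo_mem
  have hmem : x₀ ∈ (A i).allIncomes := Agent.incomes_subset_allIncomes hT
    ⟨le_rfl, ((hA i).iLo_lt_iHi _ hT).le⟩
  have hmin : ∀ x ∈ (A i).allIncomes, x₀ ≤ x := fun x hx => by
    obtain ⟨θ, hθ, hx⟩ := mem_iUnion₂.1 hx
    exact ((hA i).monotoneOn_iLo hT hθ hθ.1).trans hx.1
  have hi : ∀ x ∈ (A i).allIncomes, Integrable (fun z : ℝ => min z 0) (K i x) := fun x hx =>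
    (hK.integrable i x hx).inf (integrable_const 0)
  refine ⟨-(2 * ∫ z, min z 0 ∂(K i x₀)), ?_, fun x hx => ?_⟩
  · have : ∫ z, min z 0 ∂(K i x₀) ≤ (0 : ℝ) := integral_nonpos fun z : ℝ => min_le_right z 0
    linarith
  · have hle : ∫ z, min z 0 ∂(K i x₀) ≤ ∫ z, min z 0 ∂(K i x) := by
      rcases (hmin x hx).eq_or_lt with h | h
      · rw [← h]
      · exact integral_le_of_dominance (hK.dominance i x₀ hmem x hx h) (S := univ)
          (ae_of_all _ fun z => mem_univ z) (ae_of_all _ fun z => mem_univ z)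
          (fun z _ z' _ hz => min_le_min_right 0 hz) (hi x₀ hmem) (hi x hx)
    have e : ∀ z : ℝ, |z| = z - 2 * min z 0 := fun z => by
      rcases le_total 0 z with h | h
      · rw [abs_of_nonneg h, min_eq_right h]
        ring
      · rw [abs_of_nonpos h, min_eq_left h]
        ring
    simp only [e]
    rw [integral_sub (hK.integrable i x hx) ((hi x hx).const_mul 2), integral_const_mul,
      hK.unbiased i x hx]
    linarith

theorem noisyFinitePayments_star : NoisyFinitePayments A K (star A) where
  interim i s hs x' hx' x hx := by
    have := hK.markov i
    have := isProbabilityMeasure_profileLaw hA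
    have hint : Integrable (fun z => (A i).contingentPay s x' z) (K i x) :=
      (integrable_const _).add
        ((((hK.integrable i x hx).sub (integrable_const x')).mul_const _).const_mul _)
    refine lt_of_le_of_lt (lintegral_mono
      (g := fun _ => ∫⁻ z, ‖(A i).contingentPay s x' z‖ₑ ∂(K i x)) fun θ => lintegral_mono fun z => ?_) ?_
    · rw [star_pay, repl_self, enorm_mul]
      refine mul_le_of_le_one_left' ?_
      rw [← enorm_one (G := ℝ), enorm_le_iff_norm_le]
      have := starQ_mem (A := A) i (repl θ i s)
      simp only [star]
      rw [Real.norm_of_nonneg this.1]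
      simpa using this.2
    · rw [lintegral_const, measure_univ, mul_one]
      exact hint.2
  exAnte i := by
    have := hK.markov i
    have := isProbabilityMeasure_profileLaw hA
    obtain ⟨C, hC0, hC⟩ := exists_integral_abs_signal_le hK hA i
    refine lt_of_le_of_lt (lintegral_mono_ae
      (g := fun _ => ENNReal.ofReal (3 * (A i).tHi + C)) ?_) (by simp)
    filter_upwards [ae_mem_profiles hA] with θ hθ
    have hprob := (hA i).incomeLaw_prob _ (hθ i)
    have hinc := (hA i).income_integrable _ (hθ i)
    have h1 : ∫⁻ x, ENNReal.ofReal (3 * x + C) ∂((A i).incomeLaw (θ i))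
        = ENNReal.ofReal (3 * θ i + C) := by
      have hlin : Integrable (fun x => 3 * x + C) ((A i).incomeLaw (θ i)) :=
        (hinc.const_mul 3).add (integrable_const C)
      rw [← ofReal_integral_eq_lintegral_ofReal hlin
        (((hA i).ae_nonneg_income (hθ i)).mono fun x hx => add_nonneg (mul_nonneg (by norm_num) hx) hC0),
        integral_add (hinc.const_mul 3) (integrable_const C), integral_const_mul,
        (hA i).income_mean _ (hθ i)]
      simp
    refine (lintegral_mono_ae ?_).trans (h1.le.trans (ENNReal.ofReal_le_ofReal
      (by linarith [(hθ i).2])))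
    filter_upwards [Agent.ae_mem_incomes (θ i)] with x hx
    have hxa := Agent.incomes_subset_allIncomes (hθ i) hx
    have hx0 := (hA i).allIncomes_nonneg hxa
    have hiz : Integrable (fun z => |z|) (K i x) := (hK.integrable i x hxa).abs
    -- The royalty is at most x and the penalty at most |z| + x in absolute value. With the mean of
    -- |z| at most x + C, this accounts for 3x + C.
    have hz : ∀ z, ‖(star A).q i θ * ((star A).r i θ x + (star A).a i θ x * (star A).p i θ x z)‖
        ≤ 2 * x + |z| := by
      intro z
      have hq := starQ_mem (A := A) i θ
      have hc := (hA i).cappedIncome_mem (hθ i) hx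
      have ha := Agent.auditRule_mem (A := A i) (θ i) x
      have hφ := (hA i).φ_mem
      have b1 : |(A i).cappedIncome (θ i) x * (A i).φ| ≤ x := by
        rw [abs_of_nonneg (mul_nonneg hc.1 hφ.1)]
        exact (mul_le_of_le_one_right hc.1 hφ.2).trans hc.2
      have b2 : |(A i).auditRule (θ i) x * ((z - x) * (A i).φ)| ≤ |z| + x := by
        rw [abs_mul, abs_mul, abs_of_nonneg ha.1, abs_of_nonneg hφ.1]
        refine (mul_le_of_le_one_left (mul_nonneg (abs_nonneg _) hφ.1) ha.2).trans
          ((mul_le_of_le_one_right (abs_nonneg _) hφ.2).trans ?_)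
        exact (abs_sub _ _).trans_eq (by rw [abs_of_nonneg hx0])
      rw [star_pay, norm_mul, Real.norm_of_nonneg (show 0 ≤ (star A).q i θ from hq.1)]
      refine (mul_le_of_le_one_left (norm_nonneg _) hq.2).trans ((norm_add_le _ _).trans ?_)
      rw [Real.norm_eq_abs, Real.norm_eq_abs]
      linarith
    calc _ ≤ ∫⁻ z, ENNReal.ofReal (2 * x + |z|) ∂(K i x) := lintegral_mono fun z => by
          rw [← ofReal_norm]
          exact ENNReal.ofReal_le_ofReal (hz z)
      _ = ENNReal.ofReal (∫ z, (2 * x + |z|) ∂(K i x)) :=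
          (ofReal_integral_eq_lintegral_ofReal ((integrable_const _).add hiz)
            (ae_of_all _ fun z => add_nonneg (mul_nonneg zero_le_two hx0) (abs_nonneg z))).symm
      _ ≤ ENNReal.ofReal (3 * x + C) := by
          refine ENNReal.ofReal_le_ofReal ?_
          rw [integral_add (integrable_const _) hiz, integral_const]
          have := hC x hxa
          simp
          linarith

variable (hreg : ∀ i, (A i).Regular)
include hreg

theorem star_noisyFeasible : NoisyFeasible A K (star A) where
  wellDefined := star_wellDefined hA hreg
  finite := noisyFinitePayments_star hK hA
  doubleMonotone := star_doubleMonotone hA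
  incentives := (star_incentives hA hreg).congr hA rfl fun _ _ hs _ hx' _ hx =>
    noisyUtility_star hK hA hs hx' hx

/-- A feasible noisy mechanism earns what a feasible mechanism with perfect auditing earns, and the
perfect-auditing optimum survives noise with its payoff intact. -/
theorem star_noisyOptimal : NoisyOptimal A K (star A) := by
  refine ⟨star_noisyFeasible hK hA hreg, fun m hm => ?_⟩
  rw [noisyPayoff_eq hK hA hm.doubleMonotone, noisyPayoff_star hK hA]
  exact payoff_le_star hA hreg (effective_feasible hK hA hm)

end

end CostlyAudit

end

theorem mainTheorem6 (N : ℕ) (A : Fin N → CostlyAudit.Agent)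
    (hA : ∀ i, (A i).Valid) (hreg : ∀ i, (A i).Regular)
    (K : Fin N → ProbabilityTheory.Kernel ℝ ℝ) (hK : CostlyAudit.ValidSignal A K) :
    -- effective penalty rules inherit generalized double monotonicity
    (∀ m : CostlyAudit.Mechanism N,
      CostlyAudit.DoubleMonotone A (CostlyAudit.signalSupport A K) m →
      CostlyAudit.DoubleMonotone A (fun i => (A i).allIncomes) (CostlyAudit.effective K m)) ∧
    -- every feasible noisy mechanism is equivalent to a feasible mechanism with perfect auditing
    (∀ m : CostlyAudit.Mechanism N, CostlyAudit.NoisyFeasible A K m →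
      CostlyAudit.Feasible A (CostlyAudit.effective K m) ∧
      (∀ i, ∀ s ∈ (A i).types, ∀ x' ∈ (A i).incomes s, ∀ x ∈ (A i).allIncomes,
        CostlyAudit.noisyUtility A K m i s x' x =
          CostlyAudit.utility A (CostlyAudit.effective K m) i s x' x) ∧
      CostlyAudit.noisyPayoff A K m = CostlyAudit.payoff A (CostlyAudit.effective K m)) ∧
    -- with the signal in place of income, the effective penalty is the perfect-auditing one
    (∀ i, ∀ h ∈ CostlyAudit.histories A i, ∀ x ∈ (A i).allIncomes,
      (CostlyAudit.effective K (CostlyAudit.star A)).p i h.1 h.2 x =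
        (CostlyAudit.star A).p i h.1 h.2 x) ∧
    -- the mechanism is optimal with perfect auditing and with noisy auditing, with equal payoffs
    CostlyAudit.Optimal A (CostlyAudit.star A) ∧
    CostlyAudit.NoisyOptimal A K (CostlyAudit.star A) ∧
    CostlyAudit.noisyPayoff A K (CostlyAudit.star A) =
      CostlyAudit.payoff A (CostlyAudit.star A) := by
  refine ⟨fun m hm => CostlyAudit.doubleMonotone_effective hK hm, fun m hm =>
    ⟨CostlyAudit.effective_feasible hK hA hm, fun i s hs x' hx' x hx =>
      CostlyAudit.noisyUtility_eq hK hA hm.doubleMonotone hs hx' hx,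
      CostlyAudit.noisyPayoff_eq hK hA hm.doubleMonotone⟩,
    fun i h _ x hx => CostlyAudit.effective_star_p hK i h.1 h.2 hx,
    CostlyAudit.star_optimal hA hreg, CostlyAudit.star_noisyOptimal hK hA hreg,
    CostlyAudit.noisyPayoff_star hK hA⟩
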